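/- Let $n\ge 1$ be an integer. On $\mathbb{C}^n$ let $|z|=(\sum_j|z_j|^2)^{1/2}$, and let $dV$ be Lebesgue measure normalized so that $\int_{\mathbb{C}^n} e^{-|z|^2}\,dV(z)=1$. For real $\alpha,\beta$ let $F^1_\alpha$ be the space of entire functions $g$ on $\mathbb{C}^n$ with $$\|g\|_{F^1_\alpha}=\int_{\mathbb{C}^n}|g(z)|e^{-\frac12|z|^2}\frac{dV(z)}{(1+|z|)^{\alpha}}<\infty ,$$ let $F^\infty_\beta$ be the space of entire functions $f$ on $\mathbb{C}^n$ with $$\|f\|_{F^\infty_\beta}=\operatorname*{ess\,sup}_{z\in\mathbb{C}^n}\frac{|f(z)|e^{-\frac12|z|^2}}{(1+|z|)^{\beta}}<\infty ,$$ and let $F^{\infty,0}_\beta$, with the norm of $F^\infty_\beta$, be the subspace of all $f\in F^\infty_\beta$ with $\lim_{|z|\to\infty}|f(z)|e^{-\frac12|z|^2}(1+|z|)^{-\beta}=0$. For an entire function $f$ with homogeneous expansion $f=\sum_{k\ge0}f_k$ and real $s$ put $f_s^-=\sum_{k\le|s|}f_k$ and $f_s^+=f-f_s^-$. For real $\sigma$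 put $(\psi,\varphi)_\sigma=\int_{\mathbb{C}^n}\psi(z)\overline{\varphi(z)}e^{-|z|^2}|z|^{-\sigma}\,dV(z)$ and $$\langle f,g\rangle_\sigma=\begin{cases}(f,g)_\sigma & \text{if }\sigma<2n,\\ (f_{\sigma/2}^-,g_{\sigma/2}^-)_0+(f_{\sigma/2}^+,g_{\sigma/2}^+)_\sigma & \text{if }\sigma\ge 2n.\end{cases}$$ Theorem 5.8. Let $\alpha$ and $\beta$ be real numbers. Then $(F^{\infty,0}_\beta)^*=F^1_\alpha$ with equivalent norms under the pairing $\langle\cdot,\cdot\rangle_{\alpha+\beta}$. That is, the integrals defining $\langle f,g\rangle_{\alpha+\beta}$ converge absolutely for all $f\in F^{\infty,0}_\beta$ and $g\in F^1_\alpha$; the map $g\mapsto\langle\cdot,g\rangle_{\alpha+\beta}$ is a conjugate-linear bijection of $F^1_\alpha$ onto the space $(F^{\infty,0}_\beta)^*$ of bounded linear functionals on $F^{\infty,0}_\beta$; and there is a constant $C=C(n,\alpha,\beta)>0$ such that $$C^{-1}\|g\|_{F^1_\alpha}\le\|\langle\cdot,g\rangle_{\alpha+\beta}\|_{(F^{\infty,0}_\beta)^*}\le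 C\|g\|_{F^1_\alpha}\qquad\text{for all }g\in F^1_\alpha .$$ -/

import Mathlib

open MeasureTheory Filter Topology
open scoped ENNReal ComplexConjugate

/-- The space `ℂⁿ` with the Hermitian norm `|z| = (∑ |z_j|²)^{1/2}`. -/
abbrev Cn (n : ℕ) : Type := EuclideanSpace ℂ (Fin n)

/-- The volume measure `dV` on `ℂⁿ`, normalized by `∫ e^{-|z|²} dV(z) = 1`, that is `π^{-n}` times
Lebesgue measure. -/
noncomputable def fockVol (n : ℕ) : Measure (Cn n) :=
  ENNReal.ofReal ((Real.pi ^ n)⁻¹) • volume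

/-- The normalization of `fockVol`. -/
theorem integral_exp_fockVol (n : ℕ) :
    ∫ z : Cn n, Real.exp (-‖z‖ ^ 2) ∂(fockVol n) = 1 := by
  have h := GaussianFourier.integral_rexp_neg_mul_sq_norm (V := Cn n) (b := 1) one_pos
  have hd : Module.finrank ℝ (Cn n) = 2 * n := by
    rw [← Module.finrank_mul_finrank ℝ ℂ (Cn n)]
    simp
  rw [hd] at h
  have hp : (0 : ℝ) < Real.pi ^ n := by positivity
  have h2 : ∫ v : Cn n, Real.exp (-‖v‖ ^ 2) = Real.pi ^ n := by
    simpa using h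
  rw [fockVol, integral_smul_measure, h2, ENNReal.toReal_ofReal (by positivity), smul_eq_mul]
  exact inv_mul_cancel₀ hp.ne'

instance fockVol_isOpenPosMeasure (n : ℕ) : (fockVol n).IsOpenPosMeasure := by
  refine ⟨fun U hU hne h => hU.measure_ne_zero volume hne ?_⟩
  rw [fockVol, Measure.smul_apply, smul_eq_mul, mul_eq_zero, ENNReal.ofReal_eq_zero] at h
  refine h.resolve_left (not_le.2 ?_)
  positivity

/-- The exponent of `1 + |z|` in the weight: `α / p` for finite `p`, and `α` for `p = ∞`. -/
noncomputable def fockExponent (p : ℝ≥0∞) (α : ℝ) : ℝ :=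
  if p = ∞ then α else α / p.toReal

/-- The weighted function `z ↦ f(z) e^{-|z|²/2} (1 + |z|)^{-α/p}` (with `α` in place of `α/p` when
`p = ∞`). Its `L^p(dV)` norm is the norm of `f` in `L^p_α`: it is
`(∫ |f(z) e^{-|z|²/2}|^p (1 + |z|)^{-α} dV(z))^{1/p}` for finite `p`, and
`ess sup |f(z)| e^{-|z|²/2} / (1 + |z|)^α` for `p = ∞`. -/
noncomputable def fockWeighted {n : ℕ} (p : ℝ≥0∞) (α : ℝ) (f : Cn n → ℂ) (z : Cn n) : ℂ :=
  ((Real.exp (-‖z‖ ^ 2 / 2) * (1 + ‖z‖) ^ (-fockExponent p α) : ℝ) : ℂ) * f z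

/-- The entire functions on `ℂⁿ` that belong to `L^p_α`, as a linear subspace of all functions. -/
noncomputable def fockSubmodule (n : ℕ) (p : ℝ≥0∞) (α : ℝ) : Submodule ℂ (Cn n → ℂ) where
  carrier := {f | Differentiable ℂ f ∧ MemLp (fockWeighted p α f) p (fockVol n)}
  add_mem' := by
    rintro f g ⟨hf, hf'⟩ ⟨hg, hg'⟩
    refine ⟨hf.add hg, ?_⟩
    have h : fockWeighted p α (f + g) = fockWeighted p α f + fockWeighted p α g := by
      funext z
      simp only [fockWeighted, Pi.add_apply, mul_add]
    rw [h]
    exact hf'.add hg'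
  zero_mem' := by
    refine ⟨differentiable_const 0, ?_⟩
    have h : fockWeighted p α (0 : Cn n → ℂ) = 0 := by
      funext z
      simp only [fockWeighted, Pi.zero_apply, mul_zero]
    rw [h]
    exact MemLp.zero
  smul_mem' := by
    rintro c f ⟨hf, hf'⟩
    refine ⟨hf.const_smul c, ?_⟩
    have h : fockWeighted p α (c • f) = c • fockWeighted p α f := by
      funext z
      simp only [fockWeighted, Pi.smul_apply, smul_eq_mul]
      ring
    rw [h]
    exact hf'.const_smul c

/-- The weighted Fock space `F^p_α`. It is a type of its own, so that it carries the topology of its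
norm and not that of pointwise convergence. -/
def FockSpace (n : ℕ) (p : ℝ≥0∞) (α : ℝ) : Type := fockSubmodule n p α

namespace FockSpace

variable {n : ℕ} {p : ℝ≥0∞} {α : ℝ}

noncomputable instance : AddCommGroup (FockSpace n p α) :=
  inferInstanceAs (AddCommGroup (fockSubmodule n p α))

noncomputable instance : Module ℂ (FockSpace n p α) :=
  inferInstanceAs (Module ℂ (fockSubmodule n p α))

instance : CoeFun (FockSpace n p α) (fun _ => Cn n → ℂ) := ⟨fun f => f.1⟩

/-- The linear map `f ↦ f(z) e^{-|z|²/2} (1 + |z|)^{-α/p}` of `F^p_α` into `L^p(dV)`. -/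
noncomputable def toLp : FockSpace n p α →ₗ[ℂ] Lp ℂ p (fockVol n) where
  toFun f := f.2.2.toLp (fockWeighted p α f)
  map_add' f g := by
    rw [← MemLp.toLp_add]
    congr 1
    funext z
    exact mul_add _ (f z) (g z)
  map_smul' c f := by
    rw [RingHom.id_apply, ← MemLp.toLp_const_smul]
    congr 1
    funext z
    exact mul_left_comm _ c (f z)

theorem continuous_fockWeighted (f : FockSpace n p α) : Continuous (fockWeighted p α f) := by
  have hf : Continuous f.1 := f.2.1.continuous
  refine Continuous.mul (Complex.continuous_ofReal.comp ?_) hf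
  refine Continuous.mul (by fun_prop) ?_
  refine Continuous.rpow_const (by fun_prop) fun z => Or.inl ?_
  positivity

theorem toLp_injective : Function.Injective (toLp : FockSpace n p α → Lp ℂ p (fockVol n)) := by
  intro f g h
  have h1 : fockWeighted p α f =ᵐ[fockVol n] fockWeighted p α g :=
    (MemLp.toLp_eq_toLp_iff f.2.2 g.2.2).1 h
  have h2 := (Continuous.ae_eq_iff_eq (fockVol n) (continuous_fockWeighted f)
    (continuous_fockWeighted g)).1 h1
  refine Subtype.ext (funext fun z => ?_)
  have h3 := congrFun h2 z
  refine mul_left_cancel₀ ?_ h3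
  rw [Ne, Complex.ofReal_eq_zero]
  positivity

/-- The norm of `F^p_α`, for `1 ≤ p ≤ ∞`: the `L^p(dV)` norm of the weighted function. -/
noncomputable instance [Fact (1 ≤ p)] : NormedAddCommGroup (FockSpace n p α) :=
  NormedAddCommGroup.induced (FockSpace n p α) (Lp ℂ p (fockVol n)) toLp toLp_injective

noncomputable instance [Fact (1 ≤ p)] : NormedSpace ℂ (FockSpace n p α) :=
  NormedSpace.induced ℂ (FockSpace n p α) (Lp ℂ p (fockVol n)) toLp

theorem norm_def [Fact (1 ≤ p)] (f : FockSpace n p α) :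
    ‖f‖ = (eLpNorm (fockWeighted p α f) p (fockVol n)).toReal :=
  Lp.norm_toLp _ f.2.2

end FockSpace

/-- The little space `F^{∞,0}_β`: the subspace of all `f` in `F^∞_β` with
`|f(z)| e^{-|z|²/2} / (1 + |z|)^β → 0` as `|z| → ∞`, with the norm of `F^∞_β`. -/
noncomputable def littleFock (n : ℕ) (β : ℝ) : Submodule ℂ (FockSpace n ∞ β) where
  carrier := {f | Tendsto (fun z => ‖f z‖ * Real.exp (-‖z‖ ^ 2 / 2) / (1 + ‖z‖) ^ β)
    (cocompact (Cn n)) (𝓝 0)}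
  add_mem' := by
    intro f g hf hg
    have h := Tendsto.add hf hg
    rw [add_zero] at h
    refine squeeze_zero (fun z => by positivity) (fun z => ?_) h
    rw [← add_div, ← add_mul]
    gcongr
    exact norm_add_le (f z) (g z)
  zero_mem' := by
    refine Tendsto.congr (fun z => ?_) tendsto_const_nhds
    change 0 = ‖(0 : ℂ)‖ * _ / _
    simp
  smul_mem' := by
    intro c f hf
    have h := Tendsto.const_mul ‖c‖ hf
    rw [mul_zero] at h
    refine Tendsto.congr (fun z => ?_) h
    change _ = ‖c * f z‖ * _ / _
    rw [norm_mul]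
    ring

/-- The homogeneous part `f_k` of degree `k` of the Taylor expansion of `f` at the origin. -/
noncomputable def homogPart {n : ℕ} (k : ℕ) (f : Cn n → ℂ) (z : Cn n) : ℂ :=
  ((k.factorial : ℂ))⁻¹ * iteratedFDeriv ℂ k f 0 (fun _ => z)

/-- `f_s^- = ∑_{k ≤ |s|} f_k`. -/
noncomputable def taylorHead {n : ℕ} (s : ℝ) (f : Cn n → ℂ) (z : Cn n) : ℂ :=
  ∑ k ∈ Finset.range (⌊|s|⌋₊ + 1), homogPart k f z

/-- `f_s^+ = f - f_s^-`. -/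
noncomputable def taylorTail {n : ℕ} (s : ℝ) (f : Cn n → ℂ) (z : Cn n) : ℂ :=
  f z - taylorHead s f z

/-- The integrand `ψ(z) conj(φ(z)) e^{-|z|²} |z|^{-σ}`. -/
noncomputable def rawIntegrand {n : ℕ} (σ : ℝ) (ψ φ : Cn n → ℂ) (z : Cn n) : ℂ :=
  ψ z * conj (φ z) * ((Real.exp (-‖z‖ ^ 2) * ‖z‖ ^ (-σ) : ℝ) : ℂ)

/-- `(ψ, φ)_σ = ∫ ψ(z) conj(φ(z)) e^{-|z|²} |z|^{-σ} dV(z)`. -/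
noncomputable def rawPairing {n : ℕ} (σ : ℝ) (ψ φ : Cn n → ℂ) : ℂ :=
  ∫ z, rawIntegrand σ ψ φ z ∂(fockVol n)

/-- The pairing `⟨f, g⟩_σ`: it is `(f, g)_σ` if `σ < 2n`, and
`(f_{σ/2}^-, g_{σ/2}^-)_0 + (f_{σ/2}^+, g_{σ/2}^+)_σ` if `σ ≥ 2n`. -/
noncomputable def fockPairing {n : ℕ} (σ : ℝ) (f g : Cn n → ℂ) : ℂ :=
  if σ < 2 * n then rawPairing σ f g
  else rawPairing 0 (taylorHead (σ / 2) f) (taylorHead (σ / 2) g) +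
    rawPairing σ (taylorTail (σ / 2) f) (taylorTail (σ / 2) g)

/-- The integrals in the definition of `⟨f, g⟩_σ` converge absolutely. -/
def FockPairingConverges {n : ℕ} (σ : ℝ) (f g : Cn n → ℂ) : Prop :=
  if σ < 2 * n then Integrable (rawIntegrand σ f g) (fockVol n)
  else Integrable (rawIntegrand 0 (taylorHead (σ / 2) f) (taylorHead (σ / 2) g)) (fockVol n) ∧
    Integrable (rawIntegrand σ (taylorTail (σ / 2) f) (taylorTail (σ / 2) g)) (fockVol n)

/-!
Put `σ = α + β` and `ε_k = Γ(n + k - σ/2) / Γ(n + k)`, replaced by `1` in the degrees `k ≤ |σ|/2`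
if `σ ≥ 2n`. Polar coordinates show that on polynomials of degree `k` the pairing `⟨·,·⟩_σ` is
`ε_k` times the pairing `(·,·)_0`, for which `⟨z, ·⟩^k / k!` reproduces the homogeneous part of
degree `k` at `z`.

Multiplication by `e^{-|u|²/2} (1 + |u|)^{-β}` embeds `F^{∞,0}_β` isometrically into `C₀(ℂⁿ)`, so by
Hahn–Banach a bounded functional on `F^{∞,0}_β` extends, after a conjugation, to a functional `L` on
`C₀(ℂⁿ)`. The function representing it is `g(z) = L(K_z)`, where `K_z` is the weighted kernel
`u ↦ e^{-|u|²/2} (1 + |u|)^{-β} ∑_k ε_k⁻¹ ⟨u, z⟩^k / k!`. It belongs to `F^1_α` because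
`∫ |∑_k ε_k⁻¹ ⟨u, z⟩^k / k!| e^{-|z|²/2} (1 + |z|)^{-α} dV(z)` is at most a constant times
`e^{|u|²/2} (1 + |u|)^β`: up to a polynomial factor in `k`, `ε_k⁻¹` is a moment of a Beta
distribution, so that the kernel is an average of dilated exponentials `e^{t⟨u, z⟩}` and their
derivatives. The functionals `μ` and `⟨·, g⟩_σ` agree on the monomials `⟨z, ·⟩^k`, and these span a
dense subspace, since every `f` is the limit of its dilations `f(r·)`, which are integrals of
exponential kernels.
-/

open scoped ZeroAtInfty

section GaussianAverages

theorem one_add_rpow_le_mul {r s d : ℝ} (hr : 0 ≤ r) (hs : 0 ≤ s) (hd : |r - s| ≤ d) (a : ℝ) :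
    (1 + r) ^ a ≤ (1 + s) ^ a * (1 + d) ^ |a| := by
  have d_nonneg : 0 ≤ d := (abs_nonneg _).trans hd
  have one_add_le {x y : ℝ} (hy : 0 ≤ y) (hxy : |x - y| ≤ d) : 1 + x ≤ (1 + y) * (1 + d) := by
    nlinarith [abs_le.1 hxy]
  rcases le_total 0 a with ha | ha
  · rw [abs_of_nonneg ha, ← Real.mul_rpow (by positivity) (by positivity)]
    exact Real.rpow_le_rpow (by positivity) (one_add_le hs hd) ha
  · rw [abs_of_nonpos ha, Real.rpow_neg (by positivity), ← div_eq_mul_inv,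
      le_div_iff₀ (by positivity), ← Real.mul_rpow (by positivity) (by positivity)]
    exact Real.rpow_le_rpow_of_nonpos (by positivity) (one_add_le hr (abs_sub_comm r s ▸ hd)) ha

/-- Peetre's inequality. -/
theorem one_add_norm_rpow_le_mul {E : Type*} [SeminormedAddCommGroup E] (z w : E) (a : ℝ) :
    (1 + ‖z‖) ^ a ≤ (1 + ‖w‖) ^ a * (1 + ‖z - w‖) ^ |a| :=
  one_add_rpow_le_mul (norm_nonneg z) (norm_nonneg w) (abs_norm_sub_norm_le z w) a

theorem continuous_one_add_norm_rpow {E : Type*} [SeminormedAddCommGroup E] (a : ℝ) :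
    Continuous fun z : E => (1 + ‖z‖) ^ a :=
  Continuous.rpow_const (by fun_prop) fun z => Or.inl (by positivity)

theorem exists_one_add_rpow_mul_exp_le (a T : ℝ) {b : ℝ} (hb : 0 < b) :
    ∃ C : ℝ, 0 < C ∧ ∀ r : ℝ, 0 ≤ r → (1 + r) ^ a * Real.exp (T * r - b * r ^ 2) ≤ C := by
  set N := ⌈|a|⌉₊
  refine ⟨N.factorial * Real.exp (1 + (T + 1) ^ 2 / (4 * b)), by positivity, fun r hr => ?_⟩
  have power_le : (1 + r) ^ a ≤ N.factorial * Real.exp (1 + r) := by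
    calc (1 + r) ^ a ≤ (1 + r) ^ (N : ℝ) :=
          Real.rpow_le_rpow_of_exponent_le (by linarith)
            ((le_abs_self a).trans (Nat.le_ceil _))
      _ = (1 + r) ^ N := Real.rpow_natCast _ _
      _ ≤ N.factorial * Real.exp (1 + r) := by
        rw [mul_comm, ← div_le_iff₀ (by positivity)]
        exact Real.pow_div_factorial_le_exp (1 + r) (by linarith) N
  have exponent_le : (T + 1) * r - b * r ^ 2 ≤ (T + 1) ^ 2 / (4 * b) := by
    rw [le_div_iff₀ (by positivity)]
    nlinarith [sq_nonneg (2 * b * r - (T + 1))]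
  calc (1 + r) ^ a * Real.exp (T * r - b * r ^ 2)
      ≤ N.factorial * Real.exp (1 + r) * Real.exp (T * r - b * r ^ 2) := by gcongr
    _ = N.factorial * Real.exp (1 + ((T + 1) * r - b * r ^ 2)) := by
        rw [mul_assoc, ← Real.exp_add]
        ring_nf
    _ ≤ N.factorial * Real.exp (1 + (T + 1) ^ 2 / (4 * b)) := by gcongr

theorem one_add_norm_rpow_mul_gaussian_sub_le {E : Type*} [SeminormedAddCommGroup E] (a : ℝ)
    (z w : E) :
    (1 + ‖z‖) ^ a * Real.exp (-‖z - w‖ ^ 2 / 2) ≤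
      (1 + ‖w‖) ^ a * ((1 + ‖z - w‖) ^ |a| * Real.exp (-‖z - w‖ ^ 2 / 2)) := by
  rw [← mul_assoc]
  gcongr
  exact one_add_norm_rpow_le_mul z w a

variable {E : Type*} [NormedAddCommGroup E] [NormedSpace ℝ E] [FiniteDimensional ℝ E]
  [MeasurableSpace E] [BorelSpace E] (μ : Measure E) [μ.IsAddHaarMeasure]

theorem integrable_one_add_norm_rpow_mul_exp (a T : ℝ) {b : ℝ} (hb : 0 < b) :
    Integrable (fun z : E => (1 + ‖z‖) ^ a * Real.exp (T * ‖z‖ - b * ‖z‖ ^ 2)) μ := by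
  set d : ℝ := Module.finrank ℝ E + 1
  obtain ⟨C, -, hC⟩ := exists_one_add_rpow_mul_exp_le (a + d) T hb
  refine ((integrable_one_add_norm (μ := μ) (r := d) (by simp [d])).const_mul C).mono'
    ((continuous_one_add_norm_rpow a).mul (by fun_prop)).aestronglyMeasurable
    (Eventually.of_forall fun z => ?_)
  rw [Real.norm_of_nonneg (by positivity), Real.rpow_neg (by positivity), ← div_eq_mul_inv,
    le_div_iff₀ (by positivity), mul_right_comm, ← Real.rpow_add (by positivity)]
  exact hC ‖z‖ (norm_nonneg z)

theorem integrable_one_add_norm_rpow_mul_gaussian (a : ℝ) :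
    Integrable (fun z : E => (1 + ‖z‖) ^ a * Real.exp (-‖z‖ ^ 2 / 2)) μ := by
  refine (integrable_one_add_norm_rpow_mul_exp μ a 0 (b := 1 / 2) (by norm_num)).congr
    (Eventually.of_forall fun z => ?_)
  ring_nf

theorem integrable_one_add_norm_rpow_mul_gaussian_sub (a : ℝ) (w : E) :
    Integrable (fun z : E => (1 + ‖z‖) ^ a * Real.exp (-‖z - w‖ ^ 2 / 2)) μ := by
  refine (((integrable_one_add_norm_rpow_mul_gaussian μ |a|).comp_sub_right w).const_mul
    ((1 + ‖w‖) ^ a)).mono'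
    ((continuous_one_add_norm_rpow a).mul (by fun_prop)).aestronglyMeasurable
    (Eventually.of_forall fun z => ?_)
  rw [Real.norm_of_nonneg (by positivity)]
  exact one_add_norm_rpow_mul_gaussian_sub_le a z w

theorem exists_integral_one_add_norm_rpow_mul_gaussian_sub_le (a : ℝ) : ∃ C : ℝ, 0 ≤ C ∧
    ∀ w : E, ∫ z, (1 + ‖z‖) ^ a * Real.exp (-‖z - w‖ ^ 2 / 2) ∂μ ≤ C * (1 + ‖w‖) ^ a := by
  refine ⟨∫ z, (1 + ‖z‖) ^ |a| * Real.exp (-‖z‖ ^ 2 / 2) ∂μ,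
    integral_nonneg fun z => by positivity, fun w => ?_⟩
  calc ∫ z, (1 + ‖z‖) ^ a * Real.exp (-‖z - w‖ ^ 2 / 2) ∂μ
      ≤ ∫ z, (1 + ‖w‖) ^ a * ((1 + ‖z - w‖) ^ |a| * Real.exp (-‖z - w‖ ^ 2 / 2)) ∂μ :=
        integral_mono (integrable_one_add_norm_rpow_mul_gaussian_sub μ a w)
          (((integrable_one_add_norm_rpow_mul_gaussian μ |a|).comp_sub_right w).const_mul _)
          fun z => one_add_norm_rpow_mul_gaussian_sub_le a z w
    _ = (∫ z, (1 + ‖z‖) ^ |a| * Real.exp (-‖z‖ ^ 2 / 2) ∂μ) * (1 + ‖w‖) ^ a := by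
        rw [integral_const_mul, mul_comm,
          integral_sub_right_eq_self (fun z => (1 + ‖z‖) ^ |a| * Real.exp (-‖z‖ ^ 2 / 2))]

end GaussianAverages

instance fockVol_isAddHaarMeasure (n : ℕ) : (fockVol n).IsAddHaarMeasure := by
  refine Measure.IsAddHaarMeasure.smul volume ?_ ENNReal.ofReal_ne_top
  rw [Ne, ENNReal.ofReal_eq_zero, not_le]
  positivity

theorem finrank_real_Cn (n : ℕ) : Module.finrank ℝ (Cn n) = 2 * n := by
  rw [← Module.finrank_mul_finrank ℝ ℂ (Cn n)]
  simp

/-- The weight `w_γ(z) = e^{-|z|²/2} (1 + |z|)^{-γ}`; the norms of `F^1_α` and `F^∞_β` are those of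
`w_α g` in `L¹` and of `w_β f` in `L^∞`, and `w_γ w_{-γ}` is the Gaussian `e^{-|z|²}`. -/
noncomputable def fockWeight {n : ℕ} (γ : ℝ) (z : Cn n) : ℝ :=
  Real.exp (-‖z‖ ^ 2 / 2) * (1 + ‖z‖) ^ (-γ)

section FockWeight

variable {n : ℕ}

theorem fockWeight_pos (γ : ℝ) (z : Cn n) : 0 < fockWeight γ z := by
  unfold fockWeight; positivity

theorem norm_fockWeight_mul (γ : ℝ) (z : Cn n) (x : ℂ) :
    ‖(fockWeight γ z : ℂ) * x‖ = fockWeight γ z * ‖x‖ := by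
  rw [norm_mul, Complex.norm_of_nonneg (fockWeight_pos γ z).le]

theorem continuous_fockWeight (γ : ℝ) : Continuous (fockWeight γ : Cn n → ℝ) :=
  Continuous.mul (by fun_prop) (continuous_one_add_norm_rpow _)

theorem fockWeight_mul_neg (γ : ℝ) (z : Cn n) :
    fockWeight γ z * fockWeight (-γ) z = Real.exp (-‖z‖ ^ 2) := by
  unfold fockWeight
  rw [neg_neg, mul_mul_mul_comm, ← Real.exp_add, ← Real.rpow_add (by positivity), neg_add_cancel,
    Real.rpow_zero, mul_one, add_halves]

theorem fockWeight_add (γ δ : ℝ) (z : Cn n) :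
    fockWeight (γ + δ) z = fockWeight γ z * (1 + ‖z‖) ^ (-δ) := by
  unfold fockWeight
  rw [mul_assoc, ← Real.rpow_add (by positivity), neg_add]

theorem fockWeight_mul_exp_eq (γ T : ℝ) (z : Cn n) : fockWeight γ z * Real.exp (T * ‖z‖) =
    (1 + ‖z‖) ^ (-γ) * Real.exp (T * ‖z‖ - 1 / 2 * ‖z‖ ^ 2) := by
  unfold fockWeight
  rw [mul_right_comm, ← Real.exp_add, mul_comm]
  ring_nf

theorem exists_fockWeight_mul_exp_le (n : ℕ) (γ T : ℝ) :
    ∃ C : ℝ, 0 < C ∧ ∀ z : Cn n, fockWeight γ z * Real.exp (T * ‖z‖) ≤ C := by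
  obtain ⟨C, hC, hle⟩ := exists_one_add_rpow_mul_exp_le (-γ) T (b := 1 / 2) (by norm_num)
  refine ⟨C, hC, fun z => ?_⟩
  rw [fockWeight_mul_exp_eq]
  exact hle _ (norm_nonneg z)

theorem tendsto_fockWeight_mul_exp (γ T : ℝ) :
    Tendsto (fun z : Cn n => fockWeight γ z * Real.exp (T * ‖z‖)) (cocompact (Cn n)) (𝓝 0) := by
  obtain ⟨C, -, hC⟩ := exists_fockWeight_mul_exp_le n γ (T + 1)
  have exp_tendsto :
      Tendsto (fun z : Cn n => C * Real.exp (-‖z‖)) (cocompact (Cn n)) (𝓝 0) := by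
    simpa using (Real.tendsto_exp_neg_atTop_nhds_zero.comp
      (tendsto_norm_cocompact_atTop (E := Cn n))).const_mul C
  refine squeeze_zero (fun z => mul_nonneg (fockWeight_pos γ z).le (Real.exp_pos _).le)
    (fun z => ?_) exp_tendsto
  calc fockWeight γ z * Real.exp (T * ‖z‖)
      = fockWeight γ z * Real.exp ((T + 1) * ‖z‖) * Real.exp (-‖z‖) := by
        rw [mul_assoc, ← Real.exp_add]; ring_nf
    _ ≤ C * Real.exp (-‖z‖) := by gcongr; exact hC z

theorem integrable_fockWeight_mul_exp (γ T : ℝ) :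
    Integrable (fun z : Cn n => fockWeight γ z * Real.exp (T * ‖z‖)) (fockVol n) := by
  simp only [fockWeight_mul_exp_eq]
  exact integrable_one_add_norm_rpow_mul_exp _ (-γ) T (by norm_num)

theorem norm_exp_inner_mul_fockWeight (γ : ℝ) (u z : Cn n) :
    ‖Complex.exp (inner ℂ u z)‖ * fockWeight γ u =
      Real.exp (‖z‖ ^ 2 / 2) * ((1 + ‖u‖) ^ (-γ) * Real.exp (-‖u - z‖ ^ 2 / 2)) := by
  have norm_sub : ‖u - z‖ ^ 2 = ‖u‖ ^ 2 - 2 * (inner ℂ u z : ℂ).re + ‖z‖ ^ 2 :=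
    norm_sub_sq (𝕜 := ℂ) u z
  rw [Complex.norm_exp, fockWeight, ← mul_assoc, ← Real.exp_add, mul_left_comm, ← Real.exp_add,
    mul_comm, norm_sub]
  ring_nf

theorem exists_fockWeight_mul_norm_exp_inner_le (γ : ℝ) (z : Cn n) :
    ∃ C : ℝ, ∀ u : Cn n, fockWeight γ u * ‖Complex.exp (inner ℂ u z)‖ ≤ C := by
  obtain ⟨C, -, hC⟩ := exists_fockWeight_mul_exp_le n γ ‖z‖
  refine ⟨C, fun u => le_trans ?_ (hC u)⟩
  rw [Complex.norm_exp, mul_comm ‖z‖]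
  exact mul_le_mul_of_nonneg_left (Real.exp_le_exp.2 ((Complex.re_le_norm _).trans
    (norm_inner_le_norm u z))) (fockWeight_pos γ u).le

end FockWeight

section Rotation

instance smulInvariantMeasure_circle_fockVol (n : ℕ) :
    SMulInvariantMeasure Circle (Cn n) (fockVol n) where
  measure_preimage_smul c s hs := by
    let rotation : Cn n ≃ₗᵢ[ℝ] Cn n :=
      { (LinearEquiv.smulOfNeZero ℂ (Cn n) (c : ℂ) c.coe_ne_zero).restrictScalars ℝ with
        norm_map' := fun z => by
          change ‖(c : ℂ) • z‖ = ‖z‖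
          rw [norm_smul, Circle.norm_coe, one_mul] }
    exact (rotation.measurePreserving.smul_measure _).measure_preimage hs.nullMeasurableSet

variable {E : Type*} [NormedAddCommGroup E] [NormedSpace ℂ E] [MeasurableSpace E] [BorelSpace E]
  {μ : Measure E} [SFinite μ] [SMulInvariantMeasure Circle E μ]

theorem integral_circleAverage_smul {Φ : E → ℂ} (hΦm : Measurable Φ) (hΦ : Integrable Φ μ) :
    ∫ u, Real.circleAverage (fun a => Φ (a • u)) 0 1 ∂μ = ∫ u, Φ u ∂μ := by
  have circleMap_smul (θ : ℝ) (u : E) : circleMap 0 1 θ • u = Circle.exp θ • u := by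
    simp [circleMap, Circle.smul_def]
  have integral_rotate {F : Type} [NormedAddCommGroup F] [NormedSpace ℝ F] (Ψ : E → F) (θ : ℝ) :
      ∫ u, Ψ (circleMap 0 1 θ • u) ∂μ = ∫ u, Ψ u ∂μ := by
    simp only [circleMap_smul, integral_smul_eq_self]
  have measurable_rotate :
      Measurable (Function.uncurry fun (θ : ℝ) (u : E) => Φ (circleMap 0 1 θ • u)) :=
    hΦm.comp (((continuous_circleMap 0 1).comp continuous_fst).smul continuous_snd).measurable
  have integrable_rotate :
      Integrable (Function.uncurry fun (θ : ℝ) (u : E) => Φ (circleMap 0 1 θ • u))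
        ((volume.restrict (Set.uIoc 0 (2 * Real.pi))).prod μ) := by
    rw [integrable_prod_iff measurable_rotate.aestronglyMeasurable]
    refine ⟨Eventually.of_forall fun θ => ?_, ?_⟩
    · simp only [Function.uncurry_apply_pair, circleMap_smul]
      exact (measurePreserving_smul (Circle.exp θ) μ).integrable_comp_of_integrable hΦ
    · simp only [Function.uncurry_apply_pair, integral_rotate fun u => ‖Φ u‖]
      rw [Set.uIoc_of_le (by positivity)]
      exact integrable_const _
  simp only [Real.circleAverage]
  rw [integral_smul, ← intervalIntegral_integral_swap integrable_rotate]
  simp only [integral_rotate, intervalIntegral.integral_const, sub_zero]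
  rw [smul_smul, inv_mul_cancel₀ (by positivity), one_smul]

/-- Mean value property: the average of an entire function over a circle `{a u : |a| = 1}` is its
value at the origin. -/
theorem integral_differentiable_mul_radial {h : E → ℂ} {ρ : ℝ → ℝ} (hd : Differentiable ℂ h)
    (hρ : Measurable ρ) (hi : Integrable (fun u => h u * (ρ ‖u‖ : ℂ)) μ) :
    ∫ u, h u * (ρ ‖u‖ : ℂ) ∂μ = h 0 * (∫ u, ρ ‖u‖ ∂μ : ℝ) := by
  have circleAverage_eq (u : E) :
      Real.circleAverage (fun a : ℂ => h (a • u) * (ρ ‖a • u‖ : ℂ)) 0 1 = h 0 * (ρ ‖u‖ : ℂ) := by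
    have mean_value : Real.circleAverage (fun a : ℂ => h (a • u)) 0 1 = h 0 := by
      have differentiable_slice : Differentiable ℂ fun a : ℂ => h (a • u) :=
        hd.comp (differentiable_id.smul_const u)
      simpa using (differentiable_slice.diffContOnCl (s := Metric.ball 0 |1|)).circleAverage
    rw [← mean_value, mul_comm, ← smul_eq_mul, ← Real.circleAverage_fun_smul]
    refine Real.circleAverage_congr_sphere fun a ha => ?_
    have norm_eq_one : ‖a‖ = 1 := by simpa using ha
    rw [norm_smul, norm_eq_one, one_mul, smul_eq_mul, mul_comm]
  have measurable_integrand : Measurable fun u => h u * (ρ ‖u‖ : ℂ) :=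
    hd.continuous.measurable.mul (Complex.measurable_ofReal.comp (hρ.comp measurable_norm))
  rw [← integral_circleAverage_smul measurable_integrand hi]
  simp only [circleAverage_eq]
  rw [integral_const_mul, integral_complex_ofReal]

theorem integral_mul_gaussian_eq {n : ℕ} {h : Cn n → ℂ} (hd : Differentiable ℂ h)
    (hi : Integrable (fun u => h u * (Real.exp (-‖u‖ ^ 2) : ℝ)) (fockVol n)) :
    ∫ u, h u * (Real.exp (-‖u‖ ^ 2) : ℝ) ∂(fockVol n) = h 0 := by
  rw [integral_differentiable_mul_radial (ρ := fun r => Real.exp (-r ^ 2)) hd (by fun_prop) hi,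
    integral_exp_fockVol, Complex.ofReal_one, mul_one]

end Rotation

section Polar

open Set in
theorem integral_homogeneous_mul_radial {E : Type*} [NormedAddCommGroup E] [NormedSpace ℝ E]
    [Nontrivial E] [MeasurableSpace E] [BorelSpace E] [FiniteDimensional ℝ E] (μ : Measure E)
    [μ.IsAddHaarMeasure] {Φ : E → ℂ} {d : ℕ}
    (hΦ : ∀ (t : ℝ) (u : E), 0 < t → Φ (t • u) = (t : ℂ) ^ d * Φ u) (ρ : ℝ → ℝ) :
    ∫ u, Φ u * (ρ ‖u‖ : ℂ) ∂μ = (∫ ξ, Φ ξ ∂μ.toSphere) *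
      ((∫ r in Ioi (0 : ℝ), r ^ (Module.finrank ℝ E - 1) * (r ^ d * ρ r) : ℝ) : ℂ) := by
  have polar (x : ({(0 : E)}ᶜ : Set E)) : Φ x.1 * (ρ ‖x.1‖ : ℂ) =
      (fun y : Metric.sphere (0 : E) 1 × Ioi (0 : ℝ) => Φ y.1 * ((y.2.1 ^ d * ρ y.2.1 : ℝ) : ℂ))
        (homeomorphUnitSphereProd E x) := by
    have norm_pos : 0 < ‖x.1‖ := norm_pos_iff.2 x.2
    have homogeneous := hΦ ‖x.1‖ (‖x.1‖⁻¹ • x.1) norm_pos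
    rw [smul_smul, mul_inv_cancel₀ norm_pos.ne', one_smul] at homogeneous
    simp only [homeomorphUnitSphereProd_apply_snd_coe, homeomorphUnitSphereProd_apply_fst_coe]
    rw [homogeneous]
    push_cast
    ring
  have radial_integral : ∫ r : Ioi (0 : ℝ), r.1 ^ d * ρ r.1 ∂.volumeIoiPow (Module.finrank ℝ E - 1)
      = ∫ r in Ioi (0 : ℝ), r ^ (Module.finrank ℝ E - 1) * (r ^ d * ρ r) := by
    simp only [Measure.volumeIoiPow, ENNReal.ofReal]
    rw [integral_withDensity_eq_integral_smul
      ((measurable_subtype_coe.pow_const _).real_toNNReal),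
      integral_subtype_comap measurableSet_Ioi fun a : ℝ =>
        Real.toNNReal (a ^ (Module.finrank ℝ E - 1)) • (a ^ d * ρ a)]
    refine setIntegral_congr_fun measurableSet_Ioi fun r hr => ?_
    rw [NNReal.smul_def, Real.coe_toNNReal _ (pow_nonneg (mem_Ioi.1 hr).le _), smul_eq_mul]
  calc ∫ u, Φ u * (ρ ‖u‖ : ℂ) ∂μ
      = ∫ x : ({(0 : E)}ᶜ : Set E), Φ x.1 * (ρ ‖x.1‖ : ℂ) ∂(μ.comap (↑)) := by
        rw [integral_subtype_comap (measurableSet_singleton _).compl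
          fun x => Φ x * (ρ ‖x‖ : ℂ), restrict_compl_singleton]
    _ = ∫ x, Φ x.1 * ((x.2.1 ^ d * ρ x.2.1 : ℝ) : ℂ)
          ∂μ.toSphere.prod (.volumeIoiPow (Module.finrank ℝ E - 1)) := by
        simp only [polar]
        exact μ.measurePreserving_homeomorphUnitSphereProd.integral_comp
          (Homeomorph.measurableEmbedding _) fun x => Φ x.1 * ((x.2.1 ^ d * ρ x.2.1 : ℝ) : ℂ)
    _ = _ := by
        rw [integral_prod_mul (fun ξ : Metric.sphere (0 : E) 1 => Φ ξ)
          (fun r : Ioi (0 : ℝ) => ((r.1 ^ d * ρ r.1 : ℝ) : ℂ)), integral_complex_ofReal,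
          radial_integral]

theorem integral_pow_mul_exp_mul_rpow {m : ℕ} {σ : ℝ} (hm : 0 < m) (k : ℕ) (hσ : σ < m + k) :
    ∫ r in Set.Ioi (0 : ℝ), r ^ (m - 1) * (r ^ k * (Real.exp (-r ^ 2) * r ^ (-σ))) =
      Real.Gamma ((m + k - σ) / 2) / 2 := by
  have cast_pred : ((m - 1 : ℕ) : ℝ) = m - 1 := Nat.cast_pred hm
  calc ∫ r in Set.Ioi (0 : ℝ), r ^ (m - 1) * (r ^ k * (Real.exp (-r ^ 2) * r ^ (-σ)))
      = ∫ r in Set.Ioi (0 : ℝ), r ^ (((m - 1 : ℕ) : ℝ) + k - σ) * Real.exp (-r ^ (2 : ℝ)) := by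
        refine setIntegral_congr_fun measurableSet_Ioi fun r (hr : 0 < r) => ?_
        rw [sub_eq_add_neg, Real.rpow_add hr, Real.rpow_add hr, Real.rpow_natCast,
          Real.rpow_natCast, Real.rpow_two]
        ring
    _ = Real.Gamma ((m + k - σ) / 2) / 2 := by
        rw [integral_rpow_mul_exp_neg_rpow (by norm_num) (by rw [cast_pred]; linarith), cast_pred]
        ring_nf

theorem integral_homogeneous_mul_exp_mul_rpow {n k : ℕ} {σ : ℝ} (hn : 0 < n)
    (hσ : σ < 2 * n + 2 * k) {Φ : Cn n → ℂ}
    (hΦ : ∀ (t : ℝ) (u : Cn n), 0 < t → Φ (t • u) = (t : ℂ) ^ (2 * k) * Φ u) :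
    ∫ u, Φ u * ((Real.exp (-‖u‖ ^ 2) * ‖u‖ ^ (-σ) : ℝ) : ℂ) ∂(fockVol n) =
      ((Real.Gamma (n + k - σ / 2) / Real.Gamma (n + k) : ℝ) : ℂ) *
        ∫ u, Φ u * ((Real.exp (-‖u‖ ^ 2) : ℝ) : ℂ) ∂(fockVol n) := by
  have : Nonempty (Fin n) := ⟨⟨0, hn⟩⟩
  have polar {τ : ℝ} (hτ : τ < 2 * n + 2 * k) :
      ∫ u, Φ u * ((Real.exp (-‖u‖ ^ 2) * ‖u‖ ^ (-τ) : ℝ) : ℂ) ∂(fockVol n) =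
        (∫ ξ, Φ ξ ∂(fockVol n).toSphere) * ((Real.Gamma (n + k - τ / 2) / 2 : ℝ) : ℂ) := by
    rw [integral_homogeneous_mul_radial (fockVol n) hΦ fun r => Real.exp (-r ^ 2) * r ^ (-τ),
      finrank_real_Cn, integral_pow_mul_exp_mul_rpow (by positivity) _ (by push_cast; exact hτ)]
    congr 4
    push_cast
    ring
  have gaussian := polar (τ := 0) (by positivity)
  simp only [neg_zero, Real.rpow_zero, mul_one, zero_div, sub_zero] at gaussian
  have Gamma_ne_zero : ((Real.Gamma (n + k) : ℝ) : ℂ) ≠ 0 :=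
    Complex.ofReal_ne_zero.2 (Real.Gamma_pos_of_pos (by positivity)).ne'
  rw [polar hσ, gaussian]
  push_cast
  field_simp

end Polar

section Homogeneous

variable {n : ℕ}

theorem homogPart_smul (k : ℕ) (f : Cn n → ℂ) (a : ℂ) (z : Cn n) :
    homogPart k f (a • z) = a ^ k * homogPart k f z := by
  unfold homogPart
  rw [ContinuousMultilinearMap.map_smul_univ, Finset.prod_const, Finset.card_univ,
    Fintype.card_fin, smul_eq_mul, mul_left_comm]

theorem homogPart_eq_iteratedDeriv {f : Cn n → ℂ} (hf : ContDiff ℂ ⊤ f) (k : ℕ) (u : Cn n) :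
    homogPart k f u = ((k.factorial : ℂ))⁻¹ * iteratedDeriv k (fun a : ℂ => f (a • u)) 0 := by
  have slice_derivative := ContinuousLinearMap.iteratedFDeriv_comp_right
    (ContinuousLinearMap.toSpanSingleton ℂ u) hf (0 : ℂ) (i := k) (by exact_mod_cast le_top)
  have slice_eq : (f ∘ (ContinuousLinearMap.toSpanSingleton ℂ u)) = fun a : ℂ => f (a • u) := by
    funext a
    simp [ContinuousLinearMap.toSpanSingleton_apply]
  rw [slice_eq] at slice_derivative
  rw [homogPart, iteratedDeriv_eq_iteratedFDeriv, slice_derivative]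
  simp [ContinuousLinearMap.toSpanSingleton_apply]

/-- Cauchy's integral formula on the circle `{a u : |a| = 1}`. -/
theorem circleAverage_eq_homogPart {f : Cn n → ℂ} (hf : ContDiff ℂ ⊤ f) (k : ℕ) (u : Cn n) :
    Real.circleAverage (fun a : ℂ => (a ^ k)⁻¹ * f (a • u)) 0 1 = homogPart k f u := by
  have differentiable_slice : Differentiable ℂ fun a : ℂ => f (a • u) :=
    (hf.differentiable (by simp)).comp (differentiable_id.smul_const u)
  have cauchy := (differentiable_slice.diffContOnCl
    (s := Metric.ball 0 1)).circleIntegral_one_div_sub_center_pow_smul one_pos k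
  have integral_eq : ∮ a in C(0, 1), (a - 0)⁻¹ • ((a ^ k)⁻¹ * f (a • u)) =
      ∮ a in C(0, 1), (1 / (a - 0) ^ (k + 1)) • f (a • u) := by
    congr 1
    funext a
    simp only [sub_zero, smul_eq_mul, one_div, pow_succ, mul_inv_rev]
    ring
  rw [Real.circleAverage_eq_circleIntegral one_ne_zero, integral_eq, cauchy,
    homogPart_eq_iteratedDeriv hf, smul_smul, smul_eq_mul]
  congr 1
  field_simp

theorem homogPart_of_homogeneous {P : Cn n → ℂ} (hP : ContDiff ℂ ⊤ P) {j : ℕ}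
    (hj : ∀ (a : ℂ) (u : Cn n), P (a • u) = a ^ j * P u) (k : ℕ) (u : Cn n) :
    homogPart k P u = if k = j then P u else 0 := by
  rw [homogPart_eq_iteratedDeriv hP]
  simp only [hj, mul_comm _ (P u)]
  rw [iteratedDeriv_const_mul_field, iteratedDeriv_fun_pow_zero, mul_comm (P u)]
  split_ifs with degree_eq
  · subst degree_eq
    rw [inv_mul_cancel_left₀ (by exact_mod_cast k.factorial_ne_zero)]
  · simp

theorem contDiff_homogPart (k : ℕ) (f : Cn n → ℂ) : ContDiff ℂ ⊤ (homogPart k f) :=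
  contDiff_const.mul ((ContinuousMultilinearMap.contDiff _).comp
    (contDiff_pi.2 fun _ => contDiff_id))

theorem homogPart_add {f g : Cn n → ℂ} (hf : ContDiff ℂ ⊤ f) (hg : ContDiff ℂ ⊤ g) (k : ℕ) :
    homogPart k (f + g) = homogPart k f + homogPart k g := by
  funext z
  simp only [homogPart, Pi.add_apply]
  rw [iteratedFDeriv_add_apply (hf.contDiffAt.of_le (by exact_mod_cast le_top))
    (hg.contDiffAt.of_le (by exact_mod_cast le_top)), _root_.add_apply, mul_add]

theorem homogPart_const_smul {f : Cn n → ℂ} (hf : ContDiff ℂ ⊤ f) (c : ℂ) (k : ℕ) :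
    homogPart k (c • f) = c • homogPart k f := by
  funext z
  simp only [homogPart, Pi.smul_apply, smul_eq_mul]
  rw [iteratedFDeriv_const_smul_apply (hf.contDiffAt.of_le (by exact_mod_cast le_top)),
    _root_.smul_apply, smul_eq_mul, mul_left_comm]

theorem contDiff_taylorHead (s : ℝ) (f : Cn n → ℂ) : ContDiff ℂ ⊤ (taylorHead s f) :=
  ContDiff.sum fun k _ => contDiff_homogPart k f

theorem taylorHead_add {f g : Cn n → ℂ} (hf : ContDiff ℂ ⊤ f) (hg : ContDiff ℂ ⊤ g) (s : ℝ) :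
    taylorHead s (f + g) = taylorHead s f + taylorHead s g := by
  funext z
  simp only [taylorHead, homogPart_add hf hg, Pi.add_apply, Finset.sum_add_distrib]

theorem taylorHead_const_smul {f : Cn n → ℂ} (hf : ContDiff ℂ ⊤ f) (c : ℂ) (s : ℝ) :
    taylorHead s (c • f) = c • taylorHead s f := by
  funext z
  simp only [taylorHead, homogPart_const_smul hf, Pi.smul_apply, Finset.smul_sum]

theorem taylorTail_add {f g : Cn n → ℂ} (hf : ContDiff ℂ ⊤ f) (hg : ContDiff ℂ ⊤ g) (s : ℝ) :
    taylorTail s (f + g) = taylorTail s f + taylorTail s g := by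
  funext z
  simp only [taylorTail, taylorHead_add hf hg, Pi.add_apply, add_sub_add_comm]

theorem taylorTail_const_smul {f : Cn n → ℂ} (hf : ContDiff ℂ ⊤ f) (c : ℂ) (s : ℝ) :
    taylorTail s (c • f) = c • taylorTail s f := by
  funext z
  simp only [taylorTail, taylorHead_const_smul hf, Pi.smul_apply, smul_sub]

theorem homogPart_taylorHead (s : ℝ) (f : Cn n → ℂ) (k : ℕ) (z : Cn n) :
    homogPart k (taylorHead s f) z = if k < ⌊|s|⌋₊ + 1 then homogPart k f z else 0 := by
  have homogPart_sum : homogPart k (taylorHead s f) z =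
      ∑ j ∈ Finset.range (⌊|s|⌋₊ + 1), homogPart k (homogPart j f) z := by
    simp only [homogPart, ← Finset.mul_sum]
    congr 1
    rw [← _root_.sum_apply, ← iteratedFDeriv_fun_sum_apply fun j _ =>
      (contDiff_homogPart j f).contDiffAt.of_le (by exact_mod_cast le_top)]
    rfl
  rw [homogPart_sum]
  simp only [homogPart_of_homogeneous (contDiff_homogPart _ f) (homogPart_smul _ f)]
  simp

theorem homogPart_taylorTail (s : ℝ) {f : Cn n → ℂ} (hf : ContDiff ℂ ⊤ f) (k : ℕ) (z : Cn n) :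
    homogPart k (taylorTail s f) z = if k < ⌊|s|⌋₊ + 1 then 0 else homogPart k f z := by
  have tail_eq : taylorTail s f = f + (-1 : ℂ) • taylorHead s f := by
    funext z
    simp [taylorTail, sub_eq_add_neg]
  have contDiff_neg_head : ContDiff ℂ ⊤ ((-1 : ℂ) • taylorHead s f) :=
    (contDiff_taylorHead s f).const_smul (-1 : ℂ)
  rw [tail_eq, homogPart_add hf contDiff_neg_head,
    homogPart_const_smul (contDiff_taylorHead s f)]
  simp only [Pi.add_apply, Pi.smul_apply, homogPart_taylorHead]
  split_ifs <;> simp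

theorem taylorHead_of_homogeneous {P : Cn n → ℂ} (hP : ContDiff ℂ ⊤ P) {j : ℕ}
    (hj : ∀ (a : ℂ) (u : Cn n), P (a • u) = a ^ j * P u) (s : ℝ) :
    taylorHead s P = if j < ⌊|s|⌋₊ + 1 then P else 0 := by
  funext u
  simp only [taylorHead, homogPart_of_homogeneous hP hj]
  split_ifs with low_degree <;> simp [Finset.mem_range, low_degree]

theorem taylorTail_of_homogeneous {P : Cn n → ℂ} (hP : ContDiff ℂ ⊤ P) {j : ℕ}
    (hj : ∀ (a : ℂ) (u : Cn n), P (a • u) = a ^ j * P u) (s : ℝ) :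
    taylorTail s P = if j < ⌊|s|⌋₊ + 1 then 0 else P := by
  funext u
  simp only [taylorTail, taylorHead_of_homogeneous hP hj]
  split_ifs <;> simp

end Homogeneous

section ZeroAtInfty

variable {X : Type*} [TopologicalSpace X]

theorem zeroAtInfty_norm_apply_le (φ : C₀(X, ℂ)) (x : X) : ‖φ x‖ ≤ ‖φ‖ :=
  φ.toBCF.norm_coe_le_norm x

theorem zeroAtInfty_norm_le {φ : C₀(X, ℂ)} {C : ℝ} (hC : 0 ≤ C) (h : ∀ x, ‖φ x‖ ≤ C) : ‖φ‖ ≤ C :=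
  (BoundedContinuousFunction.norm_le (f := φ.toBCF) hC).2 h

/-- Evaluation at a point, as a bounded linear functional on `C₀`. -/
noncomputable def zeroAtInftyEval (x : X) : C₀(X, ℂ) →L[ℂ] ℂ :=
  LinearMap.mkContinuous
    { toFun := fun φ => φ x
      map_add' := fun _ _ => rfl
      map_smul' := fun _ _ => rfl } 1 fun φ => by
    rw [one_mul]
    exact zeroAtInfty_norm_apply_le φ x

@[simp] theorem zeroAtInftyEval_apply (x : X) (φ : C₀(X, ℂ)) : zeroAtInftyEval x φ = φ x := rfl

end ZeroAtInfty

section WeightedMonomial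

variable {n : ℕ}

theorem norm_prod_inner_le {k : ℕ} (u : Cn n) (v : Fin k → Cn n) :
    ‖∏ j, (inner ℂ u (v j) : ℂ)‖ ≤ ‖u‖ ^ k * ∏ j, ‖v j‖ := by
  rw [norm_prod]
  calc ∏ j, ‖(inner ℂ u (v j) : ℂ)‖ ≤ ∏ j, ‖u‖ * ‖v j‖ :=
        Finset.prod_le_prod (fun _ _ => norm_nonneg _) fun j _ => norm_inner_le_norm u (v j)
    _ = ‖u‖ ^ k * ∏ j, ‖v j‖ := by simp [Finset.prod_mul_distrib]

theorem pow_le_factorial_mul_exp {T r : ℝ} (hT : 0 < T) (hr : 0 ≤ r) (k : ℕ) :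
    r ^ k ≤ k.factorial * (T⁻¹) ^ k * Real.exp (T * r) := by
  have power_le := Real.pow_div_factorial_le_exp (T * r) (by positivity) k
  rw [div_le_iff₀ (by positivity), mul_pow] at power_le
  calc r ^ k = (T⁻¹) ^ k * (T ^ k * r ^ k) := by
        rw [← mul_assoc, ← mul_pow, inv_mul_cancel₀ hT.ne', one_pow, one_mul]
    _ ≤ (T⁻¹) ^ k * (Real.exp (T * r) * k.factorial) := by gcongr
    _ = k.factorial * (T⁻¹) ^ k * Real.exp (T * r) := by ring

theorem norm_fockWeight_mul_prod_inner_le (β : ℝ) {T : ℝ} (hT : 0 < T) {k : ℕ} (u : Cn n)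
    (v : Fin k → Cn n) :
    ‖(fockWeight β u : ℂ) * ∏ j, (inner ℂ u (v j) : ℂ)‖ ≤
      fockWeight β u * Real.exp (T * ‖u‖) * (k.factorial * (T⁻¹) ^ k * ∏ j, ‖v j‖) := by
  have weight_nonneg := (fockWeight_pos β u).le
  calc ‖(fockWeight β u : ℂ) * ∏ j, (inner ℂ u (v j) : ℂ)‖
      ≤ fockWeight β u * (k.factorial * (T⁻¹) ^ k * Real.exp (T * ‖u‖) * ∏ j, ‖v j‖) := by
        rw [norm_fockWeight_mul]
        refine mul_le_mul_of_nonneg_left ((norm_prod_inner_le u v).trans ?_) weight_nonneg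
        gcongr
        exact pow_le_factorial_mul_exp hT (norm_nonneg u) k
    _ = fockWeight β u * Real.exp (T * ‖u‖) * (k.factorial * (T⁻¹) ^ k * ∏ j, ‖v j‖) := by ring

/-- The weighted monomial `u ↦ w_β(u) ∏ⱼ ⟪u, vⱼ⟫`. It is antilinear in `u`, since the kernels of
the pairing have to be holomorphic in the other variable. -/
noncomputable def weightedMonomial (β : ℝ) {k : ℕ} (v : Fin k → Cn n) : C₀(Cn n, ℂ) where
  toFun u := (fockWeight β u : ℂ) * ∏ j, (inner ℂ u (v j) : ℂ)
  continuous_toFun := by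
    have := continuous_fockWeight (n := n) β
    fun_prop
  zero_at_infty' := by
    rw [tendsto_zero_iff_norm_tendsto_zero]
    refine squeeze_zero (fun u => norm_nonneg _)
      (fun u => norm_fockWeight_mul_prod_inner_le β one_pos u v) ?_
    simpa only [zero_mul] using (tendsto_fockWeight_mul_exp (n := n) β 1).mul_const
      (k.factorial * (1 : ℝ)⁻¹ ^ k * ∏ j, ‖v j‖)

theorem weightedMonomial_apply (β : ℝ) {k : ℕ} (v : Fin k → Cn n) (u : Cn n) :
    weightedMonomial β v u = (fockWeight β u : ℂ) * ∏ j, (inner ℂ u (v j) : ℂ) := rfl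

theorem weightedMonomial_const_apply (β : ℝ) (k : ℕ) (z u : Cn n) :
    weightedMonomial β (fun _ : Fin k => z) u = (fockWeight β u : ℂ) * (inner ℂ u z : ℂ) ^ k := by
  simp [weightedMonomial_apply]

theorem norm_weightedMonomial_le {β T C : ℝ} (hT : 0 < T) (hC : 0 ≤ C)
    (hle : ∀ z : Cn n, fockWeight β z * Real.exp (T * ‖z‖) ≤ C) {k : ℕ} (v : Fin k → Cn n) :
    ‖weightedMonomial β v‖ ≤ C * (k.factorial * (T⁻¹) ^ k) * ∏ j, ‖v j‖ := by
  refine zeroAtInfty_norm_le (by positivity) fun u =>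
    (norm_fockWeight_mul_prod_inner_le β hT u v).trans ?_
  rw [mul_assoc C]
  gcongr
  exact hle u

/-- `weightedMonomial`, as a multilinear map in `v`. -/
noncomputable def weightedMonomialMultilinear (n : ℕ) (β : ℝ) (k : ℕ) :
    MultilinearMap ℂ (fun _ : Fin k => Cn n) C₀(Cn n, ℂ) where
  toFun v := weightedMonomial β v
  map_update_add' {inst} v i x y := by
    obtain rfl : inst = instDecidableEqFin k := Subsingleton.elim _ _
    ext u
    rw [ZeroAtInftyContinuousMap.add_apply]
    simp only [weightedMonomial_apply, ← mul_add]
    congr 1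
    exact ((MultilinearMap.mkPiAlgebra ℂ (Fin k) ℂ).compLinearMap
      fun _ => (innerSL ℂ u).toLinearMap).map_update_add v i x y
  map_update_smul' {inst} v i a x := by
    obtain rfl : inst = instDecidableEqFin k := Subsingleton.elim _ _
    ext u
    rw [ZeroAtInftyContinuousMap.smul_apply]
    simp only [weightedMonomial_apply]
    rw [smul_eq_mul, mul_left_comm]
    congr 1
    exact ((MultilinearMap.mkPiAlgebra ℂ (Fin k) ℂ).compLinearMap
      fun _ => (innerSL ℂ u).toLinearMap).map_update_smul v i a x

/-- `weightedMonomial`, as a continuous multilinear map in `v`. -/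
noncomputable def weightedMonomialCMM (n : ℕ) (β : ℝ) (k : ℕ) :
    ContinuousMultilinearMap ℂ (fun _ : Fin k => Cn n) C₀(Cn n, ℂ) where
  toMultilinearMap := weightedMonomialMultilinear n β k
  cont := by
    obtain ⟨C, hC, hle⟩ := exists_fockWeight_mul_exp_le n β 1
    exact (weightedMonomialMultilinear n β k).continuous_of_bound _
      (norm_weightedMonomial_le one_pos hC.le hle)

@[simp] theorem weightedMonomialCMM_apply (β : ℝ) (k : ℕ) (v : Fin k → Cn n) :
    weightedMonomialCMM n β k v = weightedMonomial β v := rfl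

theorem norm_weightedMonomialCMM_le {β T C : ℝ} (hT : 0 < T) (hC : 0 ≤ C)
    (hle : ∀ z : Cn n, fockWeight β z * Real.exp (T * ‖z‖) ≤ C) (k : ℕ) :
    ‖weightedMonomialCMM n β k‖ ≤ C * (k.factorial * (T⁻¹) ^ k) :=
  ContinuousMultilinearMap.opNorm_le_bound (by positivity) (norm_weightedMonomial_le hT hC hle)

end WeightedMonomial

/-- At most geometric growth of a sequence. -/
def GeometricGrowth (c : ℕ → ℝ) : Prop := ∃ A B : ℝ, 0 ≤ A ∧ 0 ≤ B ∧ ∀ k, |c k| ≤ A * B ^ k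

/-- The exponential generating function `x ↦ ∑_k c_k x^k / k!`. -/
noncomputable def expGenFun (c : ℕ → ℝ) (x : ℂ) : ℂ :=
  ∑' k, ((c k / k.factorial : ℝ) : ℂ) * x ^ k

/-- The `C₀(ℂⁿ)`-valued power series in `z` whose terms are `u ↦ w_β(u) c_k ⟪u, z⟫^k / k!`. -/
noncomputable def weightedKernelSeries (n : ℕ) (β : ℝ) (c : ℕ → ℝ) :
    FormalMultilinearSeries ℂ (Cn n) C₀(Cn n, ℂ) :=
  fun k => ((c k / k.factorial : ℝ) : ℂ) • weightedMonomialCMM n β k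

/-- The weighted kernel `u ↦ w_β(u) ∑_k c_k ⟪u, z⟫^k / k!`, an entire `C₀(ℂⁿ)`-valued function of
`z` if `c` has at most geometric growth. -/
noncomputable def weightedKernel (n : ℕ) (β : ℝ) (c : ℕ → ℝ) (z : Cn n) : C₀(Cn n, ℂ) :=
  (weightedKernelSeries n β c).sum z

section WeightedKernel

variable {n : ℕ} {β : ℝ} {c : ℕ → ℝ}

theorem norm_weightedKernelSeries_le {A B T C : ℝ} (hc : ∀ k, |c k| ≤ A * B ^ k) (hT : 0 < T)
    (hC : 0 ≤ C) (hle : ∀ z : Cn n, fockWeight β z * Real.exp (T * ‖z‖) ≤ C) (k : ℕ) :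
    ‖weightedKernelSeries n β c k‖ ≤ A * C * (B / T) ^ k := by
  have abs_div_le : |c k / k.factorial| ≤ A * B ^ k / k.factorial := by
    rw [abs_div, Nat.abs_cast]
    gcongr
    exact hc k
  calc ‖weightedKernelSeries n β c k‖
      ≤ |c k / k.factorial| * ‖weightedMonomialCMM n β k‖ := by
        rw [← Real.norm_eq_abs, ← Complex.norm_real]
        exact ContinuousMultilinearMap.opNorm_smul_le _ _
    _ ≤ (A * B ^ k / k.factorial) * (C * (k.factorial * (T⁻¹) ^ k)) :=
        mul_le_mul abs_div_le (norm_weightedMonomialCMM_le hT hC hle k) (by positivity)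
          ((abs_nonneg _).trans abs_div_le)
    _ = A * C * (B / T) ^ k := by
        rw [div_eq_mul_inv B, mul_pow]
        field_simp

theorem radius_weightedKernelSeries (β : ℝ) (hc : GeometricGrowth c) :
    (weightedKernelSeries n β c).radius = ⊤ := by
  obtain ⟨A, B, hA, hB, hAB⟩ := hc
  refine FormalMultilinearSeries.radius_eq_top_of_summable_norm _ fun r => ?_
  set T : ℝ := 2 * (B * r) + 1
  have T_pos : 0 < T := by positivity
  obtain ⟨C, hC, hle⟩ := exists_fockWeight_mul_exp_le n β T
  have ratio_le : B / T * r ≤ 1 / 2 := by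
    rw [div_mul_eq_mul_div, div_le_iff₀ T_pos]
    linarith
  refine Summable.of_nonneg_of_le (fun k => by positivity) (fun k => ?_)
    ((summable_geometric_of_lt_one (r := 1 / 2) (by norm_num) (by norm_num)).mul_left (A * C))
  calc ‖weightedKernelSeries n β c k‖ * (r : ℝ) ^ k
      ≤ A * C * (B / T) ^ k * (r : ℝ) ^ k := by
        gcongr
        exact norm_weightedKernelSeries_le hAB T_pos hC.le hle k
    _ = A * C * (B / T * r) ^ k := by rw [mul_assoc, ← mul_pow]
    _ ≤ A * C * (1 / 2) ^ k := by gcongr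

section

variable (hc : GeometricGrowth c)

include hc

theorem hasFPowerSeriesOnBall_weightedKernel :
    HasFPowerSeriesOnBall (weightedKernel n β c) (weightedKernelSeries n β c) 0 ⊤ := by
  rw [← radius_weightedKernelSeries (n := n) β hc]
  refine (weightedKernelSeries n β c).hasFPowerSeriesOnBall ?_
  rw [radius_weightedKernelSeries β hc]
  exact ENNReal.zero_lt_top

theorem hasSum_weightedKernel (z : Cn n) :
    HasSum (fun k => ((c k / k.factorial : ℝ) : ℂ) • weightedMonomial β (fun _ : Fin k => z))
      (weightedKernel n β c z) := by
  have hasSum_series :=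
    (hasFPowerSeriesOnBall_weightedKernel (β := β) (n := n) hc).hasSum (y := z) (by simp)
  rwa [zero_add] at hasSum_series

theorem weightedKernel_apply (z u : Cn n) :
    weightedKernel n β c z u = (fockWeight β u : ℂ) * expGenFun c (inner ℂ u z) := by
  have hasSum_apply := (hasSum_weightedKernel (β := β) hc z).mapL (zeroAtInftyEval u)
  simp only [map_smul, zeroAtInftyEval_apply, weightedMonomial_const_apply, smul_eq_mul]
    at hasSum_apply
  rw [expGenFun, ← tsum_mul_left, ← hasSum_apply.tsum_eq]
  simp only [mul_left_comm]

theorem continuous_weightedKernel : Continuous (weightedKernel n β c) := by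
  rw [← continuousOn_univ, ← Metric.eball_top (0 : Cn n)]
  exact (hasFPowerSeriesOnBall_weightedKernel hc).continuousOn

theorem continuous_expGenFun_inner (w : Cn n) :
    Continuous fun z : Cn n => expGenFun c (inner ℂ w z) := by
  have eq_eval (z : Cn n) : expGenFun c (inner ℂ w z) =
      ((fockWeight 0 w : ℂ))⁻¹ * zeroAtInftyEval w (weightedKernel n 0 c z) := by
    rw [zeroAtInftyEval_apply, weightedKernel_apply hc, inv_mul_cancel_left₀]
    exact Complex.ofReal_ne_zero.2 (fockWeight_pos 0 w).ne'
  simp only [eq_eval]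
  exact ((zeroAtInftyEval w).continuous.comp (continuous_weightedKernel hc)).const_mul _

variable (L : C₀(Cn n, ℂ) →L[ℂ] ℂ)

theorem hasFPowerSeriesOnBall_comp_weightedKernel :
    HasFPowerSeriesOnBall (fun z => L (weightedKernel n β c z))
      (L.compFormalMultilinearSeries (weightedKernelSeries n β c)) 0 ⊤ :=
  L.comp_hasFPowerSeriesOnBall (hasFPowerSeriesOnBall_weightedKernel hc)

theorem contDiff_comp_weightedKernel : ContDiff ℂ ⊤ fun z => L (weightedKernel n β c z) := by
  rw [← contDiffOn_univ, ← Metric.eball_top (0 : Cn n)]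
  exact (hasFPowerSeriesOnBall_comp_weightedKernel hc L).analyticOnNhd.contDiffOn
    Metric.isOpen_eball.uniqueDiffOn

theorem homogPart_comp_weightedKernel (k : ℕ) (z : Cn n) :
    homogPart k (fun z => L (weightedKernel n β c z)) z =
      ((c k / k.factorial : ℝ) : ℂ) * L (weightedMonomial β fun _ : Fin k => z) := by
  rw [homogPart, ← (hasFPowerSeriesOnBall_comp_weightedKernel (β := β) hc L).factorial_smul z k,
    nsmul_eq_mul, inv_mul_cancel_left₀ (by exact_mod_cast k.factorial_ne_zero)]
  simp [weightedKernelSeries]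

theorem hasSum_comp_weightedKernel (z : Cn n) :
    HasSum (fun k => ((c k / k.factorial : ℝ) : ℂ) * L (weightedMonomial β fun _ : Fin k => z))
      (L (weightedKernel n β c z)) := by
  simpa using (hasSum_weightedKernel (β := β) hc z).mapL L

end

end WeightedKernel

theorem geometricGrowth_one : GeometricGrowth fun _ => 1 := ⟨1, 1, by simp⟩

theorem expGenFun_one (x : ℂ) : expGenFun (fun _ => 1) x = Complex.exp x := by
  rw [expGenFun, Complex.exp_eq_exp_ℂ, NormedSpace.exp_eq_tsum_div]
  simp [div_eq_inv_mul]

/-- Membership in `F^1_γ`, for a bare function: `f` is entire and `∫ |f| w_γ dV < ∞`. -/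
structure MemFockOne {n : ℕ} (γ : ℝ) (f : Cn n → ℂ) : Prop where
  differentiable : Differentiable ℂ f
  integrable : Integrable (fun z => (fockWeight γ z : ℂ) * f z) (fockVol n)

namespace MemFockOne

variable {n : ℕ} {γ : ℝ} {f : Cn n → ℂ}

theorem continuous (hf : MemFockOne γ f) : Continuous f := hf.differentiable.continuous

theorem integrable_mul (hf : MemFockOne γ f) {φ : Cn n → ℂ} (hφ : Continuous φ) {C : ℝ}
    (hC : ∀ u, fockWeight (-γ) u * ‖φ u‖ ≤ C) :
    Integrable (fun u => f u * φ u * (Real.exp (-‖u‖ ^ 2) : ℝ)) (fockVol n) := by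
  have continuous_weight := continuous_fockWeight (n := n) (-γ)
  refine (hf.integrable.mul_bdd (c := C) (g := fun u => (fockWeight (-γ) u : ℂ) * φ u)
    (Continuous.aestronglyMeasurable (by fun_prop)) (Eventually.of_forall fun u => by
      rw [norm_fockWeight_mul]
      exact hC u)).congr (Eventually.of_forall fun u => ?_)
  simp only [← fockWeight_mul_neg γ u]
  push_cast
  ring

theorem integrable_mul_exp_inner (hf : MemFockOne γ f) (z : Cn n) :
    Integrable (fun u => f u * Complex.exp (inner ℂ u z) * (Real.exp (-‖u‖ ^ 2) : ℝ))
      (fockVol n) := by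
  obtain ⟨C, hC⟩ := exists_fockWeight_mul_norm_exp_inner_le (-γ) z
  exact hf.integrable_mul (φ := fun u => Complex.exp (inner ℂ u z)) (by fun_prop) hC

theorem integrable_mul_inner_pow (hf : MemFockOne γ f) (k : ℕ) (z : Cn n) :
    Integrable (fun u => f u * (inner ℂ u z : ℂ) ^ k * (Real.exp (-‖u‖ ^ 2) : ℝ))
      (fockVol n) := by
  refine hf.integrable_mul (φ := fun u => (inner ℂ u z : ℂ) ^ k) (by fun_prop)
    (C := ‖weightedMonomial (-γ) fun _ : Fin k => z‖) fun u => ?_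
  rw [← norm_fockWeight_mul, ← weightedMonomial_const_apply]
  exact zeroAtInfty_norm_apply_le _ u

/-- The translation `u ↦ u + z` turns the integrand into an entire function times the Gaussian, to
which the mean value property applies. -/
theorem integral_mul_exp_inner (hf : MemFockOne γ f) (z : Cn n) :
    ∫ u, f u * Complex.exp (inner ℂ u z) * (Real.exp (-‖u‖ ^ 2) : ℝ) ∂(fockVol n) = f z := by
  have integrand_add (u : Cn n) : f (u + z) * Complex.exp (inner ℂ (u + z) z) *
      (Real.exp (-‖u + z‖ ^ 2) : ℝ) =
      f (u + z) * Complex.exp (-inner ℂ z u) * (Real.exp (-‖u‖ ^ 2) : ℝ) := by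
    have norm_sq_eq (v : Cn n) : ((‖v‖ ^ 2 : ℝ) : ℂ) = inner ℂ v v := by
      rw [inner_self_eq_norm_sq_to_K]
      norm_cast
    rw [mul_assoc, mul_assoc, Complex.ofReal_exp, Complex.ofReal_exp, ← Complex.exp_add,
      ← Complex.exp_add, Complex.ofReal_neg, Complex.ofReal_neg, norm_sq_eq, norm_sq_eq]
    congr 2
    simp only [inner_add_left, inner_add_right]
    ring
  have integrable_translate := (hf.integrable_mul_exp_inner z).comp_add_right z
  simp only [integrand_add] at integrable_translate
  rw [← integral_add_right_eq_self _ z]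
  simp only [integrand_add]
  have differentiable_translate :
      Differentiable ℂ fun u : Cn n => f (u + z) * Complex.exp (-inner ℂ z u) :=
    (hf.differentiable.comp (differentiable_id.add_const z)).mul
      ((innerSL ℂ z).differentiable.neg).cexp
  rw [integral_mul_gaussian_eq differentiable_translate integrable_translate]
  simp

theorem integrable_mul_zeroAtInfty (hf : MemFockOne γ f) (φ : C₀(Cn n, ℂ)) :
    Integrable (fun u => (fockWeight γ u : ℂ) * f u * φ u) (fockVol n) :=
  hf.integrable.mul_bdd (c := ‖φ‖) φ.continuous_toFun.aestronglyMeasurable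
    (Eventually.of_forall (zeroAtInfty_norm_apply_le φ))

/-- The bounded linear functional `φ ↦ ∫ w_γ f φ dV` on `C₀(ℂⁿ)`. -/
noncomputable def toDual (hf : MemFockOne γ f) : C₀(Cn n, ℂ) →L[ℂ] ℂ :=
  LinearMap.mkContinuous
    { toFun := fun φ => ∫ u, (fockWeight γ u : ℂ) * f u * φ u ∂(fockVol n)
      map_add' := fun φ ψ => by
        rw [← integral_add (hf.integrable_mul_zeroAtInfty φ) (hf.integrable_mul_zeroAtInfty ψ)]
        simp only [ZeroAtInftyContinuousMap.add_apply, mul_add]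
      map_smul' := fun a φ => by
        simp only [RingHom.id_apply, smul_eq_mul, ZeroAtInftyContinuousMap.smul_apply]
        rw [← integral_const_mul]
        simp only [mul_left_comm] }
    (∫ u, ‖(fockWeight γ u : ℂ) * f u‖ ∂(fockVol n)) fun φ => by
    change ‖∫ u, (fockWeight γ u : ℂ) * f u * φ u ∂(fockVol n)‖ ≤ _
    rw [← integral_mul_const]
    refine norm_integral_le_of_norm_le (hf.integrable.norm.mul_const _)
      (Eventually.of_forall fun u => ?_)
    rw [norm_mul]
    exact mul_le_mul_of_nonneg_left (zeroAtInfty_norm_apply_le φ u) (norm_nonneg _)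

theorem toDual_apply (hf : MemFockOne γ f) (φ : C₀(Cn n, ℂ)) :
    hf.toDual φ = ∫ u, (fockWeight γ u : ℂ) * f u * φ u ∂(fockVol n) := rfl

theorem toDual_weightedKernel (hf : MemFockOne γ f) :
    (fun z => hf.toDual (weightedKernel n (-γ) (fun _ => 1) z)) = f := by
  funext z
  rw [toDual_apply, ← hf.integral_mul_exp_inner z]
  refine integral_congr_ae (Eventually.of_forall fun u => ?_)
  simp only [weightedKernel_apply geometricGrowth_one, expGenFun_one, ← fockWeight_mul_neg γ u]
  push_cast
  ring

theorem contDiff (hf : MemFockOne γ f) : ContDiff ℂ ⊤ f := by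
  rw [← hf.toDual_weightedKernel]
  exact contDiff_comp_weightedKernel geometricGrowth_one hf.toDual

theorem homogPart_eq_toDual (hf : MemFockOne γ f) (k : ℕ) (z : Cn n) :
    homogPart k f z =
      ((1 / k.factorial : ℝ) : ℂ) * hf.toDual (weightedMonomial (-γ) fun _ : Fin k => z) := by
  rw [← homogPart_comp_weightedKernel geometricGrowth_one, hf.toDual_weightedKernel]

theorem homogPart_eq_integral (hf : MemFockOne γ f) (k : ℕ) (z : Cn n) :
    homogPart k f z = ((k.factorial : ℂ))⁻¹ *
      ∫ u, f u * (inner ℂ u z : ℂ) ^ k * (Real.exp (-‖u‖ ^ 2) : ℝ) ∂(fockVol n) := by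
  rw [hf.homogPart_eq_toDual, toDual_apply, one_div, Complex.ofReal_inv, Complex.ofReal_natCast]
  congr 1
  refine integral_congr_ae (Eventually.of_forall fun u => ?_)
  simp only [weightedMonomial_const_apply, ← fockWeight_mul_neg γ u]
  push_cast
  ring

theorem hasSum_homogPart (hf : MemFockOne γ f) (z : Cn n) :
    HasSum (fun k => homogPart k f z) (f z) := by
  have hasSum_kernel := hasSum_comp_weightedKernel (β := -γ) geometricGrowth_one hf.toDual z
  simp only [← hf.homogPart_eq_toDual] at hasSum_kernel
  rwa [congrFun hf.toDual_weightedKernel z] at hasSum_kernel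

end MemFockOne

section Orthogonality

variable {n : ℕ}

/-- Orthogonality of the homogeneous polynomials of different degrees on every sphere. -/
theorem integral_mul_inner_pow_mul_radial {μ : Measure (Cn n)} [SFinite μ]
    [SMulInvariantMeasure Circle (Cn n) μ] {f : Cn n → ℂ} (hf : ContDiff ℂ ⊤ f) {ρ : ℝ → ℝ}
    (hρ : Measurable ρ) (k : ℕ) (z : Cn n)
    (hi : Integrable (fun u => f u * (inner ℂ u z : ℂ) ^ k * (ρ ‖u‖ : ℂ)) μ) :
    ∫ u, f u * (inner ℂ u z : ℂ) ^ k * (ρ ‖u‖ : ℂ) ∂μ =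
      ∫ u, homogPart k f u * (inner ℂ u z : ℂ) ^ k * (ρ ‖u‖ : ℂ) ∂μ := by
  have continuous_f : Continuous f := hf.continuous
  have measurable_integrand :
      Measurable fun u : Cn n => f u * (inner ℂ u z : ℂ) ^ k * (ρ ‖u‖ : ℂ) :=
    (Continuous.measurable (by fun_prop)).mul
      (Complex.measurable_ofReal.comp (hρ.comp measurable_norm))
  rw [← integral_circleAverage_smul measurable_integrand hi]
  refine integral_congr_ae (Eventually.of_forall fun u => ?_)
  dsimp only
  rw [← circleAverage_eq_homogPart hf, mul_assoc, mul_comm, ← smul_eq_mul,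
    ← Real.circleAverage_fun_smul]
  refine Real.circleAverage_congr_sphere fun a ha => ?_
  have norm_eq_one : ‖a‖ = 1 := by simpa using ha
  have conj_eq_inv : conj (a ^ k) = (a ^ k)⁻¹ := by
    rw [Complex.inv_eq_conj (by rw [norm_pow, norm_eq_one, one_pow])]
  simp only [norm_smul, norm_eq_one, one_mul, smul_eq_mul, inner_smul_left, mul_pow, ← map_pow,
    conj_eq_inv]
  ring

theorem homogPart_mul_inner_pow_smul (k : ℕ) (f : Cn n → ℂ) (z u : Cn n) (t : ℝ) :
    homogPart k f (t • u) * (inner ℂ (t • u) z : ℂ) ^ k =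
      (t : ℂ) ^ (2 * k) * (homogPart k f u * (inner ℂ u z : ℂ) ^ k) := by
  rw [← Complex.coe_smul t u, homogPart_smul, inner_smul_left, Complex.conj_ofReal]
  ring

theorem integral_mul_inner_pow_mul_rpow {γ : ℝ} {f : Cn n → ℂ} (hf : MemFockOne γ f) (hn : 0 < n)
    {σ : ℝ} {k : ℕ} (hσ : σ < 2 * n + 2 * k) (z : Cn n)
    (hi : Integrable (fun u => f u * (inner ℂ u z : ℂ) ^ k *
      ((Real.exp (-‖u‖ ^ 2) * ‖u‖ ^ (-σ) : ℝ) : ℂ)) (fockVol n)) :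
    ∫ u, f u * (inner ℂ u z : ℂ) ^ k *
      ((Real.exp (-‖u‖ ^ 2) * ‖u‖ ^ (-σ) : ℝ) : ℂ) ∂(fockVol n) =
      ((Real.Gamma (n + k - σ / 2) / Real.Gamma (n + k) : ℝ) : ℂ) *
        (k.factorial * homogPart k f z) := by
  rw [integral_mul_inner_pow_mul_radial hf.contDiff
      (ρ := fun r => Real.exp (-r ^ 2) * r ^ (-σ)) (by fun_prop) k z hi,
    integral_homogeneous_mul_exp_mul_rpow hn hσ fun t u _ =>
      homogPart_mul_inner_pow_smul k f z u t,
    ← integral_mul_inner_pow_mul_radial hf.contDiff (ρ := fun r => Real.exp (-r ^ 2))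
      (by fun_prop) k z (hf.integrable_mul_inner_pow k z),
    hf.homogPart_eq_integral k z, mul_inv_cancel_left₀ (by exact_mod_cast k.factorial_ne_zero)]

theorem rawPairing_inner_pow {γ : ℝ} {g : Cn n → ℂ} (hg : MemFockOne γ g) (hn : 0 < n)
    {σ : ℝ} {k : ℕ} (hσ : σ < 2 * n + 2 * k) (z : Cn n)
    (hi : Integrable (rawIntegrand σ (fun u => (inner ℂ z u : ℂ) ^ k) g) (fockVol n)) :
    rawPairing σ (fun u => (inner ℂ z u : ℂ) ^ k) g =
      ((Real.Gamma (n + k - σ / 2) / Real.Gamma (n + k) : ℝ) : ℂ) *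
        (k.factorial * conj (homogPart k g z)) := by
  have conj_rawIntegrand (u : Cn n) : conj (rawIntegrand σ (fun u => (inner ℂ z u : ℂ) ^ k) g u) =
      g u * (inner ℂ u z : ℂ) ^ k * ((Real.exp (-‖u‖ ^ 2) * ‖u‖ ^ (-σ) : ℝ) : ℂ) := by
    simp only [rawIntegrand, map_mul, map_pow, inner_conj_symm, Complex.conj_conj,
      Complex.conj_ofReal]
    ring
  have conj_integral := integral_mul_inner_pow_mul_rpow hg hn hσ z <| by
    simp only [← conj_rawIntegrand]
    exact (Complex.conjCLE : ℂ →L[ℝ] ℂ).integrable_comp hi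
  simp only [← conj_rawIntegrand] at conj_integral
  rw [integral_conj] at conj_integral
  rw [rawPairing, ← Complex.conj_conj (∫ u, _ ∂_), conj_integral]
  simp

end Orthogonality

theorem floor_add_one_sub_half_pos (σ : ℝ) : 0 < ((⌊|σ / 2|⌋₊ + 1 : ℕ) : ℝ) - σ / 2 := by
  push_cast
  linarith [le_abs_self (σ / 2), Nat.lt_floor_add_one |σ / 2|]

/-- The factor by which the pairing `⟨·,·⟩_σ` differs from `(·,·)_0` on the homogeneous polynomials
of degree `k`. -/
noncomputable def pairingCoeff (n : ℕ) (σ : ℝ) (k : ℕ) : ℝ :=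
  if σ < 2 * n ∨ ⌊|σ / 2|⌋₊ + 1 ≤ k then Real.Gamma (n + k - σ / 2) / Real.Gamma (n + k) else 1

section FockPairingMonomial

variable {n : ℕ}

theorem lt_two_mul_add_of_floor_add_one_le (n : ℕ) {σ : ℝ} {k : ℕ} (hk : ⌊|σ / 2|⌋₊ + 1 ≤ k) :
    σ < 2 * n + 2 * k := by
  have floor_le : ((⌊|σ / 2|⌋₊ + 1 : ℕ) : ℝ) ≤ k := by exact_mod_cast hk
  linarith [floor_add_one_sub_half_pos σ, Nat.cast_nonneg (α := ℝ) n]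

theorem pairingCoeff_pos (σ : ℝ) (hn : 0 < n) (k : ℕ) : 0 < pairingCoeff n σ k := by
  unfold pairingCoeff
  split_ifs with high_degree
  · have lt_degree : σ < 2 * n + 2 * k := high_degree.elim
      (fun hσ => hσ.trans_le (by simp)) (lt_two_mul_add_of_floor_add_one_le n)
    exact div_pos (Real.Gamma_pos_of_pos (by linarith)) (Real.Gamma_pos_of_pos (by positivity))
  · exact one_pos

@[simp] theorem rawPairing_zero_left (σ : ℝ) (g : Cn n → ℂ) : rawPairing σ 0 g = 0 := by
  simp [rawPairing, rawIntegrand]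

theorem fockPairing_inner_pow {γ σ : ℝ} {g : Cn n → ℂ} (hg : MemFockOne γ g)
    (hhead : MemFockOne γ (taylorHead (σ / 2) g)) (htail : MemFockOne γ (taylorTail (σ / 2) g))
    (hn : 0 < n) (k : ℕ) (z : Cn n)
    (hi : FockPairingConverges σ (fun u => (inner ℂ z u : ℂ) ^ k) g) :
    fockPairing σ (fun u => (inner ℂ z u : ℂ) ^ k) g =
      (pairingCoeff n σ k : ℂ) * (k.factorial * conj (homogPart k g z)) := by
  rw [fockPairing, pairingCoeff]
  rw [FockPairingConverges] at hi
  by_cases hσ : σ < 2 * n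
  · rw [if_pos hσ] at hi ⊢
    rw [if_pos (Or.inl hσ)]
    exact rawPairing_inner_pow hg hn (by linarith [Nat.cast_nonneg (α := ℝ) k]) z hi
  rw [if_neg hσ] at hi ⊢
  have contDiff_inner_pow : ContDiff ℂ ⊤ fun u : Cn n => (inner ℂ z u : ℂ) ^ k :=
    (innerSL ℂ z).contDiff.pow k
  have inner_pow_smul (a : ℂ) (u : Cn n) :
      (inner ℂ z (a • u) : ℂ) ^ k = a ^ k * (inner ℂ z u : ℂ) ^ k := by
    rw [inner_smul_right, mul_pow]
  rw [taylorHead_of_homogeneous contDiff_inner_pow inner_pow_smul,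
    taylorTail_of_homogeneous contDiff_inner_pow inner_pow_smul] at hi ⊢
  by_cases hk : k < ⌊|σ / 2|⌋₊ + 1
  · have Gamma_ne_zero : Real.Gamma (n + k) ≠ 0 := (Real.Gamma_pos_of_pos (by positivity)).ne'
    rw [if_pos hk, if_pos hk] at hi ⊢
    rw [if_neg (not_or.2 ⟨hσ, not_le.2 hk⟩), rawPairing_zero_left, add_zero,
      rawPairing_inner_pow hhead hn (by positivity) z hi.1, homogPart_taylorHead, if_pos hk]
    simp [Gamma_ne_zero]
  · rw [if_neg hk, if_neg hk] at hi ⊢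
    rw [if_pos (Or.inr (not_lt.1 hk)), rawPairing_zero_left, zero_add,
      rawPairing_inner_pow htail hn (lt_two_mul_add_of_floor_add_one_le n (not_lt.1 hk)) z hi.2,
      homogPart_taylorTail _ hg.contDiff, if_neg hk]

end FockPairingMonomial

section ExpGenBound

theorem hasSum_descFactorial_mul_pow (i : ℕ) (x : ℂ) :
    HasSum (fun k : ℕ => (((k.descFactorial i : ℝ) / k.factorial : ℝ) : ℂ) * x ^ k)
      (x ^ i * Complex.exp x) := by
  have hasSum_shift : HasSum (fun l : ℕ => x ^ i * (x ^ l / l.factorial))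
      (x ^ i * Complex.exp x) := by
    rw [Complex.exp_eq_exp_ℂ]
    exact (NormedSpace.expSeries_div_hasSum_exp x).mul_left _
  rw [← (add_left_injective i).hasSum_iff]
  · convert hasSum_shift using 1
    funext l
    have factorial_eq := Nat.factorial_mul_descFactorial (n := l + i) (k := i) (by omega)
    rw [Nat.add_sub_cancel] at factorial_eq
    have factorial_ne_zero : (l.factorial : ℂ) ≠ 0 := by exact_mod_cast l.factorial_ne_zero
    have descFactorial_ne_zero : ((l + i).descFactorial i : ℂ) ≠ 0 := by
      exact_mod_cast (Nat.descFactorial_pos.2 (by omega)).ne'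
    simp only [Function.comp, ← factorial_eq]
    push_cast
    field_simp
    ring
  · intro k hk
    have lt : k < i := not_le.1 fun hik => hk ⟨k - i, Nat.sub_add_cancel hik⟩
    simp [Nat.descFactorial_of_lt lt]

/-- The exponential generating function of `q` converges and is `O((1 + |x|)^M e^{Re x})`. -/
def ExpGenBound (M : ℕ) (q : ℕ → ℝ) : Prop :=
  ∃ C : ℝ, 0 ≤ C ∧ ∀ x : ℂ, Summable (fun k => ((q k / k.factorial : ℝ) : ℂ) * x ^ k) ∧
    ‖expGenFun q x‖ ≤ C * (1 + ‖x‖) ^ M * Real.exp x.re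

theorem ExpGenBound.add_const_mul {M : ℕ} {p q : ℕ → ℝ} (hp : ExpGenBound (M + 1) p)
    (hq : ExpGenBound M q) (c : ℝ) : ExpGenBound (M + 1) fun k => p k + c * q k := by
  obtain ⟨A, hA, hpA⟩ := hp
  obtain ⟨B, hB, hqB⟩ := hq
  refine ⟨A + |c| * B, by positivity, fun x => ?_⟩
  have hasSum_add : HasSum (fun k => (((p k + c * q k) / k.factorial : ℝ) : ℂ) * x ^ k)
      (expGenFun p x + c * expGenFun q x) := by
    rw [expGenFun, expGenFun]
    convert (hpA x).1.hasSum.add ((hqB x).1.hasSum.mul_left (c : ℂ)) using 2 with k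
    push_cast
    ring
  refine ⟨hasSum_add.summable, ?_⟩
  rw [expGenFun, hasSum_add.tsum_eq]
  calc ‖expGenFun p x + c * expGenFun q x‖ ≤ ‖expGenFun p x‖ + |c| * ‖expGenFun q x‖ := by
        refine (norm_add_le _ _).trans_eq ?_
        rw [norm_mul, Complex.norm_real, Real.norm_eq_abs]
    _ ≤ A * (1 + ‖x‖) ^ (M + 1) * Real.exp x.re +
        |c| * (B * (1 + ‖x‖) ^ (M + 1) * Real.exp x.re) := by
        gcongr
        · exact (hpA x).2
        · refine (hqB x).2.trans ?_
          gcongr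
          · linarith [norm_nonneg x]
          · exact M.le_succ
    _ = (A + |c| * B) * (1 + ‖x‖) ^ (M + 1) * Real.exp x.re := by ring

theorem expGenBound_descFactorial (i : ℕ) : ExpGenBound i fun k => (k.descFactorial i : ℝ) := by
  refine ⟨1, zero_le_one, fun x => ⟨(hasSum_descFactorial_mul_pow i x).summable, ?_⟩⟩
  rw [expGenFun, (hasSum_descFactorial_mul_pow i x).tsum_eq, norm_mul, norm_pow,
    Complex.norm_exp, one_mul]
  gcongr
  linarith

/-- Multiplying by `k + b = (k - i) + (i + b)` raises the order of the falling factorial by one, up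
to a term of lower order. -/
theorem expGenBound_descFactorial_mul_prod (b : ℕ → ℝ) (N : ℕ) : ∀ i : ℕ, ExpGenBound (N + i)
    fun k => (k.descFactorial i : ℝ) * ∏ j ∈ Finset.range N, (k + b j) := by
  induction N with
  | zero => intro i; simpa using expGenBound_descFactorial i
  | succ N ih =>
    intro i
    have bound_succ := ih (i + 1)
    rw [← add_assoc] at bound_succ
    rw [Nat.add_right_comm]
    convert bound_succ.add_const_mul (ih i) (i + b N) using 2 with k
    rw [Finset.prod_range_succ, Nat.descFactorial_succ]
    rcases le_or_gt i k with hik | hik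
    · push_cast [Nat.cast_sub hik]
      ring
    · simp [Nat.descFactorial_of_lt hik]

theorem expGenBound_prod (b : ℕ → ℝ) (N : ℕ) :
    ExpGenBound N fun k => ∏ j ∈ Finset.range N, (k + b j) := by
  simpa using expGenBound_descFactorial_mul_prod b N 0

theorem geometricGrowth_prod (b : ℕ → ℝ) (N : ℕ) :
    GeometricGrowth fun k => ∏ j ∈ Finset.range N, (k + b j) := by
  refine ⟨∏ j ∈ Finset.range N, (1 + |b j|), 2 ^ N,
    Finset.prod_nonneg fun j _ => by positivity, by positivity, fun k => ?_⟩
  rw [Finset.abs_prod]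
  calc ∏ j ∈ Finset.range N, |(k : ℝ) + b j|
      ≤ ∏ j ∈ Finset.range N, ((1 + |b j|) * 2 ^ k) := by
        refine Finset.prod_le_prod (fun _ _ => abs_nonneg _) fun j _ => ?_
        have add_one_le : (k : ℝ) + 1 ≤ 2 ^ k := by exact_mod_cast Nat.lt_two_pow_self (n := k)
        calc |(k : ℝ) + b j| ≤ k + |b j| := (abs_add_le _ _).trans_eq (by rw [Nat.abs_cast])
          _ ≤ (1 + |b j|) * (k + 1) := by
            nlinarith [mul_nonneg (abs_nonneg (b j)) (Nat.cast_nonneg (α := ℝ) k)]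
          _ ≤ (1 + |b j|) * 2 ^ k := by gcongr
    _ = (∏ j ∈ Finset.range N, (1 + |b j|)) * (2 ^ N) ^ k := by
        rw [Finset.prod_mul_distrib, Finset.prod_const, Finset.card_range, pow_right_comm]

theorem hasSum_mul_moment {ν : Measure ℝ} [IsFiniteMeasure ν] (hν : ∀ᵐ t ∂ν, |t| ≤ 1)
    {a : ℕ → ℂ} (ha : Summable fun k => ‖a k‖) :
    HasSum (fun k => a k * ((∫ t, t ^ k ∂ν : ℝ) : ℂ)) (∫ t, ∑' k, a k * (t : ℂ) ^ k ∂ν) := by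
  have norm_term_le (k : ℕ) : ∀ᵐ t : ℝ ∂ν, ‖a k * (t : ℂ) ^ k‖ ≤ ‖a k‖ := by
    filter_upwards [hν] with t ht
    rw [norm_mul, norm_pow, Complex.norm_real]
    exact mul_le_of_le_one_right (norm_nonneg _) (pow_le_one₀ (norm_nonneg _) ht)
  have integrable_term (k : ℕ) : Integrable (fun t : ℝ => a k * (t : ℂ) ^ k) ν :=
    Integrable.of_bound (by fun_prop) _ (norm_term_le k)
  have summable_integral_norm : Summable fun k => ∫ t : ℝ, ‖a k * (t : ℂ) ^ k‖ ∂ν := by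
    refine (ha.mul_right (ν.real Set.univ)).of_nonneg_of_le
      (fun k => integral_nonneg fun t => norm_nonneg _) fun k => ?_
    rw [mul_comm, ← smul_eq_mul, ← integral_const]
    exact integral_mono_ae (integrable_term k).norm (integrable_const _) (norm_term_le k)
  simpa only [integral_const_mul, ← Complex.ofReal_pow, integral_complex_ofReal] using
    hasSum_integral_of_summable_integral_norm integrable_term summable_integral_norm

/-- Multiplying Taylor coefficients by moments averages the function over dilations. -/
theorem ExpGenBound.exists_mul_moment_le {N : ℕ} {q : ℕ → ℝ} (hq : ExpGenBound N q)
    {ν : Measure ℝ} [IsFiniteMeasure ν] (hν : ∀ᵐ t ∂ν, t ∈ Set.Icc 0 1) :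
    ∃ C : ℝ, 0 ≤ C ∧ ∀ x : ℂ,
      Summable (fun k => ((q k * (∫ t, t ^ k ∂ν) / k.factorial : ℝ) : ℂ) * x ^ k) ∧
      ‖expGenFun (fun k => q k * ∫ t, t ^ k ∂ν) x‖ ≤
        C * (1 + ‖x‖) ^ N * ∫ t, Real.exp (t * x.re) ∂ν := by
  obtain ⟨C, hC, h⟩ := hq
  refine ⟨C, hC, fun x => ?_⟩
  have hasSum_moments : HasSum
      (fun k => ((q k * (∫ t, t ^ k ∂ν) / k.factorial : ℝ) : ℂ) * x ^ k)
      (∫ t : ℝ, expGenFun q (t * x) ∂ν) := by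
    convert hasSum_mul_moment (hν.mono fun t ht => abs_le.2 ⟨by linarith [ht.1], ht.2⟩)
      (h x).1.norm using 1
    · funext k
      push_cast
      ring
    · simp only [expGenFun, mul_pow, mul_comm, mul_assoc, mul_left_comm]
  refine ⟨hasSum_moments.summable, ?_⟩
  rw [expGenFun, hasSum_moments.tsum_eq, ← integral_const_mul]
  have integrable_exp : Integrable (fun t : ℝ => Real.exp (t * x.re)) ν := by
    refine Integrable.of_bound (by fun_prop) (Real.exp |x.re|) (hν.mono fun t ht => ?_)
    rw [Real.norm_of_nonneg (Real.exp_pos _).le, Real.exp_le_exp]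
    nlinarith [ht.1, ht.2, le_abs_self x.re, abs_nonneg x.re]
  refine norm_integral_le_of_norm_le (integrable_exp.const_mul _) (hν.mono fun t ht => ?_)
  have norm_le := (h (t * x)).2
  rw [Complex.re_ofReal_mul] at norm_le
  refine norm_le.trans ?_
  gcongr
  rw [norm_mul, Complex.norm_real, Real.norm_of_nonneg ht.1]
  exact mul_le_of_le_one_left (norm_nonneg x) ht.2

theorem norm_expGenFun_le_of_eq_of_le {p c : ℕ → ℝ} {N : ℕ} (hpc : ∀ k, N ≤ k → c k = p k) {x : ℂ}
    (hp : Summable fun k => ((p k / k.factorial : ℝ) : ℂ) * x ^ k) :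
    ‖expGenFun c x‖ ≤
      (∑ k ∈ Finset.range N, |c k - p k|) * (1 + ‖x‖) ^ N + ‖expGenFun p x‖ := by
  have hasSum_sub : HasSum (fun k => (((c k - p k) / k.factorial : ℝ) : ℂ) * x ^ k)
      (∑ k ∈ Finset.range N, (((c k - p k) / k.factorial : ℝ) : ℂ) * x ^ k) :=
    hasSum_sum_of_ne_finset_zero fun k hk => by simp [hpc k (by simpa using hk)]
  have expGenFun_eq : expGenFun c x =
      (∑ k ∈ Finset.range N, (((c k - p k) / k.factorial : ℝ) : ℂ) * x ^ k) + expGenFun p x := by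
    rw [expGenFun, expGenFun, ← (hasSum_sub.add hp.hasSum).tsum_eq]
    refine tsum_congr fun k => ?_
    push_cast
    ring
  rw [expGenFun_eq]
  refine (norm_add_le _ _).trans (add_le_add_left ?_ _)
  rw [Finset.sum_mul]
  refine norm_sum_le_of_le _ fun k hk => ?_
  rw [norm_mul, Complex.norm_real, Real.norm_eq_abs, abs_div, Nat.abs_cast, norm_pow]
  have div_factorial_le : |c k - p k| / k.factorial ≤ |c k - p k| :=
    div_le_self (abs_nonneg _) (by exact_mod_cast k.factorial_pos)
  have pow_le : ‖x‖ ^ k ≤ (1 + ‖x‖) ^ N :=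
    (pow_le_pow_left₀ (norm_nonneg x) (by linarith) k).trans
      (pow_le_pow_right₀ (by linarith [norm_nonneg x]) (Finset.mem_range.1 hk).le)
  gcongr

end ExpGenBound

section BetaMeasure

open ProbabilityTheory

variable {a b : ℝ}

theorem measurable_betaPDF (a b : ℝ) : Measurable (betaPDF a b) :=
  (measurable_betaPDFReal a b).ennreal_ofReal

theorem ae_betaMeasure_mem_Ioo (a b : ℝ) : ∀ᵐ t ∂betaMeasure a b, t ∈ Set.Ioo 0 1 := by
  rw [betaMeasure, ae_withDensity_iff (measurable_betaPDF a b)]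
  refine Eventually.of_forall fun t ht => ?_
  contrapose! ht
  rcases not_and_or.1 ht with ht | ht
  · exact betaPDF_eq_zero_of_nonpos (not_lt.1 ht)
  · exact betaPDF_eq_zero_of_one_le (not_lt.1 ht)

theorem betaPDFReal_nonneg (ha : 0 < a) (hb : 0 < b) (t : ℝ) : 0 ≤ betaPDFReal a b t := by
  by_cases ht : 0 < t ∧ t < 1
  · exact (betaPDFReal_pos ht.1 ht.2 ha hb).le
  · rw [betaPDFReal, if_neg ht]

theorem integral_betaMeasure (ha : 0 < a) (hb : 0 < b) (f : ℝ → ℝ) :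
    ∫ t, f t ∂betaMeasure a b = ∫ t, betaPDFReal a b t * f t := by
  rw [betaMeasure, integral_withDensity_eq_integral_toReal_smul
    (measurable_betaPDF a b)
    (Eventually.of_forall fun _ => ENNReal.ofReal_lt_top)]
  simp only [betaPDF, ENNReal.toReal_ofReal (betaPDFReal_nonneg ha hb _), smul_eq_mul]

theorem integral_pow_betaMeasure (ha : 0 < a) (hb : 0 < b) (k : ℕ) :
    ∫ t, t ^ k ∂betaMeasure a b = beta (a + k) b / beta a b := by
  have hak : 0 < a + k := by positivity
  have := isProbabilityMeasureBeta hak hb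
  have integral_betaPDFReal : ∫ t, betaPDFReal (a + k) b t = 1 := by
    simpa using (integral_betaMeasure hak hb fun _ => 1).symm
  have betaPDFReal_mul_pow (t : ℝ) :
      betaPDFReal a b t * t ^ k = beta (a + k) b / beta a b * betaPDFReal (a + k) b t := by
    by_cases ht : 0 < t ∧ t < 1
    · have beta_ne_zero := (beta_pos hak hb).ne'
      rw [betaPDFReal, betaPDFReal, if_pos ht, if_pos ht, add_sub_right_comm,
        Real.rpow_add_natCast ht.1.ne']
      field_simp
    · rw [betaPDFReal, betaPDFReal, if_neg ht, if_neg ht, zero_mul, mul_zero]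
  simp only [integral_betaMeasure ha hb, betaPDFReal_mul_pow, integral_const_mul,
    integral_betaPDFReal, mul_one]

theorem gamma_add_natCast {x : ℝ} (hx : 0 < x) (N : ℕ) :
    Real.Gamma (x + N) = (∏ j ∈ Finset.range N, (x + j)) * Real.Gamma x := by
  induction N with
  | zero => simp
  | succ N ih =>
    rw [Nat.cast_succ, ← add_assoc, Real.Gamma_add_one (by positivity), ih,
      Finset.prod_range_succ]
    ring

theorem gamma_div_gamma_eq_moment {s : ℝ} {N k : ℕ} (ha : 0 < a) (hN : s < N) (hk : s < a + k) :
    Real.Gamma (a + k) / Real.Gamma (a + k - s) =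
      Real.Gamma a / Real.Gamma (a + (N - s)) *
        ((∏ j ∈ Finset.range N, ((k : ℝ) + (a - s + j))) * ∫ t, t ^ k ∂betaMeasure a (N - s)) := by
  have hx : 0 < a + k - s := by linarith
  have prod_eq : ∏ j ∈ Finset.range N, ((k : ℝ) + (a - s + j)) =
      ∏ j ∈ Finset.range N, (a + k - s + j) := Finset.prod_congr rfl fun j _ => by ring
  rw [integral_pow_betaMeasure ha (sub_pos.2 hN), prod_eq, beta, beta,
    show a + k + (N - s) = a + k - s + N by ring, gamma_add_natCast hx N]
  have prod_ne_zero : ∏ j ∈ Finset.range N, (a + k - s + j) ≠ 0 :=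
    (Finset.prod_pos fun j _ => by positivity).ne'
  have := (Real.Gamma_pos_of_pos hx).ne'
  have := (Real.Gamma_pos_of_pos ha).ne'
  have := (Real.Gamma_pos_of_pos (sub_pos.2 hN)).ne'
  have := (Real.Gamma_pos_of_pos (add_pos ha (sub_pos.2 hN))).ne'
  field_simp

theorem integral_exp_betaMeasure_le (ha : 1 ≤ a) (hb : 0 < b) {ρ : ℝ} (hρ : 0 < ρ) :
    ∫ t, Real.exp (-(ρ * (1 - t))) ∂betaMeasure a b ≤
      (beta a b)⁻¹ * ((1 / ρ) ^ b * Real.Gamma b) := by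
  have ha₀ : 0 < a := zero_lt_one.trans_le ha
  have beta_pos := beta_pos ha₀ hb
  have := Real.Gamma_pos_of_pos hb
  have integral_eq := Real.integral_rpow_mul_exp_neg_mul_Ioi hb hρ
  have integrable_gamma : IntegrableOn (fun y : ℝ => y ^ (b - 1) * Real.exp (-(ρ * y)))
      (Set.Ioi 0) := by
    refine Integrable.of_integral_ne_zero ?_
    rw [integral_eq]
    positivity
  rw [integral_betaMeasure ha₀ hb, ← integral_sub_left_eq_self _ _ 1, ← integral_eq,
    ← integral_const_mul, ← integral_indicator measurableSet_Ioi]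
  refine integral_mono_of_nonneg (Eventually.of_forall fun y =>
    mul_nonneg (betaPDFReal_nonneg ha₀ hb _) (Real.exp_pos _).le)
    (IntegrableOn.integrable_indicator (integrable_gamma.const_mul _) measurableSet_Ioi)
    (Eventually.of_forall fun y => ?_)
  simp only [sub_sub_cancel]
  by_cases hy : 0 < 1 - y ∧ 1 - y < 1
  · have y_pos : 0 < y := by linarith [hy.2]
    have rpow_le_one : (1 - y) ^ (a - 1) ≤ 1 :=
      Real.rpow_le_one hy.1.le hy.2.le (sub_nonneg.2 ha)
    rw [Set.indicator_of_mem (Set.mem_Ioi.2 y_pos), betaPDFReal, if_pos hy, one_div,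
      sub_sub_cancel]
    calc (beta a b)⁻¹ * (1 - y) ^ (a - 1) * y ^ (b - 1) * Real.exp (-(ρ * y))
        ≤ (beta a b)⁻¹ * 1 * y ^ (b - 1) * Real.exp (-(ρ * y)) := by gcongr
      _ = _ := by ring
  · rw [betaPDFReal, if_neg hy, zero_mul]
    exact Set.indicator_nonneg (fun y hy => by have := Set.mem_Ioi.1 hy; positivity) y

theorem exists_one_add_mul_rpow_mul_exp_sq_le (γ : ℝ) : ∃ C : ℝ, 0 < C ∧ ∀ r t : ℝ, 0 ≤ r →
    t ∈ Set.Icc 0 1 → (1 + t * r) ^ γ * Real.exp ((t * r) ^ 2 / 2) ≤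
      C * ((1 + r) ^ γ * Real.exp (r ^ 2 / 2)) * Real.exp (-((1 + r ^ 2) / 4 * (1 - t))) := by
  obtain ⟨K, hK, hKle⟩ := exists_one_add_rpow_mul_exp_le |γ| 0 (b := 1 / 4) (by norm_num)
  refine ⟨K * Real.exp (1 / 4), by positivity, fun r t hr ⟨ht₀, ht₁⟩ => ?_⟩
  have rpow_dilation_le : (1 + t * r) ^ γ ≤ (1 + r) ^ γ * (1 + (1 - t) * r) ^ |γ| :=
    one_add_rpow_le_mul (by positivity) hr
      (abs_le.2 ⟨by nlinarith, by nlinarith [mul_nonneg ht₀ hr]⟩) γ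
  have rpow_le_exp : (1 + (1 - t) * r) ^ |γ| ≤ K * Real.exp (((1 - t) * r) ^ 2 / 4) := by
    have bound := hKle ((1 - t) * r) (mul_nonneg (by linarith) hr)
    rw [zero_mul, zero_sub, Real.exp_neg, ← div_eq_mul_inv,
      div_le_iff₀ (Real.exp_pos _)] at bound
    exact bound.trans_eq (by ring_nf)
  calc (1 + t * r) ^ γ * Real.exp ((t * r) ^ 2 / 2)
      ≤ (1 + r) ^ γ * (K * Real.exp (((1 - t) * r) ^ 2 / 4)) * Real.exp ((t * r) ^ 2 / 2) := by
        refine mul_le_mul_of_nonneg_right (rpow_dilation_le.trans ?_) (Real.exp_pos _).le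
        gcongr
    _ = K * (1 + r) ^ γ * Real.exp (((1 - t) * r) ^ 2 / 4 + (t * r) ^ 2 / 2) := by
        rw [Real.exp_add]; ring
    _ ≤ K * (1 + r) ^ γ * Real.exp (1 / 4 + r ^ 2 / 2 + -((1 + r ^ 2) / 4 * (1 - t))) := by
        refine mul_le_mul_of_nonneg_left (Real.exp_le_exp.2 ?_) (by positivity)
        nlinarith [mul_nonneg (mul_nonneg ht₀ (sub_nonneg.2 ht₁)) (sq_nonneg r)]
    _ = _ := by rw [Real.exp_add, Real.exp_add]; ring

theorem exists_integral_dilation_betaMeasure_le (ha : 1 ≤ a) (hb : 0 < b) (γ : ℝ) :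
    ∃ C : ℝ, 0 < C ∧ ∀ r : ℝ, 0 ≤ r →
      ∫ t, (1 + t * r) ^ γ * Real.exp ((t * r) ^ 2 / 2) ∂betaMeasure a b ≤
        C * (1 + r) ^ (γ - 2 * b) * Real.exp (r ^ 2 / 2) := by
  have ha₀ : 0 < a := zero_lt_one.trans_le ha
  have := isProbabilityMeasureBeta ha₀ hb
  have := beta_pos ha₀ hb
  have := Real.Gamma_pos_of_pos hb
  have mem_Icc : ∀ᵐ t ∂betaMeasure a b, t ∈ Set.Icc 0 1 :=
    (ae_betaMeasure_mem_Ioo a b).mono fun _ ht => Set.Ioo_subset_Icc_self ht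
  obtain ⟨K, hK, hKle⟩ := exists_one_add_mul_rpow_mul_exp_sq_le γ
  refine ⟨K * ((beta a b)⁻¹ * (8 ^ b * Real.Gamma b)), by positivity, fun r hr => ?_⟩
  have integrable_exp : Integrable (fun t => Real.exp (-((1 + r ^ 2) / 4 * (1 - t))))
      (betaMeasure a b) := by
    refine Integrable.of_bound (by fun_prop) 1 (mem_Icc.mono fun t ht => ?_)
    rw [Real.norm_of_nonneg (Real.exp_pos _).le, Real.exp_le_one_iff, neg_nonpos]
    exact mul_nonneg (by positivity) (sub_nonneg.2 ht.2)
  have rpow_le : (1 / ((1 + r ^ 2) / 4)) ^ b ≤ 8 ^ b * (1 + r) ^ (-(2 * b)) := by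
    rw [← mul_neg, Real.rpow_mul (by positivity), Real.rpow_neg (by positivity),
      ← Real.inv_rpow (by positivity), ← Real.mul_rpow (by positivity) (by positivity)]
    refine Real.rpow_le_rpow (by positivity) ?_ hb.le
    rw [Real.rpow_two, one_div_div, ← div_eq_mul_inv,
      div_le_div_iff₀ (by positivity) (by positivity)]
    nlinarith [sq_nonneg (r - 1)]
  calc ∫ t, (1 + t * r) ^ γ * Real.exp ((t * r) ^ 2 / 2) ∂betaMeasure a b
      ≤ ∫ t, K * ((1 + r) ^ γ * Real.exp (r ^ 2 / 2)) *
          Real.exp (-((1 + r ^ 2) / 4 * (1 - t))) ∂betaMeasure a b :=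
        integral_mono_of_nonneg
          (mem_Icc.mono fun t ht => by have := mul_nonneg ht.1 hr; positivity)
          (integrable_exp.const_mul _) (mem_Icc.mono fun t ht => hKle r t hr ht)
    _ ≤ K * ((1 + r) ^ γ * Real.exp (r ^ 2 / 2)) *
        ((beta a b)⁻¹ * (8 ^ b * (1 + r) ^ (-(2 * b)) * Real.Gamma b)) := by
        rw [integral_const_mul]
        gcongr
        refine (integral_exp_betaMeasure_le ha hb (by positivity)).trans ?_
        gcongr
    _ = _ := by rw [sub_eq_add_neg, Real.rpow_add (by positivity)]; ring

end BetaMeasure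

section InvPairingCoeff

open ProbabilityTheory

variable {n : ℕ} (hn : 0 < n) (σ : ℝ)
include hn

theorem inv_pairingCoeff_eq_moment {k : ℕ} (hk : σ < 2 * n ∨ ⌊|σ / 2|⌋₊ + 1 ≤ k) :
    (pairingCoeff n σ k)⁻¹ =
      Real.Gamma n / Real.Gamma (n + ((⌊|σ / 2|⌋₊ + 1 : ℕ) - σ / 2)) *
        ((∏ j ∈ Finset.range (⌊|σ / 2|⌋₊ + 1), ((k : ℝ) + (n - σ / 2 + j))) *
          ∫ t, t ^ k ∂betaMeasure n ((⌊|σ / 2|⌋₊ + 1 : ℕ) - σ / 2)) := by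
  have lt_degree : σ < 2 * n + 2 * k := hk.elim
    (fun hσ => hσ.trans_le (by simp)) (lt_two_mul_add_of_floor_add_one_le n)
  rw [pairingCoeff, if_pos hk, inv_div]
  exact gamma_div_gamma_eq_moment (by exact_mod_cast hn)
    (sub_pos.1 (floor_add_one_sub_half_pos σ)) (by linarith)

theorem geometricGrowth_inv_pairingCoeff :
    GeometricGrowth (fun k => (pairingCoeff n σ k)⁻¹) := by
  have hn' : (0 : ℝ) < n := by exact_mod_cast hn
  have hb := floor_add_one_sub_half_pos σ
  have := isProbabilityMeasureBeta hn' hb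
  obtain ⟨A, B, hA, hB, hAB⟩ := geometricGrowth_prod (fun j => (n : ℝ) - σ / 2 + j)
    (⌊|σ / 2|⌋₊ + 1)
  have eq_moment := fun k => inv_pairingCoeff_eq_moment hn σ (k := k)
  set b := ((⌊|σ / 2|⌋₊ + 1 : ℕ) : ℝ) - σ / 2
  set κ := Real.Gamma n / Real.Gamma (n + b)
  have hκ : 0 < κ := div_pos (Real.Gamma_pos_of_pos hn') (Real.Gamma_pos_of_pos (by positivity))
  have moment_le (k : ℕ) : |∫ t, t ^ k ∂betaMeasure n b| ≤ 1 := by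
    rw [← Real.norm_eq_abs]
    refine (norm_integral_le_of_norm_le_const (C := 1) ?_).trans_eq (by simp)
    filter_upwards [ae_betaMeasure_mem_Ioo n b] with t ht
    rw [norm_pow, Real.norm_of_nonneg ht.1.le]
    exact pow_le_one₀ ht.1.le ht.2.le
  refine ⟨1 + κ * A, B + 1, by positivity, by positivity, fun k => ?_⟩
  change |(pairingCoeff n σ k)⁻¹| ≤ _
  have one_le : (1 : ℝ) ≤ (B + 1) ^ k := one_le_pow₀ (by linarith)
  by_cases hk : σ < 2 * n ∨ ⌊|σ / 2|⌋₊ + 1 ≤ k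
  · rw [eq_moment k hk, abs_mul, abs_mul, abs_of_pos hκ]
    calc _ ≤ κ * (A * B ^ k * 1) := by
          gcongr
          exacts [hAB k, moment_le k]
      _ ≤ κ * (A * (B + 1) ^ k * 1) := by
          gcongr
          linarith
      _ ≤ (1 + κ * A) * (B + 1) ^ k := by linarith
  · rw [pairingCoeff, if_neg hk, inv_one, abs_one]
    nlinarith [mul_nonneg hκ.le hA]

theorem exists_expGenFun_inv_pairingCoeff_le : ∃ C : ℝ, 0 < C ∧ ∀ x : ℂ,
    ‖expGenFun (fun k => (pairingCoeff n σ k)⁻¹) x‖ ≤ C * (1 + ‖x‖) ^ (⌊|σ / 2|⌋₊ + 1) *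
      (1 + ∫ t, Real.exp (t * x.re) ∂betaMeasure n ((⌊|σ / 2|⌋₊ + 1 : ℕ) - σ / 2)) := by
  have hn' : (0 : ℝ) < n := by exact_mod_cast hn
  have hb := floor_add_one_sub_half_pos σ
  have := isProbabilityMeasureBeta hn' hb
  have eq_moment := fun k => inv_pairingCoeff_eq_moment hn σ (k := k)
  set N := ⌊|σ / 2|⌋₊ + 1
  set b := (N : ℝ) - σ / 2
  set κ := Real.Gamma n / Real.Gamma (n + b)
  set q : ℕ → ℝ := fun k => ∏ j ∈ Finset.range N, ((k : ℝ) + (n - σ / 2 + j))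
  set p : ℕ → ℝ := fun k => q k * ∫ t, t ^ k ∂betaMeasure n b
  have hκ : 0 < κ := div_pos (Real.Gamma_pos_of_pos hn') (Real.Gamma_pos_of_pos (by positivity))
  obtain ⟨A, hA, hAle⟩ := (expGenBound_prod (fun j => (n : ℝ) - σ / 2 + j) N).exists_mul_moment_le
    ((ae_betaMeasure_mem_Ioo n b).mono fun t ht => Set.Ioo_subset_Icc_self ht)
  set D := ∑ k ∈ Finset.range N, |(pairingCoeff n σ k)⁻¹ - κ * p k|
  have hD : 0 ≤ D := Finset.sum_nonneg fun _ _ => abs_nonneg _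
  refine ⟨D + κ * A + 1, by positivity, fun x => ?_⟩
  obtain ⟨summable_p, norm_p_le⟩ : Summable (fun k => ((p k / k.factorial : ℝ) : ℂ) * x ^ k) ∧ _ :=
    hAle x
  have hasSum_mul : HasSum (fun k => ((κ * p k / k.factorial : ℝ) : ℂ) * x ^ k)
      (κ * expGenFun p x) := by
    have hasSum_p : HasSum (fun k => ((p k / k.factorial : ℝ) : ℂ) * x ^ k) (expGenFun p x) :=
      summable_p.hasSum
    simpa only [mul_div_assoc, Complex.ofReal_mul, mul_assoc] using hasSum_p.mul_left (κ : ℂ)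
  have norm_mul_le : ‖expGenFun (fun k => κ * p k) x‖ ≤ κ * ‖expGenFun p x‖ := by
    rw [expGenFun, hasSum_mul.tsum_eq, norm_mul, Complex.norm_real, Real.norm_of_nonneg hκ.le]
  set J := ∫ t, Real.exp (t * x.re) ∂betaMeasure n b
  have hJ : 0 ≤ J := integral_nonneg fun t => (Real.exp_pos _).le
  calc ‖expGenFun (fun k => (pairingCoeff n σ k)⁻¹) x‖
      ≤ D * (1 + ‖x‖) ^ N + ‖expGenFun (fun k => κ * p k) x‖ :=
        norm_expGenFun_le_of_eq_of_le (fun k hk => eq_moment k (Or.inr hk)) hasSum_mul.summable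
    _ ≤ D * (1 + ‖x‖) ^ N + κ * (A * (1 + ‖x‖) ^ N * J) := by
        gcongr
        exact norm_mul_le.trans (by gcongr)
    _ = (D + κ * A * J) * (1 + ‖x‖) ^ N := by ring
    _ ≤ ((D + κ * A + 1) * (1 + J)) * (1 + ‖x‖) ^ N := by
        gcongr
        nlinarith [mul_nonneg hD hJ, mul_nonneg hκ.le hA]
    _ = _ := by ring

end InvPairingCoeff

section KernelIntegral

variable {n : ℕ}

theorem inv_fockWeight (γ : ℝ) (z : Cn n) :
    (fockWeight γ z)⁻¹ = (1 + ‖z‖) ^ γ * Real.exp (‖z‖ ^ 2 / 2) := by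
  rw [fockWeight, mul_inv, ← Real.exp_neg, ← Real.rpow_neg (by positivity), neg_neg, mul_comm]
  ring_nf

theorem integrable_fockWeight (γ : ℝ) : Integrable (fockWeight γ : Cn n → ℝ) (fockVol n) := by
  simpa using integrable_fockWeight_mul_exp (n := n) γ 0

theorem fockWeight_mul_exp_re_inner_eq (γ : ℝ) {t : ℝ} (ht : 0 ≤ t) (w z : Cn n) :
    fockWeight γ z * Real.exp (t * (inner ℂ w z).re) = Real.exp ((t * ‖w‖) ^ 2 / 2) *
      ((1 + ‖z‖) ^ (-γ) * Real.exp (-‖z - (t : ℂ) • w‖ ^ 2 / 2)) := by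
  have re_inner_smul : (inner ℂ z ((t : ℂ) • w)).re = t * (inner ℂ w z).re := by
    rw [inner_smul_right, Complex.re_ofReal_mul, ← inner_conj_symm w z, Complex.conj_re]
  have norm_smul_eq : ‖(t : ℂ) • w‖ = t * ‖w‖ := by
    rw [norm_smul, Complex.norm_of_nonneg ht]
  rw [← norm_smul_eq, ← norm_exp_inner_mul_fockWeight, Complex.norm_exp, re_inner_smul, mul_comm]

theorem exists_integral_fockWeight_mul_exp_re_inner_le (n : ℕ) (γ : ℝ) : ∃ C : ℝ, 0 ≤ C ∧
    ∀ (t : ℝ) (w : Cn n), 0 ≤ t →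
      ∫ z, fockWeight γ z * Real.exp (t * (inner ℂ w z).re) ∂fockVol n ≤
        C * ((1 + t * ‖w‖) ^ (-γ) * Real.exp ((t * ‖w‖) ^ 2 / 2)) := by
  obtain ⟨C, hC, hle⟩ := exists_integral_one_add_norm_rpow_mul_gaussian_sub_le (fockVol n) (-γ)
  refine ⟨C, hC, fun t w ht => ?_⟩
  have norm_smul_eq : ‖(t : ℂ) • w‖ = t * ‖w‖ := by
    rw [norm_smul, Complex.norm_of_nonneg ht]
  simp only [fockWeight_mul_exp_re_inner_eq γ ht, integral_const_mul]
  calc _ ≤ Real.exp ((t * ‖w‖) ^ 2 / 2) * (C * (1 + ‖(t : ℂ) • w‖) ^ (-γ)) := by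
        gcongr
        exact hle _
    _ = _ := by rw [norm_smul_eq]; ring

theorem integrable_prod_fockWeight_mul_exp_re_inner (γ : ℝ) (w : Cn n) {ν : Measure ℝ}
    [IsFiniteMeasure ν] (hν : ∀ᵐ t ∂ν, t ∈ Set.Icc (0 : ℝ) 1) :
    Integrable (fun p : Cn n × ℝ => fockWeight γ p.1 * Real.exp (p.2 * (inner ℂ w p.1).re))
      ((fockVol n).prod ν) := by
  refine ((integrable_fockWeight_mul_exp γ ‖w‖).comp_fst ν).mono'
    (((continuous_fockWeight γ).comp continuous_fst).mul (by fun_prop)).aestronglyMeasurable ?_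
  filter_upwards [Measure.quasiMeasurePreserving_snd.ae hν] with p hp
  have re_le : (inner ℂ w p.1).re ≤ ‖w‖ * ‖p.1‖ :=
    (Complex.re_le_norm _).trans (norm_inner_le_norm w p.1)
  have := fockWeight_pos γ p.1
  rw [Real.norm_of_nonneg (by positivity)]
  refine mul_le_mul_of_nonneg_left (Real.exp_le_exp.2 ?_) this.le
  exact (mul_le_mul_of_nonneg_left re_le hp.1).trans
    (mul_le_of_le_one_left (by positivity) hp.2)

theorem integrable_fockWeight_mul_integral_exp_re_inner (γ : ℝ) (w : Cn n) {ν : Measure ℝ}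
    [IsFiniteMeasure ν] (hν : ∀ᵐ t ∂ν, t ∈ Set.Icc (0 : ℝ) 1) :
    Integrable (fun z => fockWeight γ z * ∫ t, Real.exp (t * (inner ℂ w z).re) ∂ν)
      (fockVol n) := by
  simpa only [integral_const_mul] using
    (integrable_prod_fockWeight_mul_exp_re_inner γ w hν).integral_prod_left

theorem exists_integral_fockWeight_mul_integral_betaMeasure_le (hn : 0 < n) {b : ℝ} (hb : 0 < b)
    (γ : ℝ) : ∃ C : ℝ, 0 ≤ C ∧ ∀ w : Cn n,
      ∫ z, fockWeight γ z *
          ∫ t, Real.exp (t * (inner ℂ w z).re) ∂ProbabilityTheory.betaMeasure n b ∂fockVol n ≤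
        C * (1 + ‖w‖) ^ (-γ - 2 * b) * Real.exp (‖w‖ ^ 2 / 2) := by
  have := ProbabilityTheory.isProbabilityMeasureBeta (Nat.cast_pos.2 hn) hb
  obtain ⟨C, hC, hCle⟩ := exists_integral_fockWeight_mul_exp_re_inner_le n γ
  obtain ⟨D, hD, hDle⟩ := exists_integral_dilation_betaMeasure_le (Nat.one_le_cast.2 hn) hb (-γ)
  refine ⟨C * D, by positivity, fun w => ?_⟩
  have mem_Icc := (ae_betaMeasure_mem_Ioo n b).mono fun t ht => Set.Ioo_subset_Icc_self ht
  have integrable_prod := integrable_prod_fockWeight_mul_exp_re_inner γ w mem_Icc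
  have continuousOn_dilation : ContinuousOn
      (fun t : ℝ => (1 + t * ‖w‖) ^ (-γ) * Real.exp ((t * ‖w‖) ^ 2 / 2)) (Set.Icc 0 1) := by
    refine ContinuousOn.mul (ContinuousOn.rpow_const (by fun_prop) fun t ht => Or.inl ?_)
      (by fun_prop)
    have := mul_nonneg ht.1 (norm_nonneg w)
    positivity
  have integrable_dilation : Integrable
      (fun t : ℝ => (1 + t * ‖w‖) ^ (-γ) * Real.exp ((t * ‖w‖) ^ 2 / 2))
      (ProbabilityTheory.betaMeasure n b) := by
    rw [← Measure.restrict_eq_self_of_ae_mem mem_Icc]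
    exact continuousOn_dilation.integrableOn_compact isCompact_Icc
  simp only [← integral_const_mul]
  rw [integral_integral_swap integrable_prod]
  calc _ ≤ ∫ t, C * ((1 + t * ‖w‖) ^ (-γ) * Real.exp ((t * ‖w‖) ^ 2 / 2))
          ∂ProbabilityTheory.betaMeasure n b :=
        integral_mono_ae integrable_prod.integral_prod_right (integrable_dilation.const_mul C)
          (mem_Icc.mono fun t ht => hCle t w ht.1)
    _ ≤ C * (D * (1 + ‖w‖) ^ (-γ - 2 * b) * Real.exp (‖w‖ ^ 2 / 2)) := by
        rw [integral_const_mul]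
        exact mul_le_mul_of_nonneg_left (hDle _ (norm_nonneg w)) hC
    _ = _ := by ring

theorem exists_fockWeight_mul_norm_expGenFun_inv_pairingCoeff_le (hn : 0 < n) (α σ : ℝ) :
    ∃ C : ℝ, 0 < C ∧ ∀ w z : Cn n,
      fockWeight α z * ‖expGenFun (fun k => (pairingCoeff n σ k)⁻¹) (inner ℂ w z)‖ ≤
        C * (1 + ‖w‖) ^ (⌊|σ / 2|⌋₊ + 1) * (fockWeight (α - (⌊|σ / 2|⌋₊ + 1 : ℕ)) z +
          fockWeight (α - (⌊|σ / 2|⌋₊ + 1 : ℕ)) z * ∫ t, Real.exp (t * (inner ℂ w z).re)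
            ∂ProbabilityTheory.betaMeasure n ((⌊|σ / 2|⌋₊ + 1 : ℕ) - σ / 2)) := by
  obtain ⟨C, hC, hle⟩ := exists_expGenFun_inv_pairingCoeff_le hn σ
  refine ⟨C, hC, fun w z => ?_⟩
  set N := ⌊|σ / 2|⌋₊ + 1
  set J := ∫ t, Real.exp (t * (inner ℂ w z).re) ∂ProbabilityTheory.betaMeasure n (N - σ / 2)
  have : 0 ≤ J := integral_nonneg fun t => (Real.exp_pos _).le
  have one_add_inner_le : 1 + ‖(inner ℂ w z : ℂ)‖ ≤ (1 + ‖w‖) * (1 + ‖z‖) := by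
    nlinarith [norm_inner_le_norm (𝕜 := ℂ) w z, norm_nonneg w, norm_nonneg z]
  have weight_eq : fockWeight (α - N) z = fockWeight α z * (1 + ‖z‖) ^ N := by
    rw [sub_eq_add_neg, fockWeight_add, neg_neg, Real.rpow_natCast]
  have := fockWeight_pos α z
  calc _ ≤ fockWeight α z * (C * ((1 + ‖w‖) * (1 + ‖z‖)) ^ N * (1 + J)) := by
        gcongr
        exact (hle _).trans (by gcongr)
    _ = _ := by rw [weight_eq, mul_pow]; ring

theorem integrable_fockWeight_mul_expGenFun_inv_pairingCoeff (hn : 0 < n) (α σ : ℝ) (w : Cn n) :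
    Integrable (fun z => fockWeight α z *
      ‖expGenFun (fun k => (pairingCoeff n σ k)⁻¹) (inner ℂ w z)‖) (fockVol n) := by
  obtain ⟨A, -, hAle⟩ := exists_fockWeight_mul_norm_expGenFun_inv_pairingCoeff_le hn α σ
  have := ProbabilityTheory.isProbabilityMeasureBeta (Nat.cast_pos.2 hn)
    (floor_add_one_sub_half_pos σ)
  set N := ⌊|σ / 2|⌋₊ + 1
  have integrable_average := integrable_fockWeight_mul_integral_exp_re_inner (α - N) w
    ((ae_betaMeasure_mem_Ioo n (N - σ / 2)).mono fun t ht => Set.Ioo_subset_Icc_self ht)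
  refine Integrable.mono' (((integrable_fockWeight (α - N)).add integrable_average).const_mul
    (A * (1 + ‖w‖) ^ N)) ((continuous_fockWeight α).mul (continuous_expGenFun_inner
      (geometricGrowth_inv_pairingCoeff hn σ) w).norm).aestronglyMeasurable
    (Eventually.of_forall fun z => ?_)
  exact (Real.norm_of_nonneg (mul_nonneg (fockWeight_pos α z).le (norm_nonneg _))).trans_le
    (hAle w z)

theorem exists_one_add_norm_pow_le_inv_fockWeight (n N : ℕ) (β : ℝ) : ∃ C : ℝ, 0 < C ∧
    ∀ w : Cn n, (1 + ‖w‖) ^ N ≤ C * (fockWeight β w)⁻¹ := by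
  obtain ⟨C, hC, hle⟩ := exists_fockWeight_mul_exp_le n (β - N) 0
  refine ⟨C, hC, fun w => ?_⟩
  rw [← div_eq_mul_inv, le_div_iff₀ (fockWeight_pos β w)]
  simpa [sub_eq_add_neg, fockWeight_add, mul_comm] using hle w

theorem exists_integral_expGenFun_inv_pairingCoeff_le (hn : 0 < n) (α β : ℝ) : ∃ C : ℝ, 0 ≤ C ∧
    ∀ w : Cn n, Integrable (fun z => fockWeight α z *
      ‖expGenFun (fun k => (pairingCoeff n (α + β) k)⁻¹) (inner ℂ w z)‖) (fockVol n) ∧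
    ∫ z, fockWeight α z *
      ‖expGenFun (fun k => (pairingCoeff n (α + β) k)⁻¹) (inner ℂ w z)‖ ∂fockVol n ≤
        C * (fockWeight β w)⁻¹ := by
  obtain ⟨A, hA, hAle⟩ := exists_fockWeight_mul_norm_expGenFun_inv_pairingCoeff_le hn α (α + β)
  have hb := floor_add_one_sub_half_pos (α + β)
  have := ProbabilityTheory.isProbabilityMeasureBeta (Nat.cast_pos.2 hn) hb
  set N := ⌊|(α + β) / 2|⌋₊ + 1
  set b := (N : ℝ) - (α + β) / 2 with b_def
  obtain ⟨B, hB, hBle⟩ := exists_integral_fockWeight_mul_integral_betaMeasure_le hn hb (α - N)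
  obtain ⟨D, hD, hDle⟩ := exists_one_add_norm_pow_le_inv_fockWeight n N β
  set I := ∫ z : Cn n, fockWeight (α - N) z ∂fockVol n
  have hI : 0 ≤ I := integral_nonneg fun z => (fockWeight_pos _ z).le
  refine ⟨A * (D * I + B), by positivity, fun w =>
    have integrable_kernel :=
      integrable_fockWeight_mul_expGenFun_inv_pairingCoeff hn α (α + β) w
    ⟨integrable_kernel, ?_⟩⟩
  have integrable_average := integrable_fockWeight_mul_integral_exp_re_inner (α - N) w
    ((ae_betaMeasure_mem_Ioo n b).mono fun t ht => Set.Ioo_subset_Icc_self ht)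
  have exponent_eq : (1 + ‖w‖) ^ N * (1 + ‖w‖) ^ (-(α - N) - 2 * b) = (1 + ‖w‖) ^ β := by
    rw [← Real.rpow_natCast, ← Real.rpow_add (by positivity), b_def]
    ring_nf
  calc _ ≤ A * (1 + ‖w‖) ^ N * (I + ∫ z, fockWeight (α - N) z *
        ∫ t, Real.exp (t * (inner ℂ w z).re) ∂ProbabilityTheory.betaMeasure n b ∂fockVol n) := by
        rw [← integral_add (integrable_fockWeight _) integrable_average, ← integral_const_mul]
        exact integral_mono integrable_kernel
          (((integrable_fockWeight (α - N)).add integrable_average).const_mul _) (hAle w)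
    _ ≤ A * (1 + ‖w‖) ^ N *
        (I + B * (1 + ‖w‖) ^ (-(α - N) - 2 * b) * Real.exp (‖w‖ ^ 2 / 2)) := by
        gcongr
        exact hBle w
    _ = A * ((1 + ‖w‖) ^ N * I + B * (fockWeight β w)⁻¹) := by
        rw [inv_fockWeight, ← exponent_eq]
        ring
    _ ≤ A * (D * (fockWeight β w)⁻¹ * I + B * (fockWeight β w)⁻¹) := by
        gcongr
        exact hDle w
    _ = _ := by ring

end KernelIntegral

theorem conj_div_norm_mul_self (x : ℂ) : conj x / ‖x‖ * x = ‖x‖ := by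
  rcases eq_or_ne x 0 with rfl | hx
  · simp
  · have : (‖x‖ : ℂ) ≠ 0 := by simpa using hx
    rw [div_mul_eq_mul_div, Complex.conj_mul', pow_two, mul_div_cancel_right₀ _ this]

theorem integral_norm_apply_le_of_forall_norm_integral_smul_le {X E : Type*} [MeasurableSpace X]
    [NormedAddCommGroup E] [NormedSpace ℂ E] [CompleteSpace E] {μ : Measure X} {f : X → E} {C : ℝ}
    (hf : Integrable f μ) (hC : ∀ θ : X → ℂ, AEStronglyMeasurable θ μ → (∀ x, ‖θ x‖ ≤ 1) →
      ‖∫ x, θ x • f x ∂μ‖ ≤ C) (L : E →L[ℂ] ℂ) : ∫ x, ‖L (f x)‖ ∂μ ≤ C * ‖L‖ := by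
  set θ : X → ℂ := fun x => conj (L (f x)) / ‖L (f x)‖
  have aemeasurable_apply : AEMeasurable (fun x => L (f x)) μ :=
    (L.integrable_comp hf).aestronglyMeasurable.aemeasurable
  have measurable_phase : AEStronglyMeasurable θ μ :=
    ((Complex.continuous_conj.measurable.comp_aemeasurable aemeasurable_apply).div
      (Complex.measurable_ofReal.comp_aemeasurable aemeasurable_apply.norm)).aestronglyMeasurable
  have norm_phase_le (x : X) : ‖θ x‖ ≤ 1 := by
    simpa only [θ, norm_div, RCLike.norm_conj, Complex.norm_real, norm_norm] using div_self_le_one _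
  have integrable_phase_smul : Integrable (fun x => θ x • f x) μ :=
    hf.bdd_smul 1 measurable_phase (Eventually.of_forall norm_phase_le)
  have apply_integral : L (∫ x, θ x • f x ∂μ) = (∫ x, ‖L (f x)‖ ∂μ : ℝ) := by
    rw [← L.integral_comp_comm integrable_phase_smul, ← integral_complex_ofReal]
    simp only [map_smul, smul_eq_mul, θ, conj_div_norm_mul_self]
  calc ∫ x, ‖L (f x)‖ ∂μ = ‖L (∫ x, θ x • f x ∂μ)‖ := by
        rw [apply_integral, Complex.norm_of_nonneg (integral_nonneg fun x => norm_nonneg _)]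
    _ ≤ ‖L‖ * ‖∫ x, θ x • f x ∂μ‖ := L.le_opNorm _
    _ ≤ C * ‖L‖ := by
        rw [mul_comm]
        gcongr
        exact hC θ measurable_phase norm_phase_le

section WeightedKernelDuality

variable {n : ℕ} {α β C : ℝ} {c : ℕ → ℝ}

theorem norm_setIntegral_smul_weightedKernel_le (hC : 0 ≤ C) (hc : GeometricGrowth c)
    (h : ∀ w : Cn n, Integrable (fun z => fockWeight α z * ‖expGenFun c (inner ℂ w z)‖)
        (fockVol n) ∧
      ∫ z, fockWeight α z * ‖expGenFun c (inner ℂ w z)‖ ∂fockVol n ≤ C * (fockWeight β w)⁻¹)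
    {s : Set (Cn n)} (hs : IntegrableOn
      (fun z => (fockWeight α z : ℂ) • weightedKernel n β c z) s (fockVol n))
    {θ : Cn n → ℂ} (hθ : AEStronglyMeasurable θ ((fockVol n).restrict s)) (hθ' : ∀ z, ‖θ z‖ ≤ 1) :
    ‖∫ z in s, θ z • (fockWeight α z : ℂ) • weightedKernel n β c z ∂fockVol n‖ ≤ C := by
  refine zeroAtInfty_norm_le hC fun w => ?_
  have hw := fockWeight_pos β w
  have integrable_smul : IntegrableOn
      (fun z => θ z • (fockWeight α z : ℂ) • weightedKernel n β c z) s (fockVol n) :=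
    Integrable.bdd_smul hs 1 hθ (Eventually.of_forall hθ')
  have norm_eval_le (z : Cn n) :
      ‖(θ z • (fockWeight α z : ℂ) • weightedKernel n β c z) w‖ ≤
        fockWeight β w * (fockWeight α z * ‖expGenFun c (inner ℂ w z)‖) := by
    simp only [ZeroAtInftyContinuousMap.smul_apply, smul_eq_mul, weightedKernel_apply hc]
    rw [norm_mul, norm_fockWeight_mul, norm_fockWeight_mul, mul_left_comm (fockWeight β w)]
    have := fockWeight_pos α z
    exact mul_le_of_le_one_left (by positivity) (hθ' z)
  rw [← zeroAtInftyEval_apply, ← ContinuousLinearMap.integral_comp_comm _ integrable_smul]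
  simp only [zeroAtInftyEval_apply]
  calc _ ≤ ∫ z in s, fockWeight β w * (fockWeight α z * ‖expGenFun c (inner ℂ w z)‖)
          ∂fockVol n :=
        norm_integral_le_of_norm_le ((h w).1.const_mul _).integrableOn
          (Eventually.of_forall norm_eval_le)
    _ ≤ ∫ z, fockWeight β w * (fockWeight α z * ‖expGenFun c (inner ℂ w z)‖) ∂fockVol n :=
        setIntegral_le_integral ((h w).1.const_mul _)
          (Eventually.of_forall fun z => (norm_nonneg _).trans (norm_eval_le z))
    _ ≤ fockWeight β w * (C * (fockWeight β w)⁻¹) := by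
        rw [integral_const_mul]
        gcongr
        exact (h w).2
    _ = C := by field_simp

theorem integrable_comp_weightedKernel (hC : 0 ≤ C) (hc : GeometricGrowth c)
    (h : ∀ w : Cn n, Integrable (fun z => fockWeight α z * ‖expGenFun c (inner ℂ w z)‖)
        (fockVol n) ∧
      ∫ z, fockWeight α z * ‖expGenFun c (inner ℂ w z)‖ ∂fockVol n ≤ C * (fockWeight β w)⁻¹)
    (L : C₀(Cn n, ℂ) →L[ℂ] ℂ) :
    Integrable (fun z => (fockWeight α z : ℂ) * L (weightedKernel n β c z)) (fockVol n) ∧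
      ∫ z, ‖(fockWeight α z : ℂ) * L (weightedKernel n β c z)‖ ∂fockVol n ≤ C * ‖L‖ := by
  have continuous_smul_kernel :
      Continuous fun z => (fockWeight α z : ℂ) • weightedKernel n β c z :=
    (Complex.continuous_ofReal.comp (continuous_fockWeight α)).smul (continuous_weightedKernel hc)
  have integrableOn_ball (R : ℝ) : IntegrableOn
      (fun z => (fockWeight α z : ℂ) • weightedKernel n β c z)
      (Metric.closedBall 0 R) (fockVol n) :=
    continuous_smul_kernel.continuousOn.integrableOn_compact (isCompact_closedBall 0 R)
  have integral_ball_le (R : ℝ) : ∫ z in Metric.closedBall 0 R,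
      ‖(fockWeight α z : ℂ) * L (weightedKernel n β c z)‖ ∂fockVol n ≤ C * ‖L‖ := by
    simpa only [map_smul, smul_eq_mul] using
      integral_norm_apply_le_of_forall_norm_integral_smul_le (integrableOn_ball R)
        (fun θ hθ hθ' =>
          norm_setIntegral_smul_weightedKernel_le hC hc h (integrableOn_ball R) hθ hθ') L
  have cover : AECover (fockVol n) atTop fun R : ℕ => Metric.closedBall (0 : Cn n) R :=
    aecover_closedBall tendsto_natCast_atTop_atTop
  have integrable_apply : Integrable
      (fun z => (fockWeight α z : ℂ) * L (weightedKernel n β c z)) (fockVol n) := by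
    refine cover.integrable_of_integral_norm_bounded (C * ‖L‖) (fun R => ?_)
      (Eventually.of_forall fun R => integral_ball_le R)
    simpa only [IntegrableOn, map_smul, smul_eq_mul] using L.integrable_comp (integrableOn_ball R)
  exact ⟨integrable_apply, le_of_tendsto
    (cover.integral_tendsto_of_countably_generated integrable_apply.norm)
    (Eventually.of_forall fun R => integral_ball_le R)⟩

end WeightedKernelDuality

theorem norm_le_toReal_eLpNorm_top {X E : Type*} [TopologicalSpace X] [MeasurableSpace X]
    [NormedAddCommGroup E] {μ : Measure X} [μ.IsOpenPosMeasure] {φ : X → E} (hφ : Continuous φ)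
    (hm : MemLp φ ∞ μ) (x : X) : ‖φ x‖ ≤ (eLpNorm φ ∞ μ).toReal := by
  have ae_norm_le : ∀ᵐ x ∂μ, ‖φ x‖ ≤ (eLpNorm φ ∞ μ).toReal := by
    filter_upwards [ae_le_eLpNormEssSup (f := φ) (μ := μ)] with x hx
    rw [← eLpNorm_exponent_top] at hx
    simpa only [toReal_enorm] using ENNReal.toReal_mono hm.2.ne hx
  have dense := Measure.dense_of_ae ae_norm_le
  exact (isClosed_le hφ.norm continuous_const).closure_subset (dense x)

theorem exists_extension_of_linearIsometry {𝕜 E F : Type*} [RCLike 𝕜] [NormedAddCommGroup E]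
    [NormedSpace 𝕜 E] [NormedAddCommGroup F] [NormedSpace 𝕜 F] (J : E →ₗᵢ[𝕜] F)
    (f : StrongDual 𝕜 E) : ∃ g : StrongDual 𝕜 F, (∀ x, g (J x) = f x) ∧ ‖g‖ = ‖f‖ := by
  obtain ⟨g, hg, norm_eq⟩ := exists_extension_norm_eq J.range
    (f.comp (J.equivRange.symm : J.range →L[𝕜] E))
  refine ⟨g, fun x => ?_, norm_eq.trans (f.opNorm_comp_linearIsometryEquiv _)⟩
  have apply_equivRange := hg (J.equivRange x)
  simpa using apply_equivRange

section ConjDual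

variable {E : Type*} [NormedAddCommGroup E] [NormedSpace ℂ E] [StarAddMonoid E]
  [NormedStarGroup E] [StarModule ℂ E]

/-- The conjugate `x ↦ conj (L (x*))` of a bounded linear functional `L`. -/
noncomputable def conjDual (L : StrongDual ℂ E) : StrongDual ℂ E :=
  ((starL ℂ : ℂ ≃L⋆[ℂ] ℂ) : ℂ →L⋆[ℂ] ℂ).comp (L.comp ((starL ℂ : E ≃L⋆[ℂ] E) : E →L⋆[ℂ] E))

theorem conjDual_apply (L : StrongDual ℂ E) (x : E) : conjDual L x = conj (L (star x)) := rfl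

theorem norm_conjDual_le (L : StrongDual ℂ E) : ‖conjDual L‖ ≤ ‖L‖ :=
  (conjDual L).opNorm_le_bound (norm_nonneg L) fun x => by
    rw [conjDual_apply, RCLike.norm_conj, ← norm_star x]
    exact L.le_opNorm (star x)

end ConjDual

/-- The norm `∫ |f| w_γ dV` of `F^1_γ`, for a bare function. -/
noncomputable def weightedL1Norm {n : ℕ} (γ : ℝ) (f : Cn n → ℂ) : ℝ :=
  ∫ z, ‖(fockWeight γ z : ℂ) * f z‖ ∂(fockVol n)

section Spaces

variable {n : ℕ}

theorem weightedL1Norm_nonneg (γ : ℝ) (f : Cn n → ℂ) : 0 ≤ weightedL1Norm γ f :=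
  integral_nonneg fun _ => norm_nonneg _

theorem fockWeighted_top (β : ℝ) (f : Cn n → ℂ) :
    fockWeighted ∞ β f = fun z => (fockWeight β z : ℂ) * f z := by
  funext z
  simp [fockWeighted, fockExponent, fockWeight]

theorem fockWeighted_one (α : ℝ) (f : Cn n → ℂ) :
    fockWeighted 1 α f = fun z => (fockWeight α z : ℂ) * f z := by
  funext z
  simp [fockWeighted, fockExponent, fockWeight]

/-- A function satisfying `MemFockOne α`, as an element of `F^1_α`. -/
def MemFockOne.toFockSpace {α : ℝ} {g : Cn n → ℂ} (hg : MemFockOne α g) : FockSpace n 1 α :=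
  ⟨g, hg.differentiable, by
    rw [memLp_one_iff_integrable, fockWeighted_one]
    exact hg.integrable⟩

namespace FockSpace

theorem memFockOne {α : ℝ} (g : FockSpace n 1 α) : MemFockOne α g where
  differentiable := g.2.1
  integrable := by
    rw [← fockWeighted_one, ← memLp_one_iff_integrable]
    exact g.2.2

theorem norm_eq_weightedL1Norm {α : ℝ} (g : FockSpace n 1 α) : ‖g‖ = weightedL1Norm α g := by
  rw [norm_def, fockWeighted_one, eLpNorm_one_eq_lintegral_enorm, weightedL1Norm,
    integral_norm_eq_lintegral_enorm g.memFockOne.integrable.aestronglyMeasurable]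

variable {β : ℝ} (f : FockSpace n ∞ β)

theorem continuous : Continuous f := f.2.1.continuous

theorem fockWeight_mul_norm_le (z : Cn n) : fockWeight β z * ‖f z‖ ≤ ‖f‖ := by
  rw [norm_def, ← norm_fockWeight_mul]
  simpa only [fockWeighted_top] using
    norm_le_toReal_eLpNorm_top (continuous_fockWeighted f) f.2.2 z

theorem norm_fockWeight_mul_le_one_add_norm_rpow (δ : ℝ) (z : Cn n) :
    ‖(fockWeight (β + δ) z : ℂ) * f z‖ ≤ (1 + ‖z‖) ^ (-δ) * ‖f‖ := by
  rw [norm_fockWeight_mul, fockWeight_add, mul_right_comm, mul_comm]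
  exact mul_le_mul_of_nonneg_left (f.fockWeight_mul_norm_le z) (by positivity)

theorem memFockOne_of_top {δ : ℝ} (hδ : 2 * n < δ) : MemFockOne (β + δ) f where
  differentiable := f.2.1
  integrable := by
    have integrable_majorant := (integrable_one_add_norm (μ := fockVol n) (r := δ)
      (by rw [finrank_real_Cn]; exact_mod_cast hδ)).mul_const ‖f‖
    exact integrable_majorant.mono' ((Complex.continuous_ofReal.comp
        (continuous_fockWeight _)).mul f.continuous).aestronglyMeasurable
      (Eventually.of_forall (f.norm_fockWeight_mul_le_one_add_norm_rpow δ))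

theorem weightedL1Norm_le_of_top {δ : ℝ} (hδ : 2 * n < δ) :
    weightedL1Norm (β + δ) f ≤ (∫ z : Cn n, (1 + ‖z‖) ^ (-δ) ∂fockVol n) * ‖f‖ := by
  rw [weightedL1Norm, ← integral_mul_const]
  exact integral_mono (f.memFockOne_of_top hδ).integrable.norm
    ((integrable_one_add_norm (by rw [finrank_real_Cn]; exact_mod_cast hδ)).mul_const _)
    (f.norm_fockWeight_mul_le_one_add_norm_rpow δ)

end FockSpace

theorem mul_exp_div_eq_norm_fockWeight_mul (β : ℝ) (x : ℂ) (z : Cn n) :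
    ‖x‖ * Real.exp (-‖z‖ ^ 2 / 2) / (1 + ‖z‖) ^ β = ‖(fockWeight β z : ℂ) * x‖ := by
  rw [norm_fockWeight_mul, fockWeight, Real.rpow_neg (by positivity), div_eq_mul_inv]
  ring

/-- The weighted function `w_β f`, as an element of `C₀(ℂⁿ)`. -/
noncomputable def weightedZeroAtInfty {β : ℝ} (f : littleFock n β) : C₀(Cn n, ℂ) where
  toFun z := (fockWeight β z : ℂ) * f.1 z
  continuous_toFun := (Complex.continuous_ofReal.comp (continuous_fockWeight β)).mul f.1.continuous
  zero_at_infty' := by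
    rw [tendsto_zero_iff_norm_tendsto_zero]
    exact f.2.congr fun z => mul_exp_div_eq_norm_fockWeight_mul β (f.1 z) z

theorem weightedZeroAtInfty_apply {β : ℝ} (f : littleFock n β) (z : Cn n) :
    weightedZeroAtInfty f z = (fockWeight β z : ℂ) * f.1 z := rfl

theorem norm_weightedZeroAtInfty {β : ℝ} (f : littleFock n β) :
    ‖weightedZeroAtInfty f‖ = ‖f‖ := by
  refine le_antisymm ?_ ?_
  · refine zeroAtInfty_norm_le (norm_nonneg f.1) fun z => ?_
    rw [weightedZeroAtInfty_apply, norm_fockWeight_mul]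
    exact f.1.fockWeight_mul_norm_le z
  · change ‖f.1‖ ≤ _
    rw [FockSpace.norm_def]
    refine ENNReal.toReal_le_of_le_ofReal (norm_nonneg _) ?_
    rw [eLpNorm_exponent_top, fockWeighted_top]
    exact eLpNormEssSup_le_of_ae_bound (Eventually.of_forall
      (zeroAtInfty_norm_apply_le (weightedZeroAtInfty f)))

/-- Multiplication by the weight, as an isometry of the little space into `C₀(ℂⁿ)`. -/
noncomputable def littleToZeroAtInfty (n : ℕ) (β : ℝ) : littleFock n β →ₗᵢ[ℂ] C₀(Cn n, ℂ) where
  toFun := weightedZeroAtInfty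
  map_add' f g := by
    ext z
    exact mul_add _ (f.1 z) (g.1 z)
  map_smul' c f := by
    ext z
    exact mul_left_comm _ c (f.1 z)
  norm_map' := norm_weightedZeroAtInfty

theorem littleToZeroAtInfty_apply {β : ℝ} (f : littleFock n β) (z : Cn n) :
    littleToZeroAtInfty n β f z = (fockWeight β z : ℂ) * f.1 z := rfl

theorem norm_weightedMonomial_const_apply (β : ℝ) (k : ℕ) (z u : Cn n) :
    ‖weightedMonomial β (fun _ : Fin k => z) u‖ =
      ‖(fockWeight β u : ℂ) * (inner ℂ z u : ℂ) ^ k‖ := by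
  rw [weightedMonomial_const_apply, norm_mul, norm_mul, norm_pow, norm_pow, norm_inner_symm]

/-- The monomial `u ↦ ⟪z, u⟫^k`, as an element of the little space. -/
noncomputable def littleMonomial (β : ℝ) (k : ℕ) (z : Cn n) : littleFock n β where
  val := ⟨fun u => (inner ℂ z u : ℂ) ^ k, (innerSL ℂ z).differentiable.pow k, by
    have := continuous_fockWeight (n := n) β
    rw [fockWeighted_top]
    refine memLp_top_of_bound (Continuous.aestronglyMeasurable (by fun_prop))
      ‖weightedMonomial β (fun _ : Fin k => z)‖ (Eventually.of_forall fun u => ?_)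
    rw [← norm_weightedMonomial_const_apply]
    exact zeroAtInfty_norm_apply_le _ u⟩
  property := by
    have tendsto_norm := tendsto_zero_iff_norm_tendsto_zero.1
      (weightedMonomial β (fun _ : Fin k => z)).zero_at_infty'
    refine tendsto_norm.congr fun u => ?_
    rw [mul_exp_div_eq_norm_fockWeight_mul]
    exact norm_weightedMonomial_const_apply β k z u

theorem littleMonomial_apply (β : ℝ) (k : ℕ) (z : Cn n) :
    ((littleMonomial β k z).1 : Cn n → ℂ) = fun u => (inner ℂ z u : ℂ) ^ k := rfl

theorem star_littleToZeroAtInfty_littleMonomial (β : ℝ) (k : ℕ) (z : Cn n) :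
    star (littleToZeroAtInfty n β (littleMonomial β k z)) =
      weightedMonomial β (fun _ : Fin k => z) := by
  ext u
  rw [ZeroAtInftyContinuousMap.star_apply, littleToZeroAtInfty_apply,
    weightedMonomial_const_apply, littleMonomial_apply, Complex.star_def, map_mul, map_pow,
    Complex.conj_ofReal, inner_conj_symm]

theorem exists_conj_extension {β : ℝ} (μ : StrongDual ℂ (littleFock n β)) :
    ∃ L : C₀(Cn n, ℂ) →L[ℂ] ℂ, ‖L‖ ≤ ‖μ‖ ∧
      ∀ f, L (star (littleToZeroAtInfty n β f)) = conj (μ f) := by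
  obtain ⟨Λ, extends_μ, norm_eq⟩ :=
    exists_extension_of_linearIsometry (littleToZeroAtInfty n β) μ
  refine ⟨conjDual Λ, (norm_conjDual_le Λ).trans norm_eq.le, fun f => ?_⟩
  rw [conjDual_apply, star_star, extends_μ]

end Spaces

/-- The Taylor polynomial `∑_{k < p} f_k` of `f` at the origin, of degree less than `p`. It is
`taylorHead s f` for `p = ⌊|s|⌋ + 1`. -/
noncomputable def taylorPoly {n : ℕ} (p : ℕ) (f : Cn n → ℂ) (z : Cn n) : ℂ :=
  ∑ k ∈ Finset.range p, homogPart k f z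

section TaylorBounds

variable {n : ℕ}

theorem differentiable_taylorPoly (p : ℕ) (f : Cn n → ℂ) : Differentiable ℂ (taylorPoly p f) :=
  Differentiable.fun_sum fun k _ => (contDiff_homogPart k f).differentiable (by simp)

theorem MemFockOne.norm_toDual_le {γ : ℝ} {f : Cn n → ℂ} (hf : MemFockOne γ f) :
    ‖hf.toDual‖ ≤ weightedL1Norm γ f :=
  LinearMap.mkContinuous_norm_le _ (weightedL1Norm_nonneg γ f) _

theorem exists_norm_homogPart_le (n : ℕ) (γ : ℝ) {T : ℝ} (hT : 0 < T) :
    ∃ C : ℝ, 0 ≤ C ∧ ∀ f : Cn n → ℂ, MemFockOne γ f → ∀ (k : ℕ) (z : Cn n),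
      ‖homogPart k f z‖ ≤ C * weightedL1Norm γ f * (‖z‖ / T) ^ k := by
  obtain ⟨C, hC, hle⟩ := exists_fockWeight_mul_exp_le n (-γ) T
  refine ⟨C, hC.le, fun f hf k z => ?_⟩
  have norm_monomial_le := norm_weightedMonomial_le hT hC.le hle fun _ : Fin k => z
  rw [Fin.prod_const] at norm_monomial_le
  rw [hf.homogPart_eq_toDual, norm_mul, Complex.norm_of_nonneg (by positivity)]
  calc 1 / k.factorial * ‖hf.toDual (weightedMonomial (-γ) fun _ : Fin k => z)‖
      ≤ 1 / k.factorial *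
          (weightedL1Norm γ f * (C * (k.factorial * (T⁻¹) ^ k) * ‖z‖ ^ k)) := by
        gcongr
        exact hf.toDual.le_of_opNorm_le_of_le hf.norm_toDual_le norm_monomial_le
    _ = C * weightedL1Norm γ f * (‖z‖ / T) ^ k := by
        rw [div_eq_mul_inv ‖z‖, mul_pow]
        field_simp

theorem exists_norm_sub_taylorPoly_le (n : ℕ) (γ : ℝ) (p : ℕ) : ∃ C : ℝ, 0 ≤ C ∧
    ∀ f : Cn n → ℂ, MemFockOne γ f → ∀ z : Cn n, ‖z‖ ≤ 1 →
      ‖f z - taylorPoly p f z‖ ≤ C * weightedL1Norm γ f * ‖z‖ ^ p := by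
  obtain ⟨C, hC, homogPart_le⟩ := exists_norm_homogPart_le n γ two_pos
  refine ⟨C * 2, by positivity, fun f hf z hz => ?_⟩
  have hasSum_remainder : HasSum (fun k => homogPart (k + p) f z) (f z - taylorPoly p f z) :=
    (hasSum_nat_add_iff' p).2 (hf.hasSum_homogPart z)
  have L_nonneg := weightedL1Norm_nonneg γ f
  rw [← hasSum_remainder.tsum_eq]
  calc ‖∑' k, homogPart (k + p) f z‖ ≤ C * weightedL1Norm γ f * ‖z‖ ^ p * 2 := by
        refine tsum_of_norm_bounded (hasSum_geometric_two.mul_left _) fun k => ?_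
        refine (homogPart_le f hf (k + p) z).trans ?_
        rw [mul_assoc _ (‖z‖ ^ p), pow_add, mul_comm (_ ^ k)]
        gcongr
        exact half_le_self (norm_nonneg z)
    _ = C * 2 * weightedL1Norm γ f * ‖z‖ ^ p := by ring

theorem exists_norm_taylorPoly_le (n : ℕ) (γ : ℝ) (p : ℕ) : ∃ C : ℝ, 0 ≤ C ∧
    ∀ f : Cn n → ℂ, MemFockOne γ f → ∀ z : Cn n,
      ‖taylorPoly p f z‖ ≤ C * weightedL1Norm γ f * (1 + ‖z‖) ^ p := by
  obtain ⟨C, hC, homogPart_le⟩ := exists_norm_homogPart_le n γ one_pos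
  refine ⟨p * C, by positivity, fun f hf z => ?_⟩
  have L_nonneg := weightedL1Norm_nonneg γ f
  calc ‖taylorPoly p f z‖
      ≤ ∑ _k ∈ Finset.range p, C * weightedL1Norm γ f * (1 + ‖z‖) ^ p := by
        refine norm_sum_le_of_le _ fun k hk => (homogPart_le f hf k z).trans ?_
        rw [div_one]
        gcongr
        exact (pow_le_pow_left₀ (norm_nonneg z) (by simp) k).trans
          (pow_le_pow_right₀ (by simp) (Finset.mem_range.1 hk).le)
    _ = p * C * weightedL1Norm γ f * (1 + ‖z‖) ^ p := by
        rw [Finset.sum_const, Finset.card_range, nsmul_eq_mul]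
        ring

theorem exists_norm_fockWeight_mul_taylorPoly_le (n : ℕ) (γ δ : ℝ) (p : ℕ) :
    ∃ C : ℝ, 0 ≤ C ∧ ∀ f : Cn n → ℂ, MemFockOne γ f → ∀ z : Cn n,
      ‖(fockWeight δ z : ℂ) * taylorPoly p f z‖ ≤
        C * weightedL1Norm γ f * fockWeight (δ - p) z := by
  obtain ⟨C, hC, taylorPoly_le⟩ := exists_norm_taylorPoly_le n γ p
  refine ⟨C, hC, fun f hf z => ?_⟩
  have weight_nonneg := (fockWeight_pos δ z).le
  rw [norm_fockWeight_mul, sub_eq_add_neg, fockWeight_add, neg_neg, Real.rpow_natCast,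
    mul_left_comm]
  gcongr
  exact taylorPoly_le f hf z

theorem exists_fockWeight_mul_norm_taylorPoly_le (n : ℕ) (γ δ : ℝ) (p : ℕ) :
    ∃ C : ℝ, 0 ≤ C ∧ ∀ f : Cn n → ℂ, MemFockOne γ f → ∀ z : Cn n,
      fockWeight δ z * ‖taylorPoly p f z‖ ≤ C * weightedL1Norm γ f := by
  obtain ⟨C, hC, weighted_le⟩ := exists_norm_fockWeight_mul_taylorPoly_le n γ δ p
  obtain ⟨D, hD, weight_le⟩ := exists_fockWeight_mul_exp_le n (δ - p) 0
  simp only [zero_mul, Real.exp_zero, mul_one] at weight_le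
  refine ⟨C * D, by positivity, fun f hf z => ?_⟩
  have L_nonneg := weightedL1Norm_nonneg γ f
  rw [← norm_fockWeight_mul, mul_right_comm]
  exact (weighted_le f hf z).trans (by gcongr; exact weight_le z)

theorem MemFockOne.taylorPoly {γ : ℝ} {f : Cn n → ℂ} (hf : MemFockOne γ f) (δ : ℝ) (p : ℕ) :
    MemFockOne δ (taylorPoly p f) where
  differentiable := differentiable_taylorPoly p f
  integrable := by
    obtain ⟨C, -, weighted_le⟩ := exists_norm_fockWeight_mul_taylorPoly_le n γ δ p
    exact ((integrable_fockWeight (δ - p)).const_mul _).mono'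
      ((Complex.continuous_ofReal.comp (continuous_fockWeight δ)).mul
        (differentiable_taylorPoly p f).continuous).aestronglyMeasurable
      (Eventually.of_forall (weighted_le f hf))

theorem exists_weightedL1Norm_taylorPoly_le (n : ℕ) (γ δ : ℝ) (p : ℕ) :
    ∃ C : ℝ, 0 ≤ C ∧ ∀ f : Cn n → ℂ, MemFockOne γ f →
      weightedL1Norm δ (taylorPoly p f) ≤ C * weightedL1Norm γ f := by
  obtain ⟨C, hC, weighted_le⟩ := exists_norm_fockWeight_mul_taylorPoly_le n γ δ p
  refine ⟨C * ∫ z : Cn n, fockWeight (δ - p) z ∂fockVol n,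
    mul_nonneg hC (integral_nonneg fun z => (fockWeight_pos _ z).le), fun f hf => ?_⟩
  rw [mul_right_comm, ← integral_const_mul]
  exact integral_mono (hf.taylorPoly δ p).integrable.norm
    ((integrable_fockWeight (δ - p)).const_mul _) (weighted_le f hf)

section Sub

variable {γ : ℝ} {f g : Cn n → ℂ}

theorem MemFockOne.sub (hf : MemFockOne γ f) (hg : MemFockOne γ g) :
    MemFockOne γ (fun z => f z - g z) where
  differentiable := hf.differentiable.sub hg.differentiable
  integrable := by
    simp only [mul_sub]
    exact hf.integrable.sub hg.integrable

theorem weightedL1Norm_sub_le (hf : MemFockOne γ f) (hg : MemFockOne γ g) :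
    weightedL1Norm γ (fun z => f z - g z) ≤ weightedL1Norm γ f + weightedL1Norm γ g := by
  rw [weightedL1Norm, weightedL1Norm, weightedL1Norm,
    ← integral_add hf.integrable.norm hg.integrable.norm]
  refine integral_mono (hf.sub hg).integrable.norm
    (hf.integrable.norm.add hg.integrable.norm) fun z => ?_
  simp only [mul_sub]
  exact norm_sub_le _ _

end Sub

end TaylorBounds

section PairingBounds

variable {n : ℕ} {F G : Cn n → ℂ}

theorem norm_rawIntegrand (σ : ℝ) (F G : Cn n → ℂ) (z : Cn n) :
    ‖rawIntegrand σ F G z‖ = ‖F z‖ * ‖G z‖ * (Real.exp (-‖z‖ ^ 2) * ‖z‖ ^ (-σ)) := by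
  rw [rawIntegrand, norm_mul, norm_mul, RCLike.norm_conj,
    Complex.norm_of_nonneg (by positivity)]

theorem aestronglyMeasurable_rawIntegrand (σ : ℝ) (hF : Continuous F) (hG : Continuous G) :
    AEStronglyMeasurable (rawIntegrand σ F G) (fockVol n) := by
  have measurable_weight : Measurable fun z : Cn n => Real.exp (-‖z‖ ^ 2) * ‖z‖ ^ (-σ) :=
    (Continuous.measurable (by fun_prop)).mul (measurable_norm.pow_const _)
  exact ((hF.mul (Complex.continuous_conj.comp hG)).measurable.mul
    (Complex.measurable_ofReal.comp measurable_weight)).aestronglyMeasurable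

theorem integrableOn_norm_pow_mul_rpow (hn : 0 < n) {σ : ℝ} {m : ℕ} (hm : σ < 2 * n + m) :
    IntegrableOn (fun z : Cn n => ‖z‖ ^ m * ‖z‖ ^ (-σ)) (Metric.ball 0 1) (fockVol n) := by
  have : Nonempty (Fin n) := ⟨⟨0, hn⟩⟩
  rw [integrableOn_fun_norm_addHaar (fockVol n) (f := fun r : ℝ => r ^ m * r ^ (-σ)),
    finrank_real_Cn]
  have integrable_radial :
      IntegrableOn (fun r : ℝ => r ^ ((2 * n - 1 : ℕ) + m - σ)) (Set.Ioo 0 1) := by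
    rw [intervalIntegral.integrableOn_Ioo_rpow_iff one_pos, Nat.cast_sub (by lia)]
    push_cast
    linarith
  refine integrable_radial.congr_fun (fun r hr => ?_) measurableSet_Ioo
  simp only [smul_eq_mul]
  rw [sub_eq_add_neg, Real.rpow_add hr.1, Real.rpow_add hr.1, Real.rpow_natCast,
    Real.rpow_natCast, mul_assoc]

theorem rpow_neg_le_of_one_le {r : ℝ} (hr : 1 ≤ r) (σ : ℝ) :
    r ^ (-σ) ≤ 2 ^ |σ| * (1 + r) ^ (-σ) := by
  have shift_le := one_add_rpow_le_mul (r := r - 1) (s := r) (d := 1) (by linarith) (by linarith)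
    (by norm_num) (-σ)
  rwa [add_sub_cancel, abs_neg, one_add_one_eq_two, mul_comm] at shift_le

theorem norm_rawIntegrand_le_of_one_le {α β A : ℝ} {z : Cn n} (hz : 1 ≤ ‖z‖)
    (hF : fockWeight β z * ‖F z‖ ≤ A) :
    ‖rawIntegrand (α + β) F G z‖ ≤ 2 ^ |α + β| * A * ‖(fockWeight α z : ℂ) * G z‖ := by
  have weight_mul : Real.exp (-‖z‖ ^ 2) * (1 + ‖z‖) ^ (-(α + β)) =
      fockWeight α z * fockWeight β z := by
    unfold fockWeight
    rw [mul_mul_mul_comm, ← Real.exp_add, ← Real.rpow_add (by positivity), neg_add, add_halves]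
  have weight_pos := fockWeight_pos α z
  rw [norm_rawIntegrand, norm_fockWeight_mul]
  calc ‖F z‖ * ‖G z‖ * (Real.exp (-‖z‖ ^ 2) * ‖z‖ ^ (-(α + β)))
      ≤ ‖F z‖ * ‖G z‖ *
          (Real.exp (-‖z‖ ^ 2) * (2 ^ |α + β| * (1 + ‖z‖) ^ (-(α + β)))) := by
        gcongr
        exact rpow_neg_le_of_one_le hz _
    _ = 2 ^ |α + β| * (fockWeight β z * ‖F z‖) * (fockWeight α z * ‖G z‖) := by
        rw [mul_left_comm (Real.exp _), weight_mul]
        ring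
    _ ≤ 2 ^ |α + β| * A * (fockWeight α z * ‖G z‖) := by gcongr

theorem norm_rawIntegrand_le_of_mul_le {σ D : ℝ} {m : ℕ} {z : Cn n}
    (hFG : ‖F z‖ * ‖G z‖ ≤ D * ‖z‖ ^ m) :
    ‖rawIntegrand σ F G z‖ ≤ D * (‖z‖ ^ m * ‖z‖ ^ (-σ)) := by
  rw [norm_rawIntegrand, ← mul_assoc D]
  refine mul_le_mul hFG (mul_le_of_le_one_left (by positivity) ?_) (by positivity)
    ((by positivity : 0 ≤ ‖F z‖ * ‖G z‖).trans hFG)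
  exact Real.exp_le_one_iff.2 (neg_nonpos.2 (sq_nonneg _))

theorem exists_rawPairing_bound (hn : 0 < n) (α β : ℝ) {m : ℕ} (hm : α + β < 2 * n + m) :
    ∃ C : ℝ, 0 ≤ C ∧ ∀ (F G : Cn n → ℂ) (A D : ℝ), Continuous F → MemFockOne α G →
      0 ≤ A → 0 ≤ D → (∀ z, fockWeight β z * ‖F z‖ ≤ A) →
      (∀ z, ‖z‖ ≤ 1 → ‖F z‖ * ‖G z‖ ≤ D * ‖z‖ ^ m) →
      Integrable (rawIntegrand (α + β) F G) (fockVol n) ∧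
        ‖rawPairing (α + β) F G‖ ≤ C * (A * weightedL1Norm α G + D) := by
  set H : Cn n → ℝ := (Metric.ball 0 1).indicator fun z => ‖z‖ ^ m * ‖z‖ ^ (-(α + β))
  have H_nonneg (z) : 0 ≤ H z := Set.indicator_nonneg (fun z _ => by positivity) z
  have integrable_H : Integrable H (fockVol n) :=
    (integrable_indicator_iff measurableSet_ball).2 (integrableOn_norm_pow_mul_rpow hn hm)
  have integral_H_nonneg : 0 ≤ ∫ z, H z ∂fockVol n := integral_nonneg H_nonneg
  refine ⟨2 ^ |α + β| + ∫ z, H z ∂fockVol n, by positivity,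
    fun F G A D hF hG hA hD hFA hFG => ?_⟩
  have integrand_le (z) : ‖rawIntegrand (α + β) F G z‖ ≤
      2 ^ |α + β| * A * ‖(fockWeight α z : ℂ) * G z‖ + D * H z := by
    rcases lt_or_ge ‖z‖ 1 with hz | hz
    · have H_eq : H z = ‖z‖ ^ m * ‖z‖ ^ (-(α + β)) :=
        Set.indicator_of_mem (mem_ball_zero_iff.2 hz) _
      rw [H_eq]
      exact (norm_rawIntegrand_le_of_mul_le (hFG z hz.le)).trans
        (le_add_of_nonneg_left (by positivity))
    · exact (norm_rawIntegrand_le_of_one_le hz (hFA z)).trans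
        (le_add_of_nonneg_right (mul_nonneg hD (H_nonneg z)))
  have integrable_G := hG.integrable.norm.const_mul (2 ^ |α + β| * A)
  have integrable_majorant := integrable_G.add (integrable_H.const_mul D)
  refine ⟨integrable_majorant.mono' (aestronglyMeasurable_rawIntegrand _ hF hG.continuous)
    (Eventually.of_forall integrand_le), ?_⟩
  have L_nonneg := weightedL1Norm_nonneg α G
  calc ‖rawPairing (α + β) F G‖
      ≤ ∫ z, (2 ^ |α + β| * A * ‖(fockWeight α z : ℂ) * G z‖ + D * H z) ∂fockVol n :=
        norm_integral_le_of_norm_le integrable_majorant (Eventually.of_forall integrand_le)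
    _ = 2 ^ |α + β| * (A * weightedL1Norm α G) + (∫ z, H z ∂fockVol n) * D := by
        rw [integral_add integrable_G (integrable_H.const_mul D), integral_const_mul,
          integral_const_mul, weightedL1Norm, mul_assoc, mul_comm D]
    _ ≤ _ := by
        rw [add_mul]
        gcongr
        · exact le_add_of_nonneg_right hD
        · exact le_add_of_nonneg_left (by positivity)

theorem FockSpace.exists_memFockOne_of_top (n : ℕ) (β : ℝ) : ∃ γ K : ℝ, 0 ≤ K ∧
    ∀ f : FockSpace n ∞ β, MemFockOne γ f ∧ weightedL1Norm γ f ≤ K * ‖f‖ :=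
  ⟨β + (2 * n + 1), ∫ z : Cn n, (1 + ‖z‖) ^ (-(2 * n + 1 : ℝ)) ∂fockVol n,
    integral_nonneg fun z => by positivity,
    fun f => ⟨f.memFockOne_of_top (lt_add_one _), f.weightedL1Norm_le_of_top (lt_add_one _)⟩⟩

theorem exists_rawPairing_taylorPoly_bound (n : ℕ) (α β : ℝ) (p : ℕ) :
    ∃ C : ℝ, 0 ≤ C ∧ ∀ (f : FockSpace n ∞ β) (g : FockSpace n 1 α),
      Integrable (rawIntegrand 0 (taylorPoly p f) (taylorPoly p g)) (fockVol n) ∧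
        ‖rawPairing 0 (taylorPoly p f) (taylorPoly p g)‖ ≤ C * (‖f‖ * ‖g‖) := by
  obtain ⟨γ, K, hK, memFockOne_f⟩ := FockSpace.exists_memFockOne_of_top n β
  obtain ⟨a, ha, poly_f_le⟩ := exists_norm_taylorPoly_le n γ p
  obtain ⟨b, hb, poly_g_le⟩ := exists_norm_taylorPoly_le n α p
  have integrable_gaussian := integrable_one_add_norm_rpow_mul_gaussian (fockVol n) (2 * p : ℕ)
  refine ⟨a * K * b * ∫ z : Cn n, (1 + ‖z‖) ^ ((2 * p : ℕ) : ℝ) * Real.exp (-‖z‖ ^ 2 / 2)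
    ∂fockVol n, mul_nonneg (by positivity) (integral_nonneg fun z => by positivity),
    fun f g => ?_⟩
  have integrand_le (z) : ‖rawIntegrand 0 (taylorPoly p f) (taylorPoly p g) z‖ ≤
      a * (K * ‖f‖) * (b * ‖g‖) *
        ((1 + ‖z‖) ^ ((2 * p : ℕ) : ℝ) * Real.exp (-‖z‖ ^ 2 / 2)) := by
    have f_le : ‖taylorPoly p f z‖ ≤ a * (K * ‖f‖) * (1 + ‖z‖) ^ p :=
      (poly_f_le f (memFockOne_f f).1 z).trans (by gcongr; exact (memFockOne_f f).2)
    have g_le : ‖taylorPoly p g z‖ ≤ b * ‖g‖ * (1 + ‖z‖) ^ p :=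
      g.norm_eq_weightedL1Norm ▸ poly_g_le g g.memFockOne z
    rw [norm_rawIntegrand, neg_zero, Real.rpow_zero, mul_one, Real.rpow_natCast, two_mul, pow_add]
    calc _ ≤ (a * (K * ‖f‖) * (1 + ‖z‖) ^ p) * (b * ‖g‖ * (1 + ‖z‖) ^ p) *
          Real.exp (-‖z‖ ^ 2 / 2) := by
          gcongr
          nlinarith [sq_nonneg ‖z‖]
      _ = _ := by ring
  refine ⟨(integrable_gaussian.const_mul _).mono' (aestronglyMeasurable_rawIntegrand _
    (differentiable_taylorPoly p f).continuous (differentiable_taylorPoly p g).continuous)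
    (Eventually.of_forall integrand_le), ?_⟩
  refine (norm_integral_le_of_norm_le (integrable_gaussian.const_mul _)
    (Eventually.of_forall integrand_le)).trans_eq ?_
  rw [integral_const_mul]
  ring

theorem FockSpace.exists_sub_taylorPoly_bounds_of_top (n : ℕ) (β : ℝ) (p : ℕ) :
    ∃ A D : ℝ, 0 ≤ A ∧ 0 ≤ D ∧ ∀ f : FockSpace n ∞ β,
      (∀ z, fockWeight β z * ‖f z - taylorPoly p f z‖ ≤ A * ‖f‖) ∧
        ∀ z, ‖z‖ ≤ 1 → ‖f z - taylorPoly p f z‖ ≤ D * ‖f‖ * ‖z‖ ^ p := by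
  obtain ⟨γ, K, hK, memFockOne_f⟩ := FockSpace.exists_memFockOne_of_top n β
  obtain ⟨a, ha, poly_le⟩ := exists_fockWeight_mul_norm_taylorPoly_le n γ β p
  obtain ⟨d, hd, remainder_le⟩ := exists_norm_sub_taylorPoly_le n γ p
  refine ⟨1 + a * K, d * K, by positivity, by positivity, fun f => ⟨fun z => ?_, fun z hz => ?_⟩⟩
  · have weight_pos := fockWeight_pos β z
    calc fockWeight β z * ‖f z - taylorPoly p f z‖
        ≤ fockWeight β z * ‖f z‖ + fockWeight β z * ‖taylorPoly p f z‖ := by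
          rw [← mul_add]
          gcongr
          exact norm_sub_le _ _
      _ ≤ ‖f‖ + a * (K * ‖f‖) := add_le_add (f.fockWeight_mul_norm_le z)
          ((poly_le f (memFockOne_f f).1 z).trans (by gcongr; exact (memFockOne_f f).2))
      _ = (1 + a * K) * ‖f‖ := by ring
  · refine (remainder_le f (memFockOne_f f).1 z hz).trans ?_
    rw [mul_assoc d K]
    exact mul_le_mul_of_nonneg_right
      (mul_le_mul_of_nonneg_left (memFockOne_f f).2 hd) (by positivity)

theorem exists_rawPairing_sub_taylorPoly_bound (hn : 0 < n) {α β : ℝ} {p : ℕ}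
    (hp : α + β < 2 * n + 2 * p) :
    ∃ C : ℝ, 0 ≤ C ∧ ∀ (f : FockSpace n ∞ β) (g : FockSpace n 1 α),
      Integrable (rawIntegrand (α + β) (fun z => f z - taylorPoly p f z)
        (fun z => g z - taylorPoly p g z)) (fockVol n) ∧
      ‖rawPairing (α + β) (fun z => f z - taylorPoly p f z)
        (fun z => g z - taylorPoly p g z)‖ ≤ C * (‖f‖ * ‖g‖) := by
  obtain ⟨C, hC, pairing_le⟩ :=
    exists_rawPairing_bound hn α β (m := 2 * p) (by push_cast; exact hp)
  obtain ⟨A, D, hA, hD, remainder_f_le⟩ := FockSpace.exists_sub_taylorPoly_bounds_of_top n β p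
  obtain ⟨b, hb, poly_g_le⟩ := exists_weightedL1Norm_taylorPoly_le n α α p
  obtain ⟨d, hd, remainder_g_le⟩ := exists_norm_sub_taylorPoly_le n α p
  refine ⟨C * (A * (1 + b) + D * d), by positivity, fun f g => ?_⟩
  have poly_g := g.memFockOne.taylorPoly α p
  have norm_remainder_g : weightedL1Norm α (fun z => g z - taylorPoly p g z) ≤ (1 + b) * ‖g‖ := by
    refine (weightedL1Norm_sub_le g.memFockOne poly_g).trans ?_
    rw [one_add_mul, g.norm_eq_weightedL1Norm]
    gcongr
    exact poly_g_le g g.memFockOne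
  have mul_remainder_le (z : Cn n) (hz : ‖z‖ ≤ 1) :
      ‖f z - taylorPoly p f z‖ * ‖g z - taylorPoly p g z‖ ≤
        D * ‖f‖ * (d * ‖g‖) * ‖z‖ ^ (2 * p) := by
    calc _ ≤ (D * ‖f‖ * ‖z‖ ^ p) * (d * ‖g‖ * ‖z‖ ^ p) :=
          mul_le_mul ((remainder_f_le f).2 z hz)
            (g.norm_eq_weightedL1Norm ▸ remainder_g_le g g.memFockOne z hz)
            (norm_nonneg _) (by positivity)
      _ = _ := by ring
  obtain ⟨integrable, norm_le⟩ := pairing_le _ _ (A * ‖f‖) (D * ‖f‖ * (d * ‖g‖))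
    (f.continuous.sub (differentiable_taylorPoly p f).continuous) (g.memFockOne.sub poly_g)
    (by positivity) (by positivity) (remainder_f_le f).1 mul_remainder_le
  refine ⟨integrable, norm_le.trans ?_⟩
  calc _ ≤ C * (A * ‖f‖ * ((1 + b) * ‖g‖) + D * ‖f‖ * (d * ‖g‖)) := by gcongr
    _ = _ := by ring

theorem exists_fockPairing_bound (hn : 0 < n) (α β : ℝ) :
    ∃ C : ℝ, 0 ≤ C ∧ ∀ (f : FockSpace n ∞ β) (g : FockSpace n 1 α),
      FockPairingConverges (α + β) f g ∧ ‖fockPairing (α + β) f g‖ ≤ C * (‖f‖ * ‖g‖) := by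
  unfold FockPairingConverges fockPairing
  by_cases hσ : α + β < 2 * n
  · simpa only [if_pos hσ, taylorPoly, Finset.range_zero, Finset.sum_empty, sub_zero] using
      exists_rawPairing_sub_taylorPoly_bound hn (α := α) (β := β) (p := 0) (by simpa using hσ)
  · simp only [if_neg hσ]
    set p := ⌊|(α + β) / 2|⌋₊ + 1 with hp
    have half_lt : |(α + β) / 2| < p := by
      rw [hp]
      exact_mod_cast Nat.lt_floor_add_one _
    obtain ⟨C₁, hC₁, head_bound⟩ := exists_rawPairing_taylorPoly_bound n α β p
    obtain ⟨C₂, hC₂, tail_bound⟩ := exists_rawPairing_sub_taylorPoly_bound hn (α := α) (β := β)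
      (p := p) (by linarith [le_abs_self ((α + β) / 2), Nat.cast_nonneg (α := ℝ) n])
    refine ⟨C₁ + C₂, by positivity,
      fun f g => ⟨⟨(head_bound f g).1, (tail_bound f g).1⟩, ?_⟩⟩
    rw [add_mul]
    exact (norm_add_le _ _).trans (add_le_add (head_bound f g).2 (tail_bound f g).2)

end PairingBounds

section Sesquilinear

variable {n : ℕ} {σ : ℝ} {f f₁ f₂ g g₁ g₂ : Cn n → ℂ}

theorem rawIntegrand_swap (σ : ℝ) (f g : Cn n → ℂ) :
    rawIntegrand σ g f = fun z => conj (rawIntegrand σ f g z) := by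
  funext z
  simp only [rawIntegrand, map_mul, Complex.conj_conj, Complex.conj_ofReal, mul_comm (g z)]

theorem rawPairing_swap (σ : ℝ) (f g : Cn n → ℂ) :
    rawPairing σ g f = conj (rawPairing σ f g) := by
  rw [rawPairing, rawIntegrand_swap, integral_conj, rawPairing]

theorem fockPairing_swap (σ : ℝ) (f g : Cn n → ℂ) :
    fockPairing σ g f = conj (fockPairing σ f g) := by
  simp only [fockPairing, apply_ite conj, map_add, ← rawPairing_swap]

theorem integrable_rawIntegrand_swap (h : Integrable (rawIntegrand σ f g) (fockVol n)) :
    Integrable (rawIntegrand σ g f) (fockVol n) := by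
  rw [rawIntegrand_swap]
  exact (LinearIsometryEquiv.integrable_comp_iff Complex.conjLIE).2 h

theorem FockPairingConverges.swap (h : FockPairingConverges σ f g) :
    FockPairingConverges σ g f := by
  unfold FockPairingConverges at h ⊢
  split_ifs at h ⊢
  · exact integrable_rawIntegrand_swap h
  · exact h.imp integrable_rawIntegrand_swap integrable_rawIntegrand_swap

theorem rawPairing_add_left (h₁ : Integrable (rawIntegrand σ f₁ g) (fockVol n))
    (h₂ : Integrable (rawIntegrand σ f₂ g) (fockVol n)) :
    rawPairing σ (f₁ + f₂) g = rawPairing σ f₁ g + rawPairing σ f₂ g := by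
  rw [rawPairing, rawPairing, rawPairing, ← integral_add h₁ h₂]
  simp only [rawIntegrand, Pi.add_apply, add_mul]

theorem rawPairing_smul_left (σ : ℝ) (c : ℂ) (f g : Cn n → ℂ) :
    rawPairing σ (c • f) g = c * rawPairing σ f g := by
  simp only [rawPairing, ← integral_const_mul, rawIntegrand, Pi.smul_apply, smul_eq_mul, mul_assoc]

theorem fockPairing_add_left (hf₁ : ContDiff ℂ ⊤ f₁) (hf₂ : ContDiff ℂ ⊤ f₂)
    (h₁ : FockPairingConverges σ f₁ g) (h₂ : FockPairingConverges σ f₂ g) :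
    fockPairing σ (f₁ + f₂) g = fockPairing σ f₁ g + fockPairing σ f₂ g := by
  unfold FockPairingConverges at h₁ h₂
  unfold fockPairing
  split_ifs at h₁ h₂ ⊢
  · exact rawPairing_add_left h₁ h₂
  · rw [taylorHead_add hf₁ hf₂, taylorTail_add hf₁ hf₂, rawPairing_add_left h₁.1 h₂.1,
      rawPairing_add_left h₁.2 h₂.2]
    ring

theorem fockPairing_smul_left (σ : ℝ) (hf : ContDiff ℂ ⊤ f) (c : ℂ) (g : Cn n → ℂ) :
    fockPairing σ (c • f) g = c * fockPairing σ f g := by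
  unfold fockPairing
  split_ifs
  · exact rawPairing_smul_left σ c f g
  · rw [taylorHead_const_smul hf, taylorTail_const_smul hf, rawPairing_smul_left,
      rawPairing_smul_left, mul_add]

theorem fockPairing_add_right (hg₁ : ContDiff ℂ ⊤ g₁) (hg₂ : ContDiff ℂ ⊤ g₂)
    (h₁ : FockPairingConverges σ f g₁) (h₂ : FockPairingConverges σ f g₂) :
    fockPairing σ f (g₁ + g₂) = fockPairing σ f g₁ + fockPairing σ f g₂ := by
  rw [fockPairing_swap, fockPairing_add_left hg₁ hg₂ h₁.swap h₂.swap, map_add,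
    ← fockPairing_swap, ← fockPairing_swap]

theorem fockPairing_smul_right (σ : ℝ) (f : Cn n → ℂ) (hg : ContDiff ℂ ⊤ g) (c : ℂ) :
    fockPairing σ f (c • g) = conj c * fockPairing σ f g := by
  rw [fockPairing_swap, fockPairing_smul_left σ hg, map_mul, ← fockPairing_swap]

end Sesquilinear

/-- The `C₀(ℂⁿ)`-valued integrand `u ↦ conj f(u) e^{-|u|²} w_β e^{⟪·, r u⟫}`. By the reproducing
formula, its integral is the conjugate of `w_β` times the dilation `f(r ·)`. -/
noncomputable def dilationIntegrand {n : ℕ} (β : ℝ) (f : Cn n → ℂ) (r : ℝ) (u : Cn n) :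
    C₀(Cn n, ℂ) :=
  (conj (f u) * (Real.exp (-‖u‖ ^ 2) : ℝ) : ℂ) •
    weightedKernel n β (fun _ => 1) ((r : ℂ) • u)

section Density

variable {n : ℕ}

theorem exists_norm_weightedKernel_one_le (n : ℕ) (β : ℝ) : ∃ C : ℝ, 0 ≤ C ∧ ∀ z : Cn n,
    ‖weightedKernel n β (fun _ => 1) z‖ ≤ C * (Real.exp (‖z‖ ^ 2 / 2) * (1 + ‖z‖) ^ (-β)) := by
  obtain ⟨C, hC, hle⟩ := exists_one_add_rpow_mul_exp_le |-β| 0 (b := 1 / 2) (by norm_num)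
  refine ⟨C, hC.le, fun z => zeroAtInfty_norm_le (by positivity) fun u => ?_⟩
  have gaussian_le : (1 + ‖u - z‖) ^ |-β| * Real.exp (-‖u - z‖ ^ 2 / 2) ≤ C := by
    convert hle ‖u - z‖ (norm_nonneg _) using 3
    ring
  rw [weightedKernel_apply geometricGrowth_one, expGenFun_one, norm_fockWeight_mul, mul_comm,
    norm_exp_inner_mul_fockWeight, mul_left_comm C]
  refine mul_le_mul_of_nonneg_left ?_ (Real.exp_pos _).le
  rw [mul_comm C]
  exact (one_add_norm_rpow_mul_gaussian_sub_le (-β) u z).trans (by gcongr)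

theorem exists_norm_dilationIntegrand_le (n : ℕ) (β : ℝ) : ∃ C : ℝ, 0 ≤ C ∧
    ∀ (f : FockSpace n ∞ β) (r : ℝ), 0 ≤ r → r ≤ 1 → ∀ u : Cn n, ‖dilationIntegrand β f r u‖ ≤
      C * ‖f‖ * ((1 + ‖u‖) ^ |β| * Real.exp (0 * ‖u‖ - (1 - r ^ 2) / 2 * ‖u‖ ^ 2)) := by
  obtain ⟨C, hC, kernel_le⟩ := exists_norm_weightedKernel_one_le n β
  refine ⟨C, hC, fun f r hr0 hr1 u => ?_⟩
  have weight_pos := fockWeight_pos (-β) u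
  have norm_dilation : ‖(r : ℂ) • u‖ = r * ‖u‖ := by
    rw [norm_smul, Complex.norm_of_nonneg hr0]
  have f_le : ‖f u‖ * Real.exp (-‖u‖ ^ 2) ≤ ‖f‖ * fockWeight (-β) u := by
    rw [← fockWeight_mul_neg β u, ← mul_assoc, mul_comm ‖f u‖]
    exact mul_le_mul_of_nonneg_right (f.fockWeight_mul_norm_le u) weight_pos.le
  have power_le : (1 + r * ‖u‖) ^ (-β) ≤ (1 + ‖u‖) ^ (-β) * (1 + ‖u‖) ^ |β| := by
    rw [← abs_neg β]
    refine one_add_rpow_le_mul (by positivity) (norm_nonneg u) ?_ (-β)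
    rw [abs_le]
    constructor <;> nlinarith [norm_nonneg u]
  rw [dilationIntegrand, norm_smul, norm_mul, RCLike.norm_conj,
    Complex.norm_of_nonneg (Real.exp_pos _).le]
  calc _ ≤ ‖f‖ * fockWeight (-β) u *
        (C * (Real.exp ((r * ‖u‖) ^ 2 / 2) * ((1 + ‖u‖) ^ (-β) * (1 + ‖u‖) ^ |β|))) := by
        refine mul_le_mul f_le ((kernel_le _).trans ?_) (norm_nonneg _) (by positivity)
        rw [norm_dilation]
        gcongr
    _ = C * ‖f‖ * (((1 + ‖u‖) ^ (- -β) * (1 + ‖u‖) ^ (-β)) * ((1 + ‖u‖) ^ |β| *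
          (Real.exp (-‖u‖ ^ 2 / 2) * Real.exp ((r * ‖u‖) ^ 2 / 2)))) := by
        rw [fockWeight]
        ring
    _ = _ := by
        rw [← Real.exp_add, ← Real.rpow_add (by positivity), neg_add_cancel, Real.rpow_zero,
          one_mul]
        ring_nf

theorem integrable_dilationIntegrand {β : ℝ} (f : FockSpace n ∞ β) {r : ℝ} (hr0 : 0 ≤ r)
    (hr1 : r < 1) : Integrable (dilationIntegrand β f r) (fockVol n) := by
  obtain ⟨C, -, norm_le⟩ := exists_norm_dilationIntegrand_le n β
  have continuous_kernel := (continuous_weightedKernel (n := n) (β := β) geometricGrowth_one).comp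
    (continuous_const_smul (r : ℂ))
  have continuous_coeff :
      Continuous fun u => (conj (f u) * (Real.exp (-‖u‖ ^ 2) : ℝ) : ℂ) :=
    (Complex.continuous_conj.comp f.continuous).mul (by fun_prop)
  exact ((integrable_one_add_norm_rpow_mul_exp _ |β| 0 (by nlinarith)).const_mul _).mono'
    (continuous_coeff.smul continuous_kernel).aestronglyMeasurable
    (Eventually.of_forall (norm_le f r hr0 hr1.le))

theorem integral_dilationIntegrand_apply {β : ℝ} (f : FockSpace n ∞ β) {r : ℝ} (hr0 : 0 ≤ r)
    (hr1 : r < 1) (w : Cn n) :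
    (∫ u, dilationIntegrand β f r u ∂fockVol n) w =
      (fockWeight β w : ℂ) * conj (f ((r : ℂ) • w)) := by
  obtain ⟨γ, K, -, memFockOne_f⟩ := FockSpace.exists_memFockOne_of_top n β
  rw [← zeroAtInftyEval_apply, ← ContinuousLinearMap.integral_comp_comm _
    (integrable_dilationIntegrand f hr0 hr1), ← (memFockOne_f f).1.integral_mul_exp_inner,
    ← integral_conj, ← integral_const_mul]
  congr with u
  simp only [dilationIntegrand, map_smul, zeroAtInftyEval_apply,
    weightedKernel_apply geometricGrowth_one, expGenFun_one, smul_eq_mul, map_mul,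
    Complex.conj_ofReal, ← Complex.exp_conj, inner_smul_right, inner_conj_symm]
  ring

theorem fockWeight_le_two_rpow_mul_fockWeight_smul {r : ℝ} (hr : 1 / 2 ≤ r) (hr1 : r ≤ 1) (β : ℝ)
    (w : Cn n) : fockWeight β w ≤ 2 ^ |β| * fockWeight β ((r : ℂ) • w) := by
  have norm_dilation : ‖(r : ℂ) • w‖ = r * ‖w‖ := by
    rw [norm_smul, Complex.norm_of_nonneg (by linarith)]
  have dilation_le : r * ‖w‖ ≤ ‖w‖ := mul_le_of_le_one_left (norm_nonneg w) hr1
  have dilation_nonneg : 0 ≤ r * ‖w‖ := by positivity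
  have power_le : (1 + ‖w‖) ^ (-β) ≤ 2 ^ |β| * (1 + r * ‖w‖) ^ (-β) := by
    rcases le_total 0 β with hβ | hβ
    · exact (Real.rpow_le_rpow_of_nonpos (by positivity) (by linarith) (by linarith)).trans
        (le_mul_of_one_le_left (by positivity) (Real.one_le_rpow one_le_two (abs_nonneg β)))
    · rw [abs_of_nonpos hβ, ← Real.mul_rpow zero_le_two (by positivity)]
      exact Real.rpow_le_rpow (by positivity) (by nlinarith [norm_nonneg w]) (by linarith)
  rw [fockWeight, fockWeight, norm_dilation, mul_left_comm]
  gcongr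

theorem exists_forall_fockWeight_mul_norm_le {β : ℝ} (f : littleFock n β) {ε : ℝ} (hε : 0 < ε) :
    ∃ R : ℝ, 0 ≤ R ∧ ∀ w, R ≤ ‖w‖ → fockWeight β w * ‖f.1 w‖ ≤ ε := by
  have decay : ∀ᶠ w in cocompact (Cn n), ‖littleToZeroAtInfty n β f w‖ < ε :=
    (tendsto_zero_iff_norm_tendsto_zero.1
      (littleToZeroAtInfty n β f).zero_at_infty').eventually (gt_mem_nhds hε)
  rw [← Metric.cobounded_eq_cocompact, hasBasis_cobounded_norm.eventually_iff] at decay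
  obtain ⟨R, -, norm_lt⟩ := decay
  refine ⟨max R 0, le_max_right _ _, fun w hw => ?_⟩
  rw [← norm_fockWeight_mul]
  exact (norm_lt ((le_max_left R 0).trans hw)).le

theorem eventually_norm_dilation_sub_lt {f : Cn n → ℂ} (hf : Continuous f) (R : ℝ) {ε : ℝ}
    (hε : 0 < ε) :
    ∀ᶠ r : ℝ in 𝓝[<] 1, ∀ w ∈ Metric.closedBall 0 R, ‖f ((r : ℂ) • w) - f w‖ < ε := by
  refine nhdsWithin_le_nhds <| (isCompact_closedBall 0 R).eventually_forall_of_forall_eventually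
    fun w _ => ?_
  have continuous_difference :
      Continuous fun p : ℝ × Cn n => ‖f ((p.1 : ℂ) • p.2) - f p.2‖ := by fun_prop
  exact continuous_difference.continuousAt.eventually_lt continuousAt_const (by simpa using hε)

theorem eventually_fockWeight_mul_norm_dilation_sub_le {β : ℝ} (f : littleFock n β) {ε : ℝ}
    (hε : 0 < ε) :
    ∀ᶠ r : ℝ in 𝓝[<] 1, ∀ w, fockWeight β w * ‖f.1 ((r : ℂ) • w) - f.1 w‖ ≤ ε := by
  obtain ⟨R, hR, decay⟩ :=
    exists_forall_fockWeight_mul_norm_le f (ε := ε / (2 ^ |β| + 1)) (by positivity)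
  obtain ⟨M, hM, weight_le⟩ := exists_fockWeight_mul_exp_le n β 0
  simp only [zero_mul, Real.exp_zero, mul_one] at weight_le
  filter_upwards [Ioo_mem_nhdsLT (show (1 / 2 : ℝ) < 1 by norm_num),
    eventually_norm_dilation_sub_lt f.1.continuous (2 * R) (div_pos hε hM)]
    with r ⟨half_lt, lt_one⟩ close_on_ball w
  have weight_pos := fockWeight_pos β w
  rcases le_total ‖w‖ (2 * R) with hw | hw
  · calc _ ≤ M * (ε / M) := mul_le_mul (weight_le w)
          (close_on_ball w (mem_closedBall_zero_iff.2 hw)).le (norm_nonneg _) hM.le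
      _ = ε := mul_div_cancel₀ ε hM.ne'
  · have decay_dilation : fockWeight β ((r : ℂ) • w) * ‖f.1 ((r : ℂ) • w)‖ ≤ ε / (2 ^ |β| + 1) := by
      refine decay _ ?_
      rw [norm_smul, Complex.norm_of_nonneg (by linarith)]
      nlinarith
    calc _ ≤ fockWeight β w * ‖f.1 ((r : ℂ) • w)‖ + fockWeight β w * ‖f.1 w‖ := by
          rw [← mul_add]
          gcongr
          exact norm_sub_le _ _
      _ ≤ 2 ^ |β| * (ε / (2 ^ |β| + 1)) + ε / (2 ^ |β| + 1) := by
          refine add_le_add ?_ (decay w (by linarith))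
          refine (mul_le_mul_of_nonneg_right (fockWeight_le_two_rpow_mul_fockWeight_smul half_lt.le
            lt_one.le β w) (norm_nonneg _)).trans ?_
          rw [mul_assoc]
          gcongr
      _ = ε := by field_simp

theorem tendsto_integral_dilationIntegrand {β : ℝ} (f : littleFock n β) :
    Tendsto (fun r => ∫ u, dilationIntegrand β f.1 r u ∂fockVol n) (𝓝[<] 1)
      (𝓝 (star (littleToZeroAtInfty n β f))) := by
  refine Metric.nhds_basis_closedBall.tendsto_right_iff.2 fun ε hε => ?_
  filter_upwards [Ioo_mem_nhdsLT zero_lt_one,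
    eventually_fockWeight_mul_norm_dilation_sub_le f hε] with r ⟨hr0, hr1⟩ close
  rw [mem_closedBall_iff_norm]
  refine zeroAtInfty_norm_le hε.le fun w => ?_
  rw [ZeroAtInftyContinuousMap.sub_apply, ZeroAtInftyContinuousMap.star_apply,
    littleToZeroAtInfty_apply, integral_dilationIntegrand_apply f.1 hr0.le hr1, Complex.star_def,
    map_mul, Complex.conj_ofReal, ← mul_sub, ← map_sub, norm_fockWeight_mul, RCLike.norm_conj]
  exact close w

theorem eq_zero_of_forall_littleMonomial {β : ℝ} {μ : StrongDual ℂ (littleFock n β)}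
    (hμ : ∀ k z, μ (littleMonomial β k z) = 0) : μ = 0 := by
  obtain ⟨L, -, extends_μ⟩ := exists_conj_extension μ
  have L_kernel (z : Cn n) : L (weightedKernel n β (fun _ => 1) z) = 0 := by
    have kernel_sum := hasSum_comp_weightedKernel (β := β) geometricGrowth_one L z
    simp only [← star_littleToZeroAtInfty_littleMonomial, extends_μ, hμ, map_zero,
      mul_zero] at kernel_sum
    exact kernel_sum.unique hasSum_zero
  ext f
  have L_integral : ∀ᶠ r : ℝ in 𝓝[<] 1, L (∫ u, dilationIntegrand β f.1 r u ∂fockVol n) = 0 := by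
    filter_upwards [Ioo_mem_nhdsLT zero_lt_one] with r ⟨hr0, hr1⟩
    rw [← L.integral_comp_comm (integrable_dilationIntegrand f.1 hr0.le hr1)]
    simp only [dilationIntegrand, map_smul, L_kernel, smul_zero, integral_zero]
  have L_star : L (star (littleToZeroAtInfty n β f)) = 0 :=
    tendsto_nhds_unique ((L.continuous.tendsto _).comp (tendsto_integral_dilationIntegrand f))
      (tendsto_const_nhds.congr' (L_integral.mono fun r hr => hr.symm))
  rwa [extends_μ, map_eq_zero] at L_star

end Density

section Duality

variable {n : ℕ} {α β : ℝ}

theorem FockSpace.contDiff_of_top (f : FockSpace n ∞ β) : ContDiff ℂ ⊤ f.1 := by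
  obtain ⟨_, _, -, memFockOne⟩ := FockSpace.exists_memFockOne_of_top n β
  exact (memFockOne f).1.contDiff

theorem pairingCoeff_ne_zero (hn : 0 < n) (σ : ℝ) (k : ℕ) : (pairingCoeff n σ k : ℂ) ≠ 0 :=
  Complex.ofReal_ne_zero.2 (pairingCoeff_pos σ hn k).ne'

theorem fockPairing_littleMonomial (hn : 0 < n) (g : FockSpace n 1 α) (k : ℕ) (z : Cn n) :
    fockPairing (α + β) (littleMonomial β k z).1 g =
      (pairingCoeff n (α + β) k : ℂ) * (k.factorial * conj (homogPart k g z)) := by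
  obtain ⟨C, -, fockPairing_bound⟩ := exists_fockPairing_bound hn α β
  have converges := (fockPairing_bound (littleMonomial β k z).1 g).1
  have head_mem := g.memFockOne.taylorPoly α (⌊|(α + β) / 2|⌋₊ + 1)
  rw [littleMonomial_apply] at converges ⊢
  exact fockPairing_inner_pow g.memFockOne head_mem (g.memFockOne.sub head_mem) hn k z converges

/-- The bounded functional `⟨·, g⟩_{α+β}` on the little space `F^{∞,0}_β`. -/
noncomputable def pairingDual (hn : 0 < n) (α β : ℝ) (g : FockSpace n 1 α) :
    StrongDual ℂ (littleFock n β) :=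
  LinearMap.mkContinuousOfExistsBound
    { toFun := fun f => fockPairing (α + β) f.1 g
      map_add' := fun f₁ f₂ => by
        obtain ⟨C, -, fockPairing_bound⟩ := exists_fockPairing_bound hn α β
        exact fockPairing_add_left f₁.1.contDiff_of_top f₂.1.contDiff_of_top
          (fockPairing_bound f₁.1 g).1 (fockPairing_bound f₂.1 g).1
      map_smul' := fun c f => fockPairing_smul_left (α + β) f.1.contDiff_of_top c g } <| by
    obtain ⟨C, -, fockPairing_bound⟩ := exists_fockPairing_bound hn α β
    refine ⟨C * ‖g‖, fun f => (fockPairing_bound f.1 g).2.trans_eq ?_⟩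
    rw [mul_assoc, mul_comm ‖g‖]
    rfl

theorem pairingDual_apply (hn : 0 < n) (g : FockSpace n 1 α) (f : littleFock n β) :
    pairingDual hn α β g f = fockPairing (α + β) f.1 g :=
  rfl

theorem exists_norm_pairingDual_le (hn : 0 < n) (α β : ℝ) : ∃ C : ℝ, 0 ≤ C ∧
    ∀ g : FockSpace n 1 α, ‖pairingDual hn α β g‖ ≤ C * ‖g‖ := by
  obtain ⟨C, hC, fockPairing_bound⟩ := exists_fockPairing_bound hn α β
  refine ⟨C, hC, fun g => ContinuousLinearMap.opNorm_le_bound _ (by positivity) fun f => ?_⟩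
  rw [mul_assoc, mul_comm ‖g‖]
  exact (fockPairing_bound f.1 g).2

/-- The conjugate-linear map `g ↦ ⟨·, g⟩_{α+β}` of `F^1_α` into the dual of `F^{∞,0}_β`. -/
noncomputable def pairingDualMap (hn : 0 < n) (α β : ℝ) :
    FockSpace n 1 α →ₛₗ[starRingEnd ℂ] StrongDual ℂ (littleFock n β) where
  toFun := pairingDual hn α β
  map_add' g₁ g₂ := by
    obtain ⟨C, -, fockPairing_bound⟩ := exists_fockPairing_bound hn α β
    ext f
    exact fockPairing_add_right g₁.memFockOne.contDiff g₂.memFockOne.contDiff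
      (fockPairing_bound f.1 g₁).1 (fockPairing_bound f.1 g₂).1
  map_smul' c g := by
    ext f
    exact fockPairing_smul_right (α + β) f.1 g.memFockOne.contDiff c

theorem exists_pairingDual_eq (hn : 0 < n) (α β : ℝ) : ∃ C : ℝ, 0 ≤ C ∧
    ∀ μ : StrongDual ℂ (littleFock n β), ∃ g : FockSpace n 1 α, ‖g‖ ≤ C * ‖μ‖ ∧
      pairingDual hn α β g = μ := by
  obtain ⟨C, hC, kernel_bound⟩ := exists_integral_expGenFun_inv_pairingCoeff_le hn α β
  have growth := geometricGrowth_inv_pairingCoeff hn (α + β)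
  refine ⟨C, hC, fun μ => ?_⟩
  obtain ⟨L, norm_L_le, L_eq⟩ := exists_conj_extension μ
  obtain ⟨integrable, integral_le⟩ := integrable_comp_weightedKernel hC growth kernel_bound L
  have memFockOne : MemFockOne α fun z =>
      L (weightedKernel n β (fun k => (pairingCoeff n (α + β) k)⁻¹) z) :=
    ⟨(contDiff_comp_weightedKernel growth L).differentiable (by simp), integrable⟩
  refine ⟨memFockOne.toFockSpace, ?_, ?_⟩
  · rw [FockSpace.norm_eq_weightedL1Norm]
    exact integral_le.trans (mul_le_mul_of_nonneg_left norm_L_le hC)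
  · rw [← sub_eq_zero]
    refine eq_zero_of_forall_littleMonomial fun k z => ?_
    have homogPart_eq : homogPart k memFockOne.toFockSpace z = _ :=
      homogPart_comp_weightedKernel growth L k z
    have coeff_ne_zero := pairingCoeff_ne_zero hn (α + β) k
    have factorial_ne_zero : (k.factorial : ℂ) ≠ 0 := mod_cast k.factorial_ne_zero
    rw [sub_apply, sub_eq_zero, pairingDual_apply, fockPairing_littleMonomial hn, homogPart_eq,
      ← star_littleToZeroAtInfty_littleMonomial, L_eq, map_mul, Complex.conj_ofReal,
      Complex.conj_conj]
    push_cast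
    field_simp

theorem pairingDual_injective (hn : 0 < n) (α β : ℝ) :
    Function.Injective (pairingDual (n := n) hn α β) := by
  intro g₁ g₂ pairingDual_eq
  refine Subtype.ext (funext fun z => ?_)
  have homogPart_eq : (fun k => homogPart k g₁ z) = fun k => homogPart k g₂ z := by
    funext k
    have pairing_eq := DFunLike.congr_fun pairingDual_eq (littleMonomial β k z)
    rw [pairingDual_apply, pairingDual_apply, fockPairing_littleMonomial hn,
      fockPairing_littleMonomial hn] at pairing_eq
    have factorial_ne_zero : (k.factorial : ℂ) ≠ 0 := mod_cast k.factorial_ne_zero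
    exact (starRingEnd ℂ).injective <| mul_left_cancel₀ factorial_ne_zero <|
      mul_left_cancel₀ (pairingCoeff_ne_zero hn (α + β) k) pairing_eq
  have hasSum := g₁.memFockOne.hasSum_homogPart z
  rw [homogPart_eq] at hasSum
  exact hasSum.unique (g₂.memFockOne.hasSum_homogPart z)

end Duality

/-- `(F^{∞,0}_β)^* = F^1_α` with equivalent norms under the pairing `⟨·,·⟩_{α+β}`: the pairing
converges on `F^{∞,0}_β × F^1_α`, and `g ↦ ⟨·, g⟩_{α+β}` is a conjugate-linear bijection of `F^1_α`
onto the space of bounded linear functionals on `F^{∞,0}_β`, bounded above and below. -/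
theorem theorem5p8 (n : ℕ) (hn : 0 < n) (α β : ℝ) :
    (∀ (f : littleFock n β) (g : FockSpace n 1 α), FockPairingConverges (α + β) f.1 g) ∧
    ∃ Φ : FockSpace n 1 α ≃ₛₗ[starRingEnd ℂ] StrongDual ℂ (littleFock n β),
      (∀ (g : FockSpace n 1 α) (f : littleFock n β), Φ g f = fockPairing (α + β) f.1 g) ∧
      ∃ C : ℝ, 0 < C ∧ ∀ g : FockSpace n 1 α, C⁻¹ * ‖g‖ ≤ ‖Φ g‖ ∧ ‖Φ g‖ ≤ C * ‖g‖ := by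
  obtain ⟨_, -, fockPairing_bound⟩ := exists_fockPairing_bound hn α β
  obtain ⟨C₁, hC₁, norm_pairingDual_le⟩ := exists_norm_pairingDual_le hn α β
  obtain ⟨C₂, hC₂, exists_representative⟩ := exists_pairingDual_eq hn α β
  have injective := pairingDual_injective hn α β
  have surjective : Function.Surjective (pairingDual hn α β) := fun μ =>
    (exists_representative μ).imp fun _ => And.right
  refine ⟨fun f g => (fockPairing_bound f.1 g).1,
    LinearEquiv.ofBijective (pairingDualMap hn α β) ⟨injective, surjective⟩, fun _ _ => rfl,
    C₁ + C₂ + 1, by positivity, fun g => ⟨?_, ?_⟩⟩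
  · obtain ⟨g', norm_le, pairingDual_eq⟩ := exists_representative (pairingDual hn α β g)
    rw [injective pairingDual_eq] at norm_le
    rw [inv_mul_le_iff₀ (by positivity)]
    exact norm_le.trans (mul_le_mul_of_nonneg_right (by linarith)
      (pairingDual hn α β g).opNorm_nonneg)
  · exact (norm_pairingDual_le g).trans (mul_le_mul_of_nonneg_right (by linarith) (norm_nonneg g))
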